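/- For every $n\ge 1$ let $\boldsymbol d=\boldsymbol d^{(n)}=(d_1,\dots,d_n)$ be a sequence of non-negative integers with even sum $\ell_n=\sum_{i\in[n]}d_i$. Let $\mathrm{CM}_n(\boldsymbol d)$ be the configuration model: vertex $i\in[n]$ receives $d_i$ half-edges and the $\ell_n$ half-edges are paired uniformly at random; it is called simple if it has no self-loops and no multiple edges. Let $n_k$ be the number of vertices of degree $k$ and $D_n$ the degree of a uniformly chosen vertex. Assume that 1. $D_n$ converges in distribution to some (proper) random variable $D$; 2. $n_0=0$; 3. $n_1/\sqrt n\to\rho_1\in[0,\infty)$; 4. $n_2/n\to p_2\in[0,1)$; 5. $\mathbb E[D_n]\to d<\infty$; 6. $\nu_n=\mathbb E[D_n(D_n-1)]/\mathbb E[D_n]\to\nu<\infty$. Then $$\lim_{n\to\infty}\mathbb P\big(\mathrm{CM}_n(\boldsymbol d)\text{ is connected}\mid \mathrm{CM}_n(\boldsymbol d)\text{ is simple}\big)=\Big(\frac{d-2p_2}{d}\Big)^{1/2}\exp\Big(-\frac{\rho_1^2}{2(d-2p_2)}+\frac{p_2^2+dp_2}{d^2}\Big).$$ If moreover $\max_{i\in[n]}d_i=o(\sqrt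 n)$ (which holds in particular when $\mathbb E[D_n^2]\to\mathbb E[D^2]<\infty$), then the number $\mathscr N^C_n(\boldsymbol d)$ of connected simple graphs on the vertex set $[n]$ in which vertex $i$ has degree $d_i$ for every $i\in[n]$ satisfies $$\mathscr N^C_n(\boldsymbol d)=\frac{(\ell_n-1)!!}{\prod_{i\in[n]}d_i!}\Big(\frac{d-2p_2}{d}\Big)^{1/2}\exp\Big(-\frac{\nu}{2}-\frac{\nu^2}{4}-\frac{\rho_1^2}{2(d-2p_2)}+\frac{p_2^2+dp_2}{d^2}\Big)(1+o(1)).$$ -/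

import Mathlib

open Filter Topology MeasureTheory ProbabilityTheory
open scoped Nat BoundedContinuousFunction Asymptotics

namespace ConfigModel

/-- The total degree `ℓ_n` of a degree sequence on `n` vertices. -/
def totalDegree {n : ℕ} (d : Fin n → ℕ) : ℕ := ∑ v, d v

/-- The number `n_k` of vertices of degree `k`. -/
def numDegree {n : ℕ} (d : Fin n → ℕ) (k : ℕ) : ℕ :=
  (Finset.univ.filter fun v => d v = k).card

/-- The largest degree. -/
def maxDegree {n : ℕ} (d : Fin n → ℕ) : ℕ := Finset.univ.sup d

/-- `E[f(D_n)]`, where `D_n` is the degree of a uniformly chosen vertex. -/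
noncomputable def meanDegree {n : ℕ} (d : Fin n → ℕ) (f : ℕ → ℝ) : ℝ :=
  (∑ v, f (d v)) / (n : ℝ)

/-- `ν_n = E[D_n (D_n - 1)] / E[D_n]`. -/
noncomputable def nuParam {n : ℕ} (d : Fin n → ℕ) : ℝ :=
  meanDegree d (fun k => (k : ℝ) * ((k : ℝ) - 1)) / meanDegree d (fun k => (k : ℝ))

/-- The half-edges: vertex `v` carries `d v` of them. -/
abbrev HalfEdge {n : ℕ} (d : Fin n → ℕ) : Type := Σ v : Fin n, Fin (d v)

/-- A pairing (perfect matching) of the half-edges, i.e. a fixed-point-free involution: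
`σ h` is the half-edge that `h` is paired with. -/
abbrev Pairing {n : ℕ} (d : Fin n → ℕ) : Type :=
  {σ : Equiv.Perm (HalfEdge d) // ∀ h, σ h ≠ h ∧ σ (σ h) = h}

/-- All sets of pairings are events. -/
instance {n : ℕ} (d : Fin n → ℕ) : MeasurableSpace (Pairing d) := ⊤

/-- The law of the configuration model `CM_n(d)`: a uniformly random pairing of the half-edges. -/
noncomputable def law {n : ℕ} (d : Fin n → ℕ) : Measure (Pairing d) :=
  uniformOn Set.univ

/-- The adjacency relation of the multigraph that a pairing creates (multiplicities and self-loops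
are forgotten, which does not affect connectivity). -/
def adjGraph {n : ℕ} {d : Fin n → ℕ} (σ : Pairing d) : SimpleGraph (Fin n) :=
  SimpleGraph.fromRel fun u v => ∃ h : HalfEdge d, h.1 = u ∧ (σ.1 h).1 = v

/-- The event that the multigraph is connected. -/
def connectedEvent {n : ℕ} (d : Fin n → ℕ) : Set (Pairing d) :=
  {σ | (adjGraph σ).Connected}

/-- The event that the multigraph is simple: it has no self-loops, and no two different edges
join the same two vertices. -/
def simpleEvent {n : ℕ} (d : Fin n → ℕ) : Set (Pairing d) :=
  {σ | (∀ h : HalfEdge d, (σ.1 h).1 ≠ h.1) ∧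
    ∀ h h' : HalfEdge d, h.1 = h'.1 → (σ.1 h).1 = (σ.1 h').1 → h = h'}

/-- The number of connected simple graphs on the vertex set `Fin n` in which every vertex `v`
has degree `d v`. -/
noncomputable def numConnectedSimple {n : ℕ} (d : Fin n → ℕ) : ℕ :=
  Nat.card {G : SimpleGraph (Fin n) // G.Connected ∧ ∀ v, (G.neighborSet v).ncard = d v}

/-- The critical window for connectivity, with parameters `ρ₁`, `p₂` and mean `dbar`, for a sequence
of degree sequences with even total degrees. The probability measure `μ` is the law of the
limiting degree `D`. -/
structure CriticalWindow (d : (n : ℕ) → Fin n → ℕ) (ρ₁ p₂ dbar : ℝ) : Prop where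
  even_total : ∀ n, Even (totalDegree (d n))
  tendsto_law : ∃ μ : ProbabilityMeasure ℕ, ∀ f : ℕ →ᵇ ℝ,
    Tendsto (fun n => meanDegree (d n) f) atTop (𝓝 (∫ k, f k ∂(μ : Measure ℕ)))
  no_degree_zero : ∀ n, numDegree (d n) 0 = 0
  tendsto_degree_one :
    Tendsto (fun n : ℕ => (numDegree (d n) 1 : ℝ) / Real.sqrt (n : ℝ)) atTop (𝓝 ρ₁)
  tendsto_degree_two :
    Tendsto (fun n : ℕ => (numDegree (d n) 2 : ℝ) / (n : ℝ)) atTop (𝓝 p₂)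
  p₂_lt_one : p₂ < 1
  tendsto_mean : Tendsto (fun n => meanDegree (d n) (fun k => (k : ℝ))) atTop (𝓝 dbar)

end ConfigModel

/-! Let `V₀` be the set of vertices of degree one and two. Call a set of vertices closed if no edge
leaves it. If no non-empty subset of `V₀` is closed, then the graph can be disconnected only when
two components both contain a vertex of degree at least three, and this has probability tending to
zero (`pr_split_le`). So "simple and connected" may be replaced by `Good`: simple, with no closed
set inside `V₀`.

In a simple matching, let `R` be the largest closed subset of `V₀`. The matching then consists of a
simple matching on `R` and a good matching of the rest (`card_simple_eq_sum`). Removing a bounded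
number of vertices of degree one and two hardly changes the probability of a good matching
(`abs_pr_good_sdiff_above_sub_le`): deleting two points and joining their partners sends the uniform
matching to the uniform matching, and it preserves goodness outside a rare event. Hence P(simple) is
asymptotically `W` times P(good), where `W` is the weighted number of simple configurations on
closed subsets of `V₀` (`abs_pr_simple_sub_le`), and the conditional probability of connectedness
tends to `1 / W`.

The limit of `W` is an explicit series. The number of simple matchings on given numbers of vertices
of degree one and two satisfies a recurrence (`card_simple_eq_simpleCount`), so its generating
function solves a linear differential equation (`tsum_simpleCount`). With `x = ρ₁² / d` and `y = p₂
/ d` the series is `(1 - 2y)^(-1/2) * exp (x / (2 (1 - 2y)) - y - y²)` (`hasSum_simpleCount`). Here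
`x / (2 (1 - 2y))` comes from paths between two vertices of degree one, and the rest from the
cycles, of weight `(2y)^k / (2k)` for length `k`; the correction `- y - y²` removes the cycles of
length one and two, which simplicity forbids. Dominated convergence gives the limit of `W`.

Closed sets are controlled by a union bound. The probability that `b` of `a + b` points are matched
among themselves is a ratio of double factorials, and hence a ratio of integrals of `cos ^ a * sin ^
b` (`wallis_eq`). Under the integral, sums over sets of vertices factor into products over vertices:
a vertex of degree two contributes `cos² + sin² = 1`, and vertices of degree at least three yield
Gaussian decay.

The probability of simplicity itself is estimated by a sieve over loops and double edges. A lopsided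
local lemma bounds it below (`pr_simple_ge`), using only that `ν_n` stays bounded; this suffices for
the division in the conditional probability. The matching upper bound (`pr_simple_le`) needs maximal
degree `o(√n)`. Together they give the limit `exp (-ν/2 - ν²/4)`, and since every simple graph
arises from `∏ v, (d v)!` pairings (`card_pairings_of_graph`), the enumeration follows. -/

namespace ConfigModel

/-! ### Perfect matchings as involutions, merging, and the probability of a clash -/

section Pairings

open Finset Equiv
open scoped Classical

variable {H : Type*} [Fintype H] [DecidableEq H]

/-- The perfect matchings of `S`, as involutions of `H` whose support is `S`. -/
noncomputable def pairings (S : Finset H) : Finset (Perm H) :=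
  univ.filter fun σ => (∀ h, σ (σ h) = h) ∧ ∀ h, σ h ≠ h ↔ h ∈ S

theorem mem_pairings {S : Finset H} {σ : Perm H} :
    σ ∈ pairings S ↔ (∀ h, σ (σ h) = h) ∧ ∀ h, σ h ≠ h ↔ h ∈ S := by
  simp [pairings]

theorem pairings_invol {S : Finset H} {σ : Perm H} (hσ : σ ∈ pairings S) (h : H) :
    σ (σ h) = h := (mem_pairings.1 hσ).1 h

theorem pairings_ne {S : Finset H} {σ : Perm H} (hσ : σ ∈ pairings S) {h : H} (hh : h ∈ S) :
    σ h ≠ h := ((mem_pairings.1 hσ).2 h).2 hh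

theorem pairings_fix {S : Finset H} {σ : Perm H} (hσ : σ ∈ pairings S) {h : H} (hh : h ∉ S) :
    σ h = h := by
  by_contra hne
  exact hh (((mem_pairings.1 hσ).2 h).1 hne)

theorem pairings_mem {S : Finset H} {σ : Perm H} (hσ : σ ∈ pairings S) {h : H} :
    σ h ∈ S ↔ h ∈ S := by
  rw [← (mem_pairings.1 hσ).2 h, ← (mem_pairings.1 hσ).2 (σ h), pairings_invol hσ]
  exact ne_comm

/-- Remove `x` and `y` from a matching and join their former partners. -/
def merge (x y : H) (σ : Perm H) : Perm H :=
  -- Conjugation by `swap x (σ y)` exchanges the roles of `x` and `σ y`, so that `y` is matched to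
  -- `x` and `σ x` to `σ y`; the last factor deletes the pair `{x, y}`. If `σ x = y` the conjugation
  -- is trivial.
  swap x (σ y) * σ * swap x (σ y) * swap x y

/-- Removing `x` and `y` joins their partners and leaves all other pairs alone. -/
theorem merge_apply {S : Finset H} {σ : Perm H} (hσ : σ ∈ pairings S) {x y : H} (hx : x ∈ S)
    (hy : y ∈ S) (hxy : x ≠ y) (h : H) :
    merge x y σ h = if h = x ∨ h = y then h else if σ h = x then σ y else
      if σ h = y then σ x else σ h := by
  have i := pairings_invol hσ
  have hyy : σ y ≠ y := pairings_ne hσ hy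
  have hxx : σ x ≠ x := pairings_ne hσ hx
  simp only [merge, Perm.mul_apply, swap_apply_def]
  have e1 : ∀ u v, σ u = v ↔ u = σ v := fun u v => ⟨fun e => by rw [← e, i], fun e => by rw [e, i]⟩
  grind

theorem merge_mem {S : Finset H} {σ : Perm H} (hσ : σ ∈ pairings S) {x y : H} (hx : x ∈ S)
    (hy : y ∈ S) (hxy : x ≠ y) : merge x y σ ∈ pairings (S \ {x, y}) := by
  have i := pairings_invol hσ
  have hyy : σ y ≠ y := pairings_ne hσ hy
  have hxx : σ x ≠ x := pairings_ne hσ hx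
  have f := fun h => (mem_pairings.1 hσ).2 h
  rw [mem_pairings]
  constructor
  · intro h
    rw [merge_apply hσ hx hy hxy, merge_apply hσ hx hy hxy]
    grind
  · intro h
    rw [merge_apply hσ hx hy hxy, Finset.mem_sdiff, mem_insert, mem_singleton, ← f h]
    grind

/-- Every matching of `S \ {x, y}` arises from `|S| - 1` matchings of `S` by merging. -/
theorem card_merge {S : Finset H} {x y : H} (hx : x ∈ S) (hy : y ∈ S) (hxy : x ≠ y)
    (p : Perm H → Prop) :
    ((pairings S).filter fun σ => p (merge x y σ)).card =
      (S.card - 1) * ((pairings (S \ {x, y})).filter p).card := by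
  rw [← card_erase_of_mem hy, ← card_product]
  -- The lost information is the partner `b` of `y`, any point of `S` other than `y`. The inverse
  -- adds the pair `{x, y}` to the smaller matching and conjugates by `swap x b`; the value `b = x`
  -- leaves that pair intact.
  refine card_nbij' (fun σ => (σ y, merge x y σ))
    (fun bτ => swap x bτ.1 * (bτ.2 * swap x y) * swap x bτ.1) ?_ ?_ ?_ ?_
  · intro σ hσ
    simp only [coe_filter, Set.mem_ofPred_eq, coe_product, Set.mem_prod, mem_coe, mem_erase,
      mem_filter] at hσ ⊢
    exact ⟨⟨pairings_ne hσ.1 hy, (pairings_mem hσ.1).2 hy⟩, merge_mem hσ.1 hx hy hxy, hσ.2⟩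
  · rintro ⟨b, τ⟩ hb
    simp only [coe_filter, Set.mem_ofPred_eq, coe_product, Set.mem_prod, mem_coe, mem_erase,
      mem_filter] at hb ⊢
    obtain ⟨⟨hby, hbS⟩, hτ, hp⟩ := hb
    have i := pairings_invol hτ
    have f := fun h => (mem_pairings.1 hτ).2 h
    simp only [Finset.mem_sdiff, mem_insert, mem_singleton] at f
    have e1 : ∀ u v, τ u = v ↔ u = τ v := fun u v =>
      ⟨fun e => by rw [← e, i], fun e => by rw [e, i]⟩
    have hτx : τ x = x := by have := f x; grind
    have hτy : τ y = y := by have := f y; grind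
    have key : (swap x b * (τ * swap x y) * swap x b) y = b := by
      simp only [Perm.mul_apply, swap_apply_def]
      grind
    refine ⟨?_, ?_⟩
    · rw [mem_pairings]
      constructor
      · intro h
        have : ∀ ρ : Perm H, (∀ h, ρ (ρ h) = h) → ∀ h,
          (swap x b * ρ * swap x b) ((swap x b * ρ * swap x b) h) = h := by
          intro ρ hρ h
          simp [Perm.mul_apply, hρ]
        apply this
        intro h
        simp only [Perm.mul_apply, swap_apply_def]
        grind
      · intro h
        have := f h
        have := f (swap x b h)
        simp only [Perm.mul_apply]
        rw [Ne, swap_apply_eq_iff]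
        simp only [swap_apply_def] at *
        grind
    · have : merge x y (swap x b * (τ * swap x y) * swap x b) = τ := by
        unfold merge
        rw [key]
        ext h
        simp [Perm.mul_apply]
      rw [this]; exact hp
  · intro σ hσ
    simp only [coe_filter, Set.mem_ofPred_eq] at hσ
    ext h
    simp [merge, Perm.mul_apply]
  · rintro ⟨b, τ⟩ hb
    simp only [coe_product, Set.mem_prod, mem_coe, mem_erase, mem_filter] at hb
    obtain ⟨⟨hby, hbS⟩, hτ, hp⟩ := hb
    have f := fun h => (mem_pairings.1 hτ).2 h
    simp only [Finset.mem_sdiff, mem_insert, mem_singleton] at f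
    have hτx : τ x = x := by have := f x; grind
    have hτy : τ y = y := by have := f y; grind
    have key : (swap x b * (τ * swap x y) * swap x b) y = b := by
      simp only [Perm.mul_apply, swap_apply_def]
      grind
    simp only [key, Prod.mk.injEq, true_and]
    unfold merge
    rw [key]
    ext h
    simp [Perm.mul_apply]

/-- A matching of `S` under which `T` is closed is a matching of `T` and one of `S \ T`. -/
theorem card_closed {S T : Finset H} (hTS : T ⊆ S) (p : Perm H → Prop) :
    ((pairings S).filter fun σ => (∀ h ∈ T, σ h ∈ T) ∧ p σ).card =
      ((pairings T ×ˢ pairings (S \ T)).filter fun στ => p (στ.1 * στ.2)).card := by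
  symm
  refine card_bij (fun στ _ => στ.1 * στ.2) ?_ ?_ ?_
  · rintro ⟨σ, τ⟩ h
    simp only [mem_filter, mem_product] at h ⊢
    obtain ⟨⟨hσ, hτ⟩, hp⟩ := h
    have fσ := fun h => (mem_pairings.1 hσ).2 h
    have fτ := fun h => (mem_pairings.1 hτ).2 h
    have iσ := pairings_invol hσ
    have iτ := pairings_invol hτ
    have mσ := fun h => pairings_mem hσ (h := h)
    have mτ := fun h => pairings_mem hτ (h := h)
    simp only [Finset.mem_sdiff] at fτ mτ
    have hT : ∀ h ∈ T, τ h = h := by grind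
    refine ⟨?_, ?_, hp⟩
    · rw [mem_pairings]
      refine ⟨fun h => ?_, fun h => ?_⟩
      · simp only [Perm.mul_apply]; grind
      · have := @hTS h
        simp only [Perm.mul_apply]; grind
    · intro h hh
      simp only [Perm.mul_apply]; grind
  · rintro ⟨σ, τ⟩ h ⟨σ', τ'⟩ h' e
    simp only [mem_filter, mem_product] at h h'
    obtain ⟨⟨hσ, hτ⟩, hp⟩ := h
    obtain ⟨⟨hσ', hτ'⟩, hp'⟩ := h'
    have eh : ∀ h, σ (τ h) = σ' (τ' h) := fun h => by
      have := congrArg (fun ρ : Perm H => ρ h) e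
      simpa [Perm.mul_apply] using this
    have fτ := fun h hh => pairings_fix hτ (h := h) hh
    have fτ' := fun h hh => pairings_fix hτ' (h := h) hh
    have fσ := fun h hh => pairings_fix hσ (h := h) hh
    have fσ' := fun h hh => pairings_fix hσ' (h := h) hh
    have mτ := fun h => pairings_mem hτ (h := h)
    have mτ' := fun h => pairings_mem hτ' (h := h)
    simp only [Finset.mem_sdiff] at fτ fτ' mτ mτ'
    have e1 : σ = σ' := by
      ext h
      by_cases hh : h ∈ T
      · have := eh h; rw [fτ h (by simp [hh]), fτ' h (by simp [hh])] at this; exact this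
      · rw [fσ h hh, fσ' h hh]
    subst e1
    have e2 : τ = τ' := by
      ext h
      exact σ.injective (eh h)
    rw [e2]
  · intro ρ hρ
    simp only [mem_filter] at hρ
    obtain ⟨hρ, hT, hp⟩ := hρ
    have i := pairings_invol hρ
    have f := fun h => (mem_pairings.1 hρ).2 h
    have hT' : ∀ h, ρ h ∈ T ↔ h ∈ T := fun h => ⟨fun hh => by rw [← i h]; exact hT _ hh, hT h⟩
    let σf : H → H := fun h => if h ∈ T then ρ h else h
    have σi : Function.Involutive σf := by intro h; simp only [σf]; grind
    let τf : H → H := fun h => if h ∈ T then h else ρ h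
    have τi : Function.Involutive τf := by intro h; simp only [τf]; grind
    have e : σi.toPerm * τi.toPerm = ρ := by
      ext h
      simp only [Perm.mul_apply, Function.Involutive.coe_toPerm, σf, τf]
      grind
    refine ⟨(σi.toPerm, τi.toPerm), ?_, e⟩
    simp only [mem_filter, mem_product, mem_pairings, Function.Involutive.coe_toPerm]
    refine ⟨⟨⟨σi, fun h => ?_⟩, ⟨τi, fun h => ?_⟩⟩, by rw [e]; exact hp⟩
    · have := @hTS h
      simp only [σf]; grind
    · simp only [τf, Finset.mem_sdiff]; grind

/-- The number of perfect matchings of a set of `L` points, for even `L`. -/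
def matchingCount (L : ℕ) : ℕ := (L - 1)‼

theorem matchingCount_zero : matchingCount 0 = 1 := rfl

theorem matchingCount_add_two {L : ℕ} (hL : Even L) :
    matchingCount (L + 2) = (L + 1) * matchingCount L := by
  obtain ⟨k, rfl⟩ := hL
  cases k with
  | zero => rfl
  | succ k =>
    have : k + 1 + (k + 1) + 2 - 1 = (2 * k + 1) + 2 := by omega
    have h2 : k + 1 + (k + 1) - 1 = 2 * k + 1 := by omega
    rw [matchingCount, matchingCount, this, h2, Nat.doubleFactorial_add_two]
    congr 1
    omega

theorem matchingCount_pos (L : ℕ) : 0 < matchingCount L := Nat.doubleFactorial_pos _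

theorem card_pairings_eq_mul {S : Finset H} {x y : H} (hx : x ∈ S) (hy : y ∈ S) (hxy : x ≠ y) :
    (pairings S).card = (S.card - 1) * (pairings (S \ {x, y})).card := by
  simpa using card_merge hx hy hxy (fun _ => True)

theorem card_sdiff_pair {S : Finset H} {x y : H} (hx : x ∈ S) (hy : y ∈ S) (hxy : x ≠ y) :
    (S \ {x, y}).card + 2 = S.card := by
  have h : ({x, y} : Finset H) ⊆ S := by
    intro z hz; simp only [mem_insert, mem_singleton] at hz; rcases hz with rfl | rfl <;> assumption
  have := card_sdiff_add_card_eq_card h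
  rwa [card_pair hxy] at this

theorem card_pairings {S : Finset H} (hS : Even S.card) :
    (pairings S).card = matchingCount S.card := by
  induction hn : S.card using Nat.strong_induction_on generalizing S with
  | _ n ih =>
    rcases Nat.lt_or_ge n 2 with h2 | h2
    · have : S = ∅ := by
        rw [← card_eq_zero]; obtain ⟨k, hk⟩ := hS; omega
      subst this
      simp only [card_empty] at hn
      subst hn
      rw [matchingCount_zero, card_eq_one]
      refine ⟨1, ?_⟩
      ext σ
      simp only [mem_pairings, notMem_empty, iff_false, not_not, mem_singleton]
      constructor
      · rintro ⟨-, h⟩; ext z; simp [h z]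
      · rintro rfl; simp
    · obtain ⟨x, hx, y, hy, hxy⟩ := one_lt_card.1 (by omega : 1 < S.card)
      have hc := card_sdiff_pair hx hy hxy
      have he : Even (S \ {x, y}).card := by
        rw [← hc] at hS; exact (Nat.even_add.1 hS).2 even_two
      rw [card_pairings_eq_mul hx hy hxy, ih _ (by omega) he rfl, ← hn, ← hc,
        matchingCount_add_two he]
      rfl

theorem card_pairings_pos {S : Finset H} (hS : Even S.card) : 0 < (pairings S).card := by
  rw [card_pairings hS]; exact matchingCount_pos _

theorem pairings_pair {x y : H} (hxy : x ≠ y) : pairings ({x, y} : Finset H) = {swap x y} := by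
  have h1 : (pairings ({x, y} : Finset H)).card = 1 := by
    rw [card_pairings (by simp [card_pair hxy]), card_pair hxy]; rfl
  obtain ⟨σ, hσ⟩ := card_eq_one.1 h1
  rw [hσ]
  have : swap x y ∈ pairings ({x, y} : Finset H) := by
    rw [mem_pairings]
    refine ⟨fun h => by simp, fun h => ?_⟩
    simp only [mem_insert, mem_singleton, swap_apply_def]
    grind
  rw [hσ, mem_singleton] at this
  rw [this]

/-- Matchings of `S` that contain the pair `{x, y}` are matchings of `S \ {x, y}`. -/
theorem card_apply_eq {S : Finset H} {x y : H} (hx : x ∈ S) (hy : y ∈ S) (hxy : x ≠ y)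
    (p : Perm H → Prop) :
    ((pairings S).filter fun σ => σ x = y ∧ p σ).card =
      ((pairings (S \ {x, y})).filter fun τ => p (swap x y * τ)).card := by
  have hT : ({x, y} : Finset H) ⊆ S := by
    intro z hz; simp only [mem_insert, mem_singleton] at hz; rcases hz with rfl | rfl <;> assumption
  have h := card_closed hT p
  rw [pairings_pair hxy] at h
  have e : ((pairings S).filter fun σ => σ x = y ∧ p σ) =
      (pairings S).filter fun σ => (∀ h ∈ ({x, y} : Finset H), σ h ∈ ({x, y} : Finset H)) ∧ p σ := by
    refine filter_congr fun σ hσ => and_congr_left fun _ => ?_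
    have := pairings_ne hσ hx
    have := pairings_ne hσ hy
    have := pairings_invol hσ x
    simp only [mem_insert, mem_singleton]
    grind
  rw [e, h, singleton_product, filter_map, card_map]
  rfl

/-- The probability of `p` for a uniformly random perfect matching of `S`. -/
noncomputable def pr (S : Finset H) (p : Perm H → Prop) : ℝ :=
  ((pairings S).filter p).card / (pairings S).card

theorem pr_def (S : Finset H) (p : Perm H → Prop) [DecidablePred p] :
    pr S p = ((pairings S).filter p).card / (pairings S).card := by
  unfold pr; congr!

theorem pr_nonneg (S : Finset H) (p : Perm H → Prop) : 0 ≤ pr S p := by unfold pr; positivity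

theorem pr_mono {S : Finset H} {p q : Perm H → Prop} (h : ∀ σ ∈ pairings S, p σ → q σ) :
    pr S p ≤ pr S q := by
  unfold pr
  gcongr ?_ / _
  exact_mod_cast card_le_card fun σ hσ => by
    rw [mem_filter] at hσ ⊢; exact ⟨hσ.1, h σ hσ.1 hσ.2⟩

theorem pr_congr {S : Finset H} {p q : Perm H → Prop} (h : ∀ σ ∈ pairings S, p σ ↔ q σ) :
    pr S p = pr S q :=
  le_antisymm (pr_mono fun σ hσ => (h σ hσ).1) (pr_mono fun σ hσ => (h σ hσ).2)

theorem pr_le_one (S : Finset H) (p : Perm H → Prop) : pr S p ≤ 1 := by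
  unfold pr
  apply div_le_one_of_le₀ _ (by positivity)
  exact_mod_cast card_filter_le _ _

theorem pr_true {S : Finset H} (hS : Even S.card) : pr S (fun _ => True) = 1 := by
  unfold pr
  rw [filter_true, div_self]
  exact_mod_cast (card_pairings_pos hS).ne'

theorem pr_and_add_and_not (S : Finset H) (p q : Perm H → Prop) :
    pr S (fun σ => p σ ∧ q σ) + pr S (fun σ => p σ ∧ ¬ q σ) = pr S p := by
  rw [pr_def, pr_def, pr_def, ← add_div]
  congr 1
  rw [← filter_filter, ← filter_filter]
  exact_mod_cast card_filter_add_card_filter_not (s := (pairings S).filter p) q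

theorem pr_or_le (S : Finset H) (p q : Perm H → Prop) :
    pr S (fun σ => p σ ∨ q σ) ≤ pr S p + pr S q := by
  rw [pr_def, pr_def, pr_def, ← add_div, filter_or]
  gcongr
  exact_mod_cast card_union_le _ _

theorem pr_exists_le {ι : Type*} (S : Finset H) (I : Finset ι) (p : ι → Perm H → Prop) :
    pr S (fun σ => ∃ i ∈ I, p i σ) ≤ ∑ i ∈ I, pr S (p i) := by
  induction I using Finset.induction_on with
  | empty => simp [pr]
  | insert i I hi ih =>
    rw [sum_insert hi]
    calc _ ≤ pr S (fun σ => p i σ ∨ ∃ i ∈ I, p i σ) := pr_mono (by simp)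
      _ ≤ _ := (pr_or_le _ _ _).trans (by gcongr)

theorem pr_le_add (S : Finset H) (p q : Perm H → Prop) :
    pr S p ≤ pr S q + pr S (fun σ => p σ ∧ ¬ q σ) := by
  rw [← pr_and_add_and_not S p q]
  gcongr
  exact pr_mono fun σ _ h => h.2

theorem one_lt_card_of_mem {S : Finset H} {x y : H} (hx : x ∈ S) (hy : y ∈ S) (hxy : x ≠ y) :
    1 < S.card := one_lt_card.2 ⟨x, hx, y, hy, hxy⟩

/-- Merging has fibres of constant size, so it transports the uniform matching of `S` to the uniform
matching of `S \ {x, y}`. This coupling is the tool for all comparisons before and after the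
deletion of two points. -/
theorem pr_merge {S : Finset H} {x y : H} (hx : x ∈ S) (hy : y ∈ S) (hxy : x ≠ y)
    (p : Perm H → Prop) : pr S (fun σ => p (merge x y σ)) = pr (S \ {x, y}) p := by
  unfold pr
  rw [card_merge hx hy hxy, card_pairings_eq_mul hx hy hxy]
  have := one_lt_card_of_mem hx hy hxy
  have : ((S.card - 1 : ℕ) : ℝ) ≠ 0 := by
    exact_mod_cast (by omega : S.card - 1 ≠ 0)
  push_cast
  rw [mul_div_mul_left _ _ this]

theorem pr_apply {S : Finset H} {x y : H} (hx : x ∈ S) (hy : y ∈ S) (hxy : x ≠ y)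
    (p : Perm H → Prop) :
    pr S (fun σ => σ x = y ∧ p σ) =
      pr (S \ {x, y}) (fun τ => p (swap x y * τ)) / ((S.card : ℝ) - 1) := by
  rw [pr_def, pr_def, card_apply_eq hx hy hxy, card_pairings_eq_mul hx hy hxy]
  have := one_lt_card_of_mem hx hy hxy
  push_cast [Nat.cast_sub this.le]
  rw [div_div, mul_comm]

theorem swap_mul_apply_eq {S : Finset H} {x a y b : H} {τ : Perm H} (hτ : τ ∈ pairings (S \ {x, a}))
    (hb : b ∉ ({x, a} : Finset H)) (hy : y ∉ ({x, a} : Finset H)) (hyS : y ∈ S) :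
    (swap x a * τ) y = b ↔ τ y = b := by
  have h := (pairings_mem hτ (h := y)).2 (by rw [Finset.mem_sdiff]; exact ⟨hyS, hy⟩)
  simp only [Finset.mem_sdiff, mem_insert, mem_singleton] at h hy hb
  simp only [Perm.mul_apply, swap_apply_def]
  grind

theorem pr_apply_two {S : Finset H} {x a y b : H} (hS : ∀ z ∈ [x, a, y, b], z ∈ S)
    (hd : [x, a, y, b].Nodup) (p : Perm H → Prop) :
    pr S (fun σ => σ x = a ∧ σ y = b ∧ p σ) =
      pr ((S \ {x, a}) \ {y, b}) (fun τ => p (swap x a * (swap y b * τ))) /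
        (((S.card : ℝ) - 1) * ((S.card : ℝ) - 3)) := by
  simp only [List.nodup_cons, List.mem_cons, List.not_mem_nil, List.forall_mem_cons] at hS hd
  have hc := card_sdiff_pair (S := S) (x := x) (y := a) (by grind) (by grind) (by grind)
  have e : pr (S \ {x, a}) (fun τ => (swap x a * τ) y = b ∧ p (swap x a * τ)) =
      pr (S \ {x, a}) (fun τ => τ y = b ∧ p (swap x a * τ)) :=
    pr_congr fun τ hτ => and_congr_left fun _ =>
      swap_mul_apply_eq hτ (by simp; grind) (by simp; grind) (by grind)
  rw [pr_apply (by grind) (by grind) (by grind) (fun σ => σ y = b ∧ p σ), e,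
    pr_apply (by simp; grind) (by simp; grind) (by grind)]
  have : ((S \ {x, a}).card : ℝ) = S.card - 2 := by rw [← hc]; push_cast; ring
  rw [this, div_div, mul_comm]
  ring_nf

theorem pr_apply_two_le {S : Finset H} {x a y b : H} (hS : ∀ z ∈ [x, a, y, b], z ∈ S)
    (hd : [x, a, y, b].Nodup) (hL : 4 ≤ S.card) :
    pr S (fun σ => σ x = a ∧ σ y = b) ≤ 1 / (((S.card : ℝ) - 1) * ((S.card : ℝ) - 3)) := by
  have h := pr_apply_two hS hd (fun _ => True)
  simp only [and_true] at h
  have : (4 : ℝ) ≤ S.card := by exact_mod_cast hL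
  rw [h]
  gcongr
  · exact mul_nonneg (by linarith) (by linarith)
  · exact pr_le_one _ _

theorem pr_apply_three_le {S : Finset H} {x a y b c e : H}
    (hS : ∀ z ∈ [x, a, y, b, c, e], z ∈ S) (hd : [x, a, y, b, c, e].Nodup) (hL : 6 ≤ S.card) :
    pr S (fun σ => σ x = a ∧ σ y = b ∧ σ c = e) ≤
      1 / (((S.card : ℝ) - 1) * ((S.card : ℝ) - 3) * ((S.card : ℝ) - 5)) := by
  simp only [List.nodup_cons, List.mem_cons, List.not_mem_nil, List.forall_mem_cons] at hS hd
  have hL' : (6 : ℝ) ≤ S.card := by exact_mod_cast hL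
  have hc := card_sdiff_pair (S := S) (x := x) (y := a) (by grind) (by grind) (by grind)
  have e1 : pr (S \ {x, a}) (fun τ => (swap x a * τ) y = b ∧ (swap x a * τ) c = e) =
      pr (S \ {x, a}) (fun τ => τ y = b ∧ τ c = e) :=
    pr_congr fun τ hτ => and_congr
      (swap_mul_apply_eq hτ (by simp; grind) (by simp; grind) (by grind))
      (swap_mul_apply_eq hτ (by simp; grind) (by simp; grind) (by grind))
  rw [pr_apply (by grind) (by grind) (by grind) (fun σ => σ y = b ∧ σ c = e), e1]
  have h2 := pr_apply_two_le (S := S \ {x, a}) (x := y) (a := b) (y := c) (b := e)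
    (by simp; grind) (by simp; grind) (by omega)
  have : ((S \ {x, a}).card : ℝ) = S.card - 2 := by rw [← hc]; push_cast; ring
  rw [this] at h2
  calc _ ≤ 1 / ((S.card - 2 - 1) * (S.card - 2 - 3)) / ((S.card : ℝ) - 1) := by
        gcongr; linarith
    _ = _ := by rw [div_div]; ring_nf

variable {V : Type*}

/-- Ordered pairs of distinct points of `S` over the same vertex. -/
noncomputable def siblings (π : H → V) (S : Finset H) : Finset (H × H) :=
  (S ×ˢ S).filter fun z => z.1 ≠ z.2 ∧ π z.1 = π z.2

theorem mem_siblings {π : H → V} {S : Finset H} {z : H × H} :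
    z ∈ siblings π S ↔ (z.1 ∈ S ∧ z.2 ∈ S) ∧ z.1 ≠ z.2 ∧ π z.1 = π z.2 := by
  simp [siblings]

/-- Joining the partners of `x` and `y` may create a loop or a multiple edge. -/
def Clash (π : H → V) (x y : H) (σ : Perm H) : Prop :=
  σ x = y ∨ π (σ x) = π (σ y) ∨
    -- An edge that is already present and would be parallel to the new one; `σ c ≠ c` says that `c`
    -- belongs to the matched set.
    ∃ c, c ∉ [x, y, σ x, σ y] ∧ π c = π (σ x) ∧ σ c ≠ c ∧ π (σ c) = π (σ y)

/-- Upper bound for the probability of a clash, with `L` points and `q` sibling pairs. -/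
noncomputable def clashBound (L q : ℝ) : ℝ :=
  1 / (L - 1) + q / ((L - 1) * (L - 3)) + q ^ 2 / ((L - 1) * (L - 3) * (L - 5))

/-- A union bound over the three kinds of clash. Partners at the same vertex form one of `q` sibling
pairs and prescribe two matched pairs. A parallel edge gives two sibling pairs `(σ x, c)` and `(σ y,
σ c)`, hence at most `q ^ 2` choices that each prescribe three matched pairs. -/
theorem pr_clash_le {π : H → V} {S : Finset H} {x y : H} (hx : x ∈ S) (hy : y ∈ S) (hxy : x ≠ y)
    (hL : 6 ≤ S.card) :
    pr S (Clash π x y) ≤ clashBound S.card (siblings π S).card := by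
  have hL' : (6 : ℝ) ≤ S.card := by exact_mod_cast hL
  set O := siblings π S with hO
  let I₂ := O.filter fun z => [x, z.1, y, z.2].Nodup
  let I₃ := (O ×ˢ O).filter fun z => [x, z.1.1, y, z.2.1, z.1.2, z.2.2].Nodup
  have h1 : pr S (fun σ => σ x = y) ≤ 1 / ((S.card : ℝ) - 1) := by
    have h := pr_apply hx hy hxy (fun _ => True)
    simp only [and_true] at h
    rw [h]
    gcongr
    · linarith
    · exact pr_le_one _ _
  have h2 : pr S (fun σ => ∃ z ∈ I₂, σ x = z.1 ∧ σ y = z.2) ≤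
      O.card / (((S.card : ℝ) - 1) * ((S.card : ℝ) - 3)) := by
    refine (pr_exists_le _ _ _).trans ((sum_le_card_nsmul _ _ _ fun z hz => ?_).trans
      (b := I₂.card • (1 / (((S.card : ℝ) - 1) * ((S.card : ℝ) - 3)))) ?_)
    · simp only [I₂, mem_filter, hO, mem_siblings] at hz
      exact pr_apply_two_le (by simp; tauto) hz.2 (by omega)
    · rw [nsmul_eq_mul, mul_one_div]
      have : 0 ≤ ((S.card : ℝ) - 1) * ((S.card : ℝ) - 3) := mul_nonneg (by linarith) (by linarith)
      gcongr
      exact filter_subset _ _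
  have h3 : pr S (fun σ => ∃ z ∈ I₃, σ x = z.1.1 ∧ σ y = z.2.1 ∧ σ z.1.2 = z.2.2) ≤
      (O.card : ℝ) ^ 2 / (((S.card : ℝ) - 1) * ((S.card : ℝ) - 3) * ((S.card : ℝ) - 5)) := by
    refine (pr_exists_le _ _ _).trans ((sum_le_card_nsmul _ _ _ fun z hz => ?_).trans
      (b := I₃.card • (1 / (((S.card : ℝ) - 1) * ((S.card : ℝ) - 3) * ((S.card : ℝ) - 5)))) ?_)
    · simp only [I₃, mem_filter, hO, mem_product, mem_siblings] at hz
      exact pr_apply_three_le (by simp; tauto) hz.2 hL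
    · rw [nsmul_eq_mul, mul_one_div]
      have : 0 ≤ ((S.card : ℝ) - 1) * ((S.card : ℝ) - 3) * ((S.card : ℝ) - 5) :=
        mul_nonneg (mul_nonneg (by linarith) (by linarith)) (by linarith)
      gcongr
      calc (I₃.card : ℝ) ≤ (O ×ˢ O).card := by exact_mod_cast card_filter_le _ _
        _ = _ := by rw [card_product]; push_cast; ring
  calc pr S (Clash π x y) ≤ pr S (fun σ => σ x = y ∨ ((∃ z ∈ I₂, σ x = z.1 ∧ σ y = z.2) ∨
        ∃ z ∈ I₃, σ x = z.1.1 ∧ σ y = z.2.1 ∧ σ z.1.2 = z.2.2)) := by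
        refine pr_mono fun σ hσ h => ?_
        have hi := pairings_invol hσ
        have hm := fun h => pairings_mem hσ (h := h)
        have hxx := pairings_ne hσ hx
        have hyy := pairings_ne hσ hy
        have hf := fun h => (mem_pairings.1 hσ).2 h
        by_cases hxy' : σ x = y
        · exact Or.inl hxy'
        have e1 : ∀ u v, σ u = v ↔ u = σ v := fun u v =>
          ⟨fun e => by rw [← e, hi], fun e => by rw [e, hi]⟩
        rcases h with h | h | ⟨c, hc, h1, h2, h3⟩
        · exact Or.inl h
        · refine Or.inr (Or.inl ⟨(σ x, σ y), ?_, rfl, rfl⟩)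
          simp only [I₂, mem_filter, hO, mem_siblings, List.nodup_cons, List.mem_cons,
            List.not_mem_nil]
          grind
        · refine Or.inr (Or.inr ⟨((σ x, c), (σ y, σ c)), ?_, rfl, rfl, rfl⟩)
          simp only [List.mem_cons, List.not_mem_nil] at hc
          simp only [I₃, mem_filter, hO, mem_product, mem_siblings, List.nodup_cons, List.mem_cons,
            List.not_mem_nil]
          grind
    _ ≤ _ := by
        refine (pr_or_le _ _ _).trans ?_
        rw [clashBound, add_assoc]
        exact add_le_add h1 ((pr_or_le _ _ _).trans (add_le_add h2 h3))

end Pairings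

end ConfigModel

namespace ConfigModel

/-! ### Sieve inequalities: a lopsided local lemma and an upper bound -/

section Sieve

open Finset

variable {ι : Type*} [DecidableEq ι] {P : Finset ι → ℝ} {A : ι → Finset ι → ℝ} {p : ι → ℝ}

/-- When the events of `T₁` are added one at a time to the avoided set, each costs `A j` at a set
containing `T₂`, and `A j` is antitone in the avoided set. -/
theorem sieve_union_le (hins : ∀ T i, i ∉ T → P (insert i T) = P T - A i T)
    (hmono : ∀ i T T', T ⊆ T' → A i T' ≤ A i T) (T₁ T₂ : Finset ι) (h : Disjoint T₁ T₂) :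
    P T₂ ≤ P (T₁ ∪ T₂) + ∑ j ∈ T₁, A j T₂ := by
  induction T₁ using Finset.induction_on with
  | empty => simp
  | insert i T hi ih =>
    rw [disjoint_insert_left] at h
    have hn : i ∉ T ∪ T₂ := by simp [hi, h.1]
    rw [insert_union, hins _ _ hn, sum_insert hi]
    have := hmono i T₂ (T ∪ T₂) subset_union_right
    linarith [ih h.2]

/-- The conditional bound behind the lopsided local lemma: `P T` is the probability to avoid all
events in `T`, and `A i T` the probability that `i` occurs while `T` is avoided. -/
theorem local_lemma_cond {conf : ι → ι → Prop} [∀ i, DecidablePred (conf i)] {I : Finset ι} {δ : ℝ}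
    (hP : ∀ T, 0 ≤ P T) (hins : ∀ T i, i ∉ T → P (insert i T) = P T - A i T)
    (hmono : ∀ i T T', T ⊆ T' → A i T' ≤ A i T) (hp : ∀ i, 0 ≤ p i)
    (hneg : ∀ i ∈ I, ∀ T ⊆ I, (∀ j ∈ T, ¬ conf i j) → A i T ≤ p i * P T)
    (hδ0 : 0 ≤ δ) (hδ1 : δ ≤ 1 / 4) (hδ : ∀ i ∈ I, ∑ j ∈ I.filter (conf i), p j ≤ δ)
    (T : Finset ι) (hT : T ⊆ I) : ∀ i ∈ I, A i T ≤ (1 + 4 * δ) * (p i * P T) := by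
  induction hn : T.card using Nat.strong_induction_on generalizing T with
  | _ n ih =>
    intro i hi
    -- The events that do not conflict with `i` are handled by negative correlation; the few
    -- conflicting ones only affect the comparison of `P T₂` with `P T`, to which the induction
    -- hypothesis applies.
    set T₁ := T.filter (conf i)
    set T₂ := T.filter fun j => ¬ conf i j
    have hU : T₁ ∪ T₂ = T := filter_union_filter_not_eq _ _
    have h2 : A i T₂ ≤ p i * P T₂ :=
      hneg i hi T₂ ((filter_subset _ _).trans hT) fun j hj => (mem_filter.1 hj).2
    have h1 : P T₂ ≤ (1 + 4 * δ) * P T := by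
      rcases T₁.eq_empty_or_nonempty with h0 | ⟨j₀, hj₀⟩
      · rw [h0, empty_union] at hU
        rw [hU]
        nlinarith [hP T]
      · have hlt : T₂.card < n := by
          rw [← hn]
          refine card_lt_card ⟨filter_subset _ _, fun h => ?_⟩
          exact (mem_filter.1 (h (mem_filter.1 hj₀).1)).2 (mem_filter.1 hj₀).2
        have hu := sieve_union_le hins hmono T₁ T₂ (disjoint_filter_filter_not _ _ _)
        rw [hU] at hu
        have hs : ∑ j ∈ T₁, A j T₂ ≤ (1 + 4 * δ) * (δ * P T₂) := by
          calc ∑ j ∈ T₁, A j T₂ ≤ ∑ j ∈ T₁, (1 + 4 * δ) * (p j * P T₂) :=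
                sum_le_sum fun j hj => ih _ hlt T₂ ((filter_subset _ _).trans hT) rfl j
                  (hT (mem_filter.1 hj).1)
            _ = (1 + 4 * δ) * ((∑ j ∈ T₁, p j) * P T₂) := by rw [sum_mul, mul_sum]
            _ ≤ _ := by
              have : ∑ j ∈ T₁, p j ≤ δ := (sum_le_sum_of_subset_of_nonneg
                (filter_subset_filter _ hT) fun j _ _ => hp j).trans (hδ i hi)
              have := mul_le_mul_of_nonneg_right this (hP T₂)
              nlinarith
        -- Equality holds at `δ = 0` and at `δ = 1 / 4`: with the constant four, this is exactly the
        -- admissible range of `δ`.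
        have hk : 1 ≤ (1 + 4 * δ) * (1 - (1 + 4 * δ) * δ) := by
          nlinarith [mul_nonneg hδ0 hδ0, mul_nonneg hδ0 (sub_nonneg.2 hδ1),
            mul_nonneg (mul_nonneg hδ0 hδ0) (sub_nonneg.2 hδ1)]
        have h3 : P T₂ * (1 - (1 + 4 * δ) * δ) ≤ P T := by nlinarith
        calc P T₂ ≤ (1 + 4 * δ) * (P T₂ * (1 - (1 + 4 * δ) * δ)) := by nlinarith [hP T₂]
          _ ≤ _ := by gcongr
    calc A i T ≤ A i T₂ := hmono _ _ _ (filter_subset _ _)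
      _ ≤ p i * P T₂ := h2
      _ ≤ p i * ((1 + 4 * δ) * P T) := by gcongr; exact hp i
      _ = _ := by ring

theorem exp_neg_div_le {u : ℝ} (hu : u < 1) : Real.exp (-(u / (1 - u))) ≤ 1 - u := by
  have h : 0 < 1 - u := by linarith
  have h1 := Real.add_one_le_exp (u / (1 - u))
  have h2 : u / (1 - u) + 1 = (1 - u)⁻¹ := by field_simp; ring
  rw [h2] at h1
  rw [Real.exp_neg]
  exact inv_le_of_inv_le₀ h h1

/-- The conditional bounds multiply to `P I ≥ ∏ (1 - κ * p i)` with `κ = 1 + 4 * δ`. The bound `1 -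
u ≥ exp (-u / (1 - u))` turns the product into an exponential whose exponent is asymptotically `-∑ p
i` when `δ` and `m` tend to zero. -/
theorem local_lemma {conf : ι → ι → Prop} [∀ i, DecidablePred (conf i)] {I : Finset ι} {δ m : ℝ}
    (hP0 : P ∅ = 1) (hP : ∀ T, 0 ≤ P T) (hins : ∀ T i, i ∉ T → P (insert i T) = P T - A i T)
    (hmono : ∀ i T T', T ⊆ T' → A i T' ≤ A i T) (hp : ∀ i, 0 ≤ p i)
    (hneg : ∀ i ∈ I, ∀ T ⊆ I, (∀ j ∈ T, ¬ conf i j) → A i T ≤ p i * P T)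
    (hδ0 : 0 ≤ δ) (hδ1 : δ ≤ 1 / 4) (hδ : ∀ i ∈ I, ∑ j ∈ I.filter (conf i), p j ≤ δ)
    (hpm : ∀ i ∈ I, p i ≤ m) (hm : (1 + 4 * δ) * m < 1) :
    Real.exp (-((1 + 4 * δ) / (1 - (1 + 4 * δ) * m) * ∑ i ∈ I, p i)) ≤ P I := by
  have hcond := local_lemma_cond hP hins hmono hp hneg hδ0 hδ1 hδ
  suffices h : ∀ T ⊆ I,
      Real.exp (-((1 + 4 * δ) / (1 - (1 + 4 * δ) * m) * ∑ i ∈ T, p i)) ≤ P T from h I Subset.rfl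
  intro T
  induction T using Finset.induction_on with
  | empty => intro _; simp [hP0]
  | insert i T hi ih =>
    intro hT
    have hiI : i ∈ I := hT (mem_insert_self _ _)
    have hTI : T ⊆ I := (subset_insert _ _).trans hT
    have h1 := hcond T hTI i hiI
    set κ := 1 + 4 * δ
    have hκ : 0 ≤ κ := by positivity
    have hpi := hpm i hiI
    have hu : κ * p i < 1 := lt_of_le_of_lt (by gcongr) hm
    have h2 : Real.exp (-(κ / (1 - κ * m) * p i)) ≤ 1 - κ * p i := by
      refine le_trans (Real.exp_le_exp.2 ?_) (exp_neg_div_le hu)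
      have : 0 < 1 - κ * m := by linarith
      have : κ * p i / (1 - κ * p i) ≤ κ * p i / (1 - κ * m) := by
        have := hp i
        gcongr
      rw [neg_le_neg_iff]
      calc _ ≤ _ := this
        _ = _ := by ring
    rw [hins T i hi, sum_insert hi, mul_add, neg_add, Real.exp_add]
    calc _ ≤ (1 - κ * p i) * P T :=
          mul_le_mul h2 (ih hTI) (Real.exp_pos _).le (by linarith)
      _ ≤ _ := by linarith

/-- If every event keeps nearly its full probability whatever is avoided, then avoiding it costs a
factor `1 - p i ≤ exp (-p i)` up to `e i`. Later factors are at most one, so the errors merely add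
up. -/
theorem sieve_upper {I : Finset ι} {e : ι → ℝ} (hP0 : P ∅ = 1)
    (hins : ∀ T i, i ∉ T → P (insert i T) = P T - A i T) (hp0 : ∀ i ∈ I, 0 ≤ p i)
    (hp1 : ∀ i ∈ I, p i ≤ 1) (he : ∀ i ∈ I, 0 ≤ e i)
    (hlow : ∀ T ⊆ I, ∀ i ∈ I, i ∉ T → p i * P T - e i ≤ A i T) :
    P I ≤ Real.exp (-∑ i ∈ I, p i) + ∑ i ∈ I, e i := by
  suffices h : ∀ T ⊆ I, P T ≤ Real.exp (-∑ i ∈ T, p i) + ∑ i ∈ T, e i from h I Subset.rfl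
  intro T
  induction T using Finset.induction_on with
  | empty => intro _; simp [hP0]
  | insert i T hi ih =>
    intro hT
    have hiI : i ∈ I := hT (mem_insert_self _ _)
    have hTI : T ⊆ I := (subset_insert _ _).trans hT
    have h1 := hlow T hTI i hiI hi
    have h3 := hp0 i hiI
    have h4 := hp1 i hiI
    have hs : 0 ≤ ∑ i ∈ T, e i := sum_nonneg fun j hj => he j (hTI hj)
    rw [hins T i hi, sum_insert hi, sum_insert hi, neg_add, Real.exp_add]
    calc P T - A i T ≤ (1 - p i) * P T + e i := by linarith
      _ ≤ (1 - p i) * (Real.exp (-∑ i ∈ T, p i) + ∑ i ∈ T, e i) + e i := by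
        gcongr
        exact ih hTI
      _ = (1 - p i) * Real.exp (-∑ i ∈ T, p i) + (1 - p i) * ∑ i ∈ T, e i + e i := by ring
      _ ≤ Real.exp (-p i) * Real.exp (-∑ i ∈ T, p i) + 1 * ∑ i ∈ T, e i + e i := by
        gcongr
        · exact Real.one_sub_le_exp_neg _
        · linarith
      _ = _ := by ring

end Sieve

/-! ### Loops and double edges as patterns of matched pairs -/

section Patterns

open Finset Equiv
open scoped Classical

variable {H V : Type*} [Fintype H] [DecidableEq H]

/-- The matching `σ` gives no loops and no multiple edges. -/
def Simple (π : H → V) (σ : Perm H) : Prop :=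
  (∀ h, σ h ≠ h → π (σ h) ≠ π h) ∧
    ∀ h h', σ h ≠ h → σ h' ≠ h' → π h = π h' → π (σ h) = π (σ h') → h = h'

/-- A fixed enumeration order. -/
def Before (x y : H) : Prop := Fintype.equivFin H x < Fintype.equivFin H y

omit [DecidableEq H] in
theorem before_or {x y : H} (h : x ≠ y) : Before x y ∨ Before y x :=
  lt_or_gt_of_ne fun e => h ((Fintype.equivFin H).injective e)

omit [DecidableEq H] in
theorem Before.not_symm {x y : H} (h : Before x y) : ¬ Before y x := lt_asymm h

omit [DecidableEq H] in
theorem Before.trans {x y z : H} (h : Before x y) (h' : Before y z) : Before x z := lt_trans h h'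

omit [DecidableEq H] in
theorem Before.ne {x y : H} (h : Before x y) : x ≠ y := fun e => by
  subst e; exact lt_irrefl _ h

/-- A loop at a vertex, as a degenerate pair of edges. -/
noncomputable def loops (π : H → V) (S : Finset H) : Finset ((H × H) × (H × H)) :=
  univ.filter fun j => j.1 = j.2 ∧ (j.1.1 ∈ S ∧ j.1.2 ∈ S) ∧ Before j.1.1 j.1.2 ∧ π j.1.1 = π j.1.2

/-- Two parallel edges, listed in a canonical order. -/
noncomputable def doubles (π : H → V) (S : Finset H) : Finset ((H × H) × (H × H)) :=
  univ.filter fun j => (j.1.1 ∈ S ∧ j.1.2 ∈ S ∧ j.2.1 ∈ S ∧ j.2.2 ∈ S) ∧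
    (π j.1.1 = π j.2.1 ∧ π j.1.2 = π j.2.2 ∧ π j.1.1 ≠ π j.1.2) ∧ j.1.2 ≠ j.2.2 ∧
    -- The first entry is the earliest of the four points, which selects one of the four ways to
    -- list the same two edges.
    Before j.1.1 j.2.1 ∧ Before j.1.1 j.1.2 ∧ Before j.1.1 j.2.2

/-- The matching contains both edges of the pattern. -/
def Holds (σ : Perm H) (j : (H × H) × (H × H)) : Prop := σ j.1.1 = j.1.2 ∧ σ j.2.1 = j.2.2

def Avoids (T : Finset ((H × H) × (H × H))) (σ : Perm H) : Prop := ∀ j ∈ T, ¬ Holds σ j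

/-- The points of a pattern. -/
def points (j : (H × H) × (H × H)) : Finset H := {j.1.1, j.1.2, j.2.1, j.2.2}

/-- The canonical order in the patterns loses nothing: every double edge can be listed so that its
earliest point comes first. -/
theorem simple_iff_avoids {π : H → V} {S : Finset H} {σ : Perm H} (hσ : σ ∈ pairings S) :
    Simple π σ ↔ Avoids (loops π S ∪ doubles π S) σ := by
  have hf := fun h => (mem_pairings.1 hσ).2 h
  have hi := pairings_invol hσ
  have hm := fun h => pairings_mem hσ (h := h)
  constructor
  · rintro ⟨h1, h2⟩ ⟨⟨x, y⟩, ⟨x', y'⟩⟩ hj ⟨e1, e2⟩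
    simp only [loops, doubles, mem_union, mem_filter, mem_univ, true_and] at hj e1 e2
    rcases hj with ⟨-, hS, hb, hπ⟩ | ⟨hS, hπ, hy, hb, -, -⟩
    · exact h1 x ((hf x).2 hS.1) (by rw [e1]; exact hπ.symm)
    · refine hb.ne (h2 x x' ((hf x).2 hS.1) ((hf x').2 hS.2.2.1) hπ.1 ?_)
      rw [e1, e2]; exact hπ.2.1
  · intro hA
    have h1 : ∀ h, σ h ≠ h → π (σ h) ≠ π h := by
      intro h hh hπ
      have hS := (hf h).1 hh
      rcases before_or hh with hb | hb
      · refine hA ((σ h, h), (σ h, h)) ?_ ⟨hi h, hi h⟩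
        simp only [loops, mem_union, mem_filter, mem_univ, true_and]
        exact Or.inl ⟨⟨(hm h).2 hS, hS⟩, hb, hπ⟩
      · refine hA ((h, σ h), (h, σ h)) ?_ ⟨rfl, rfl⟩
        simp only [loops, mem_union, mem_filter, mem_univ, true_and]
        exact Or.inl ⟨⟨hS, (hm h).2 hS⟩, hb, hπ.symm⟩
    refine ⟨h1, fun h h' hh hh' e1 e2 => ?_⟩
    by_contra hne
    have hS := (hf h).1 hh
    have hS' := (hf h').1 hh'
    have key : ∀ x x', x ∈ S → x' ∈ S → π x = π x' → π (σ x) = π (σ x') → Before x x' →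
        Before x (σ x) → Before x (σ x') → False := by
      intro x x' hx hx' e1 e2 b1 b2 b3
      refine hA ((x, σ x), (x', σ x')) ?_ ⟨rfl, rfl⟩
      simp only [doubles, mem_union, mem_filter, mem_univ, true_and]
      refine Or.inr ⟨⟨hx, (hm x).2 hx, hx', (hm x').2 hx'⟩,
        ⟨e1, e2, (h1 x ((hf x).2 hx)).symm⟩, fun e => b1.ne (σ.injective e), b1, b2, b3⟩
    have n1 : h ≠ σ h := hh.symm
    have n2 : h' ≠ σ h' := hh'.symm
    have n3 : σ h ≠ σ h' := fun e => hne (σ.injective e)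
    have n4 : h ≠ σ h' := fun e => h1 h hh (by rw [e2, ← e])
    have n5 : h' ≠ σ h := fun e => h1 h hh (by rw [← e, e1])
    -- The four listings of one double edge: exchange of the two edges and exchange of the two
    -- sides. In one of them the earliest point stands first.
    have k1 := key h h' hS hS' e1 e2
    have k2 := key h' h hS' hS e1.symm e2.symm
    have k3 := key (σ h) (σ h') ((hm h).2 hS) ((hm h').2 hS') e2 (by rw [hi, hi, e1])
    have k4 := key (σ h') (σ h) ((hm h').2 hS') ((hm h).2 hS) e2.symm (by rw [hi, hi, e1])
    rw [hi, hi] at k3 k4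
    have := before_or n1
    have := before_or n2
    have := before_or n3
    have := before_or n4
    have := before_or n5
    have := before_or hne
    have t1 := fun (x y z : H) => @Before.trans H _ x y z
    grind

/-- Merging at `x` and `y` does not affect patterns away from `x` and `y`. -/
theorem Holds.merge {S : Finset H} {σ : Perm H} (hσ : σ ∈ pairings S) {x y : H} (hx : x ∈ S)
    (hy : y ∈ S) (hxy : x ≠ y) {j : (H × H) × (H × H)} (hjx : x ∉ points j) (hjy : y ∉ points j)
    (h : Holds σ j) : Holds (merge x y σ) j := by
  obtain ⟨h1, h2⟩ := h
  simp only [points, mem_insert, mem_singleton] at hjx hjy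
  constructor
  · rw [merge_apply hσ hx hy hxy]; grind
  · rw [merge_apply hσ hx hy hxy]; grind

/-- Merging destroys no pattern away from `x` and `y`, so if the merged matching avoids `T`, the
original one does. This is the negative correlation that the local lemma requires. -/
theorem pr_avoids_sdiff_le {S : Finset H} {x y : H} (hx : x ∈ S) (hy : y ∈ S) (hxy : x ≠ y)
    {T : Finset ((H × H) × (H × H))} (hT : ∀ j ∈ T, x ∉ points j ∧ y ∉ points j) :
    pr (S \ {x, y}) (Avoids T) ≤ pr S (Avoids T) := by
  rw [← pr_merge hx hy hxy]
  exact pr_mono fun σ hσ h j hj hh => h j hj (hh.merge hσ hx hy hxy (hT j hj).1 (hT j hj).2)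

/-- Merging creates a single new edge, between the partners of `x` and `y`. A pattern that appears
must use it, so the new edge is a loop or parallel to an old edge. -/
theorem clash_of_avoids {π : H → V} {S S' : Finset H} {σ : Perm H} (hσ : σ ∈ pairings S) {x y : H}
    (hx : x ∈ S) (hy : y ∈ S) (hxy : x ≠ y) {T : Finset ((H × H) × (H × H))}
    (hTp : T ⊆ loops π S' ∪ doubles π S') (hT : ∀ j ∈ T, x ∉ points j ∧ y ∉ points j)
    (h : Avoids T σ) (h' : ¬ Avoids T (merge x y σ)) : Clash π x y σ := by
  unfold Avoids at h'
  push Not at h'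
  obtain ⟨⟨⟨x₁, y₁⟩, ⟨x₂, y₂⟩⟩, hj, h1, h2⟩ := h'
  have hn := h _ hj
  obtain ⟨hjx, hjy⟩ := hT _ hj
  have hjp := hTp hj
  simp only [points, mem_insert, mem_singleton, Holds] at hjx hjy hn h1 h2
  rw [merge_apply hσ hx hy hxy] at h1 h2
  have hi := pairings_invol hσ
  have e1 : ∀ u v, σ u = v ↔ u = σ v := fun u v =>
    ⟨fun e => by rw [← e, hi], fun e => by rw [e, hi]⟩
  simp only [loops, doubles, mem_union, mem_filter, mem_univ, true_and] at hjp
  by_cases hσx : σ x = y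
  · exact Or.inl hσx
  refine Or.inr ?_
  by_cases hc : π (σ x) = π (σ y)
  · exact Or.inl hc
  refine Or.inr ?_
  rcases hjp with ⟨he, -, hb, hπ⟩ | ⟨-, hπ, hy12, hb1, hb2, hb3⟩
  · exfalso
    simp only [Prod.mk.injEq] at he
    grind
  · have n1 := hb1.ne
    have n2 := hb2.ne
    have n3 := hb3.ne
    simp only [List.mem_cons, List.not_mem_nil]
    have hS1 : x₁ ≠ x ∧ x₁ ≠ y ∧ y₁ ≠ x ∧ y₁ ≠ y ∧ x₂ ≠ x ∧ x₂ ≠ y ∧ y₂ ≠ x ∧ y₂ ≠ y := by grind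
    have hc1 : x₂ ≠ y₂ := by grind
    -- The cases tell which edge of the pattern is new and in which direction it runs. The witness
    -- is the end of the old edge that lies at the vertex of `σ x`.
    by_cases hA : σ x₁ = y₁
    · have hB : σ x₂ ≠ y₂ := fun h => hn ⟨hA, h⟩
      by_cases hC : σ x₂ = x
      · exact ⟨x₁, by grind⟩
      · exact ⟨y₁, by grind⟩
    · by_cases hC : σ x₁ = x
      · exact ⟨x₂, by grind⟩
      · exact ⟨y₂, by grind⟩

end Patterns

end ConfigModel

namespace ConfigModel

/-! ### Near independence of a pattern from patterns with other points -/

section SimpleProbability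

open Finset Equiv
open scoped Classical

variable {H V : Type*} [Fintype H] [DecidableEq H] {π : H → V} {S : Finset H}

/-- The probability of a pattern. -/
noncomputable def weight (L : ℝ) (j : (H × H) × (H × H)) : ℝ :=
  if j.1 = j.2 then 1 / (L - 1) else 1 / ((L - 1) * (L - 3))

omit [Fintype H] in
theorem swap_mul_apply_iff {x y u v : H} (τ : Perm H) (hx : v ≠ x) (hy : v ≠ y) :
    (swap x y * τ) u = v ↔ τ u = v := by
  rw [Perm.mul_apply, swap_apply_eq_iff, swap_apply_of_ne_of_ne hx hy]

omit [Fintype H] in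
theorem avoids_swap_mul {T : Finset ((H × H) × (H × H))} {x y : H} (τ : Perm H)
    (hT : ∀ j ∈ T, x ∉ points j ∧ y ∉ points j) : Avoids T (swap x y * τ) ↔ Avoids T τ := by
  refine forall₂_congr fun j hj => not_congr ?_
  obtain ⟨h1, h2⟩ := hT j hj
  simp only [points, mem_insert, mem_singleton, not_or] at h1 h2
  exact and_congr (swap_mul_apply_iff τ (Ne.symm h1.2.1) (Ne.symm h2.2.1))
    (swap_mul_apply_iff τ (Ne.symm h1.2.2.2) (Ne.symm h2.2.2.2))

theorem mem_loops {j : (H × H) × (H × H)} : j ∈ loops π S ↔ j.1 = j.2 ∧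
    (j.1.1 ∈ S ∧ j.1.2 ∈ S) ∧ Before j.1.1 j.1.2 ∧ π j.1.1 = π j.1.2 := by simp [loops]

theorem mem_doubles {j : (H × H) × (H × H)} : j ∈ doubles π S ↔
    (j.1.1 ∈ S ∧ j.1.2 ∈ S ∧ j.2.1 ∈ S ∧ j.2.2 ∈ S) ∧
    (π j.1.1 = π j.2.1 ∧ π j.1.2 = π j.2.2 ∧ π j.1.1 ≠ π j.1.2) ∧ j.1.2 ≠ j.2.2 ∧
    Before j.1.1 j.2.1 ∧ Before j.1.1 j.1.2 ∧ Before j.1.1 j.2.2 := by simp [doubles]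

theorem nodup_of_mem_doubles {j : (H × H) × (H × H)} (hj : j ∈ doubles π S) :
    [j.1.1, j.1.2, j.2.1, j.2.2].Nodup := by
  rw [mem_doubles] at hj
  have := hj.2.2.2.1.ne
  have := hj.2.2.2.2.1.ne
  have := hj.2.2.2.2.2.ne
  simp only [List.nodup_cons, List.mem_cons, List.not_mem_nil, List.nodup_nil]
  grind

theorem clashBound_mono {L q q' : ℝ} (hL : 6 ≤ L) (hq : 0 ≤ q) (h : q ≤ q') :
    clashBound L q ≤ clashBound L q' := by
  unfold clashBound
  have h1 : 0 ≤ L - 1 := by linarith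
  have h3 : 0 ≤ L - 3 := by linarith
  have h5 : 0 ≤ L - 5 := by linarith
  gcongr

theorem siblings_mono {S S' : Finset H} (h : S ⊆ S') :
    siblings π S ⊆ siblings π S' := by
  intro z hz
  rw [mem_siblings] at hz ⊢
  exact ⟨⟨h hz.1.1, h hz.1.2⟩, hz.2⟩

/-- The reverse of `pr_avoids_sdiff_le`: avoidance can be lost in merging only through a clash. -/
theorem pr_avoids_le_sdiff_add {x y : H} (hx : x ∈ S) (hy : y ∈ S) (hxy : x ≠ y)
    (hL : 6 ≤ S.card) {S' : Finset H} {T : Finset ((H × H) × (H × H))}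
    (hTp : T ⊆ loops π S' ∪ doubles π S') (hT : ∀ j ∈ T, x ∉ points j ∧ y ∉ points j) :
    pr S (Avoids T) ≤ pr (S \ {x, y}) (Avoids T) + clashBound S.card (siblings π S).card := by
  rw [← pr_merge hx hy hxy]
  refine (pr_le_add S _ (fun σ => Avoids T (merge x y σ))).trans ?_
  gcongr
  exact (pr_mono fun σ hσ h => clash_of_avoids hσ hx hy hxy hTp hT h.1 h.2).trans
    (pr_clash_le hx hy hxy hL)

/-- The error in the sieve coming from clashes. -/
noncomputable def sieveError (L q : ℝ) : ℝ := clashBound L q + clashBound (L - 2) q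

theorem clashBound_nonneg {L q : ℝ} (hL : 6 ≤ L) (hq : 0 ≤ q) : 0 ≤ clashBound L q := by
  unfold clashBound
  have h1 : 0 ≤ L - 1 := by linarith
  have h3 : 0 ≤ L - 3 := by linarith
  have h5 : 0 ≤ L - 5 := by linarith
  positivity

/-- A pattern is nearly independent of patterns with other points. -/
theorem pr_holds_and_avoids (hL : 8 ≤ S.card) {i : (H × H) × (H × H)}
    (hi : i ∈ loops π S ∪ doubles π S) {T : Finset ((H × H) × (H × H))}
    (hTp : T ⊆ loops π S ∪ doubles π S) (hT : ∀ j ∈ T, Disjoint (points i) (points j)) :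
    pr S (fun σ => Holds σ i ∧ Avoids T σ) ≤ weight S.card i * pr S (Avoids T) ∧
      weight S.card i * (pr S (Avoids T) - sieveError S.card (siblings π S).card) ≤
        pr S (fun σ => Holds σ i ∧ Avoids T σ) := by
  have hL' : (8 : ℝ) ≤ S.card := by exact_mod_cast hL
  obtain ⟨⟨x, y⟩, ⟨x', y'⟩⟩ := i
  have hT' : ∀ z ∈ points ((x, y), (x', y')), ∀ j ∈ T, z ∉ points j := fun z hz j hj =>
    disjoint_left.1 (hT j hj) hz
  have hTx : ∀ j ∈ T, x ∉ points j ∧ y ∉ points j := fun j hj =>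
    ⟨hT' x (by simp [points]) j hj, hT' y (by simp [points]) j hj⟩
  have hTx' : ∀ j ∈ T, x' ∉ points j ∧ y' ∉ points j := fun j hj =>
    ⟨hT' x' (by simp [points]) j hj, hT' y' (by simp [points]) j hj⟩
  have hq : (0 : ℝ) ≤ (siblings π S).card := by positivity
  rw [mem_union] at hi
  rcases hi with hi | hi
  · rw [mem_loops] at hi
    obtain ⟨he, ⟨hx, hy⟩, hb, -⟩ := hi
    have he' := he
    simp only [Prod.mk.injEq] at he hx hy hb
    obtain ⟨rfl, rfl⟩ := he
    have e : pr S (fun σ => Holds σ ((x, y), (x, y)) ∧ Avoids T σ) =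
        1 / ((S.card : ℝ) - 1) * pr (S \ {x, y}) (Avoids T) := by
      have h1 : pr S (fun σ => Holds σ ((x, y), (x, y)) ∧ Avoids T σ) =
          pr S (fun σ => σ x = y ∧ Avoids T σ) :=
        pr_congr fun σ _ => by simp [Holds]
      rw [h1, pr_apply hx hy hb.ne, div_mul_eq_mul_div, one_mul]
      congr 1
      exact pr_congr fun τ _ => avoids_swap_mul τ hTx
    have h2 := pr_avoids_sdiff_le hx hy hb.ne hTx
    have h3 := pr_avoids_le_sdiff_add hx hy hb.ne (by omega) hTp hTx
    have hw : 0 ≤ 1 / ((S.card : ℝ) - 1) := by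
      apply div_nonneg zero_le_one; linarith
    rw [e, weight, if_pos he']
    have := clashBound_nonneg (L := S.card - 2) (by linarith) hq
    refine ⟨by gcongr, ?_⟩
    rw [sieveError]
    gcongr
    linarith
  · have hnd := nodup_of_mem_doubles hi
    rw [mem_doubles] at hi
    have hne : ¬ ((x, y) = (x', y')) := fun h => by
      simp only [Prod.mk.injEq] at h; exact hi.2.2.2.1.ne h.1
    simp only at hi hnd
    have hS := hi.1
    have hnd' := hnd
    simp only [List.nodup_cons, List.mem_cons, List.not_mem_nil] at hnd'
    have e : pr S (fun σ => Holds σ ((x, y), (x', y')) ∧ Avoids T σ) =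
        1 / (((S.card : ℝ) - 1) * ((S.card : ℝ) - 3)) *
          pr ((S \ {x, y}) \ {x', y'}) (Avoids T) := by
      have h1 : pr S (fun σ => Holds σ ((x, y), (x', y')) ∧ Avoids T σ) =
          pr S (fun σ => σ x = y ∧ σ x' = y' ∧ Avoids T σ) :=
        pr_congr fun σ _ => by simp [Holds, and_assoc]
      rw [h1, pr_apply_two (by simp; tauto) hnd, div_mul_eq_mul_div, one_mul]
      congr 1
      exact pr_congr fun τ _ => by rw [avoids_swap_mul _ hTx, avoids_swap_mul _ hTx']
    have hxS : x' ∈ S \ {x, y} := by simp; grind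
    have hyS : y' ∈ S \ {x, y} := by simp; grind
    have hxy : x ≠ y := by grind
    have hxy' : x' ≠ y' := by grind
    have hc := card_sdiff_pair hS.1 hS.2.1 hxy
    have hcr : ((S \ {x, y}).card : ℝ) = S.card - 2 := by rw [← hc]; push_cast; ring
    have h2 := pr_avoids_sdiff_le hS.1 hS.2.1 hxy hTx
    have h2' := pr_avoids_sdiff_le hxS hyS hxy' hTx'
    -- The two edges are deleted one after the other. Each deletion costs a clash term, the second
    -- with two points fewer, which explains the two terms of `sieveError`.
    have h3 := pr_avoids_le_sdiff_add hS.1 hS.2.1 hxy (by omega) hTp hTx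
    have h3' := pr_avoids_le_sdiff_add hxS hyS hxy' (by omega) hTp hTx'
    have h4 : clashBound (S \ {x, y}).card (siblings π (S \ {x, y})).card ≤
        clashBound (S.card - 2) (siblings π S).card := by
      rw [hcr]
      refine clashBound_mono (by linarith) (by positivity) ?_
      exact_mod_cast card_le_card (siblings_mono sdiff_subset)
    have hw : 0 ≤ 1 / (((S.card : ℝ) - 1) * ((S.card : ℝ) - 3)) :=
      div_nonneg zero_le_one (mul_nonneg (by linarith) (by linarith))
    rw [e, weight, if_neg hne]
    refine ⟨by gcongr; linarith, ?_⟩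
    rw [sieveError]
    gcongr
    linarith

/-- Two different patterns with a common point form a triple edge. -/
theorem triple_of_holds {σ : Perm H} (hσ : σ ∈ pairings S) {i j : (H × H) × (H × H)}
    (hi : i ∈ loops π S ∪ doubles π S) (hj : j ∈ loops π S ∪ doubles π S) (hij : i ≠ j)
    (hd : ¬ Disjoint (points i) (points j)) (hσi : Holds σ i) (hσj : Holds σ j) :
    i ∈ doubles π S ∧ ∃ z, z ∉ points i ∧ σ z ∉ points i ∧ z ∈ S ∧ π z = π i.1.1 ∧
      π (σ z) = π i.1.2 := by
  have hinv := pairings_invol hσ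
  obtain ⟨⟨x, y⟩, ⟨x', y'⟩⟩ := i
  obtain ⟨⟨x₁, y₁⟩, ⟨x₂, y₂⟩⟩ := j
  rw [not_disjoint_iff] at hd
  obtain ⟨w, hw, hw'⟩ := hd
  obtain ⟨s1, s2⟩ := hσi
  obtain ⟨s3, s4⟩ := hσj
  simp only [mem_union, mem_loops, mem_doubles, points, mem_insert, mem_singleton, ne_eq,
    Prod.mk.injEq, not_and] at *
  have t1 := hinv x
  have t2 := hinv x'
  have t3 := hinv x₁
  have t4 := hinv x₂
  rw [s1] at t1
  rw [s2] at t2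
  rw [s3] at t3
  rw [s4] at t4
  rcases hi with ⟨⟨rfl, rfl⟩, hS, hb, hπ⟩ | ⟨hS, hπ, hy, hb1, hb2, hb3⟩
  · exfalso
    rcases hj with ⟨⟨rfl, rfl⟩, hS', hb', hπ'⟩ | ⟨hS', hπ', hy', hb1', hb2', hb3'⟩
    · have := hb.not_symm
      grind
    · grind
  · refine ⟨⟨hS, hπ, hy, hb1, hb2, hb3⟩, ?_⟩
    rcases hj with ⟨⟨rfl, rfl⟩, hS', hb', hπ'⟩ | ⟨hS', hπ', hy', hb1', hb2', hb3'⟩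
    · exfalso
      grind
    · by_contra hcon
      push Not at hcon
      -- Without a third edge, every edge between the two vertices of `i` belongs to `i`. The common
      -- point places `j` at the same two vertices, so both patterns consist of the same two edges,
      -- and the canonical order forces `i = j`.
      have key : ∀ z t, σ z = t → z ∈ S → π z = π x → π t = π y → z = x ∨ z = x' := by
        intro z t hzt hz h1 h2
        by_contra hne
        rw [not_or] at hne
        have ny : z ≠ y := fun h => hπ.2.2 (by rw [← h1, h])
        have ny' : z ≠ y' := fun h => hπ.2.2 (by rw [← h1, h, ← hπ.2.1])
        have tx : t ≠ x := fun h => hπ.2.2 (by rw [← h2, h])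
        have tx' : t ≠ x' := fun h => hπ.2.2 (by rw [← h2, h, hπ.1])
        have ty : t ≠ y := fun h => hne.1 (σ.injective (by rw [hzt, s1, h]))
        have ty' : t ≠ y' := fun h => hne.2 (σ.injective (by rw [hzt, s2, h]))
        rw [← hzt] at tx tx' ty ty' h2
        exact hcon z ⟨hne.1, ny, hne.2, ny'⟩ ⟨tx, ty, tx', ty'⟩ hz h1 h2
      clear hcon
      have n1 := hb1.not_symm
      have n2 := hb2.not_symm
      have n3 := hb3.not_symm
      have n4 := hb1.ne
      have n5 := hb1'.ne
      by_cases hside : π x₁ = π x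
      · have hy1 : π y₁ = π y := by clear key; grind
        have a1 := key x₁ y₁ s3 hS'.1 hside hy1
        have a2 := key x₂ y₂ s4 hS'.2.2.1 (hπ'.1 ▸ hside) (hπ'.2.1 ▸ hy1)
        clear key
        grind
      · have hy1 : π y₁ = π x ∧ π x₁ = π y := by clear key; grind
        have a1 := key y₁ x₁ t3 hS'.2.1 hy1.1 hy1.2
        have a2 := key y₂ x₂ t4 hS'.2.2.2 (hπ'.2.1 ▸ hy1.1) (hπ'.1 ▸ hy1.2)
        have m1 := hb2'.not_symm
        have m2 := hb3'.not_symm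
        have m3 := hb1'.not_symm
        clear key
        grind

end SimpleProbability

end ConfigModel

namespace ConfigModel

/-! ### Counting patterns; two-sided bounds for the probability of simplicity -/

section PatternCounts

open Finset Equiv
open scoped Classical

variable {H V : Type*} [Fintype H] [DecidableEq H] {π : H → V} {S : Finset H}

/-- Exactly one of the two orders of a sibling pair agrees with `Before`. -/
theorem card_loops : 2 * (loops π S).card = (siblings π S).card := by
  have h1 : ((siblings π S).filter fun z => Before z.1 z.2).card = (loops π S).card := by
    refine card_nbij' (fun z => (z, z)) (fun j => j.1) ?_ ?_ ?_ ?_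
    · rintro ⟨x, y⟩ hz
      simp only [coe_filter, mem_siblings, Set.mem_ofPred_eq, mem_coe, mem_loops] at hz ⊢
      tauto
    · rintro ⟨⟨x, y⟩, ⟨x', y'⟩⟩ hz
      simp only [coe_filter, mem_siblings, Set.mem_ofPred_eq, mem_coe, mem_loops] at hz ⊢
      have := hz.2.2.1.ne
      tauto
    · intro z _; rfl
    · intro j hj
      rw [mem_coe, mem_loops] at hj
      exact Prod.ext rfl hj.1
  have h2 : ((siblings π S).filter fun z => ¬ Before z.1 z.2).card =
      ((siblings π S).filter fun z => Before z.1 z.2).card := by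
    refine card_nbij' Prod.swap Prod.swap ?_ ?_ (fun _ _ => rfl) (fun _ _ => rfl)
    · rintro ⟨x, y⟩ hz
      simp only [coe_filter, mem_siblings, Set.mem_ofPred_eq, Prod.fst_swap, Prod.snd_swap] at hz ⊢
      have := before_or hz.1.2.1
      have := hz.1.2.1
      have := hz.1.2.2
      grind
    · rintro ⟨x, y⟩ hz
      simp only [coe_filter, mem_siblings, Set.mem_ofPred_eq, Prod.fst_swap, Prod.snd_swap] at hz ⊢
      have := hz.2.not_symm
      grind
  rw [← card_filter_add_card_filter_not (s := siblings π S) fun z => Before z.1 z.2, h2, h1]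
  ring

/-- All ways to list two pairs of points over two different vertices. -/
noncomputable def quads (π : H → V) (S : Finset H) : Finset ((H × H) × (H × H)) :=
  (siblings π S ×ˢ siblings π S).filter fun z => π z.1.1 ≠ π z.2.1

omit [Fintype H] [DecidableEq H] in
theorem first_of_four {a b c d : ℕ} (h1 : a ≠ b) (h2 : a ≠ c) (h3 : a ≠ d) (h4 : b ≠ c)
    (h5 : b ≠ d) (h6 : c ≠ d) [Decidable (a < b ∧ a < c ∧ a < d)]
    [Decidable (b < a ∧ b < d ∧ b < c)] [Decidable (c < d ∧ c < a ∧ c < b)]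
    [Decidable (d < c ∧ d < b ∧ d < a)] :
    (if a < b ∧ a < c ∧ a < d then 1 else 0) + (if b < a ∧ b < d ∧ b < c then 1 else 0) +
      (if c < d ∧ c < a ∧ c < b then 1 else 0) + (if d < c ∧ d < b ∧ d < a then 1 else 0) = 1 := by
  split_ifs <;> omega

/-- Exchanging the two edges, exchanging the two sides, or doing both permutes the listings of a
double edge. Together with the identity these four maps send each listing to exactly one whose first
point is the earliest. -/
theorem card_doubles : 4 * (doubles π S).card = (quads π S).card := by
  let B : H → H → H → H → Prop := fun a b c d => Before a b ∧ Before a c ∧ Before a d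
  have hQ : ∀ x x' y y' : H, ((x, x'), (y, y')) ∈ quads π S ↔ (x ∈ S ∧ x' ∈ S ∧ y ∈ S ∧ y' ∈ S) ∧
      (π x = π x' ∧ π y = π y' ∧ π x ≠ π y) ∧ x ≠ x' ∧ y ≠ y' := by
    intro x x' y y'
    simp only [quads, mem_filter, mem_product, mem_siblings]
    tauto
  let D := (quads π S).filter fun z => B z.1.1 z.1.2 z.2.1 z.2.2
  have h0 : D.card = (doubles π S).card := by
    refine card_nbij' (fun z => ((z.1.1, z.2.1), (z.1.2, z.2.2)))
      (fun z => ((z.1.1, z.2.1), (z.1.2, z.2.2))) ?_ ?_ (fun _ _ => rfl) (fun _ _ => rfl)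
    · rintro ⟨⟨x, x'⟩, ⟨y, y'⟩⟩ hz
      simp only [D, coe_filter, Set.mem_ofPred_eq, hQ, mem_coe, mem_doubles, B] at hz ⊢
      tauto
    · rintro ⟨⟨x, y⟩, ⟨x', y'⟩⟩ hz
      simp only [D, coe_filter, Set.mem_ofPred_eq, hQ, mem_coe, mem_doubles, B] at hz ⊢
      have := hz.2.2.2.1.ne
      tauto
  have hg : ∀ g : (H × H) × (H × H) → (H × H) × (H × H), (∀ z, g (g z) = z) →
      (∀ z ∈ quads π S, g z ∈ quads π S) →
      ((quads π S).filter fun z => g z ∈ D).card = D.card := by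
    intro g hgg hgQ
    refine card_nbij' g g ?_ ?_ (fun z _ => hgg z) (fun z _ => hgg z)
    · intro z hz
      simp only [coe_filter, Set.mem_ofPred_eq] at hz
      exact hz.2
    · intro z hz
      have hz' := hz
      simp only [D, coe_filter, Set.mem_ofPred_eq, mem_coe] at hz ⊢
      rw [hgg]
      exact ⟨hgQ z hz.1, hz'⟩
  let g1 : (H × H) × (H × H) → (H × H) × (H × H) := fun z => ((z.1.2, z.1.1), (z.2.2, z.2.1))
  let g2 : (H × H) × (H × H) → (H × H) × (H × H) := fun z => (z.2, z.1)
  let g3 : (H × H) × (H × H) → (H × H) × (H × H) := fun z => ((z.2.2, z.2.1), (z.1.2, z.1.1))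
  have e1 := hg g1 (fun _ => rfl) (by
    rintro ⟨⟨x, x'⟩, ⟨y, y'⟩⟩ hz; simp only [g1, hQ] at hz ⊢; grind)
  have e2 := hg g2 (fun _ => rfl) (by
    rintro ⟨⟨x, x'⟩, ⟨y, y'⟩⟩ hz; simp only [g2, hQ] at hz ⊢; grind)
  have e3 := hg g3 (fun _ => rfl) (by
    rintro ⟨⟨x, x'⟩, ⟨y, y'⟩⟩ hz; simp only [g3, hQ] at hz ⊢; grind)
  have e0 := hg id (fun _ => rfl) (fun _ h => h)
  have hsum : (quads π S).card = ∑ z ∈ quads π S, ((if id z ∈ D then 1 else 0) +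
      (if g1 z ∈ D then 1 else 0) + (if g2 z ∈ D then 1 else 0) + (if g3 z ∈ D then 1 else 0)) := by
    rw [card_eq_sum_ones]
    refine sum_congr rfl ?_
    rintro ⟨⟨x, x'⟩, ⟨y, y'⟩⟩ hz
    simp only [D, mem_filter, hQ, g1, g2, g3, B, id] at hz ⊢
    obtain ⟨⟨s1, s2, s3, s4⟩, ⟨p1, p2, p3⟩, n1, n2⟩ := hz
    have n3 : x ≠ y := fun h => p3 (by rw [h])
    have n4 : x ≠ y' := fun h => p3 (by rw [h, p2])
    have n5 : x' ≠ y := fun h => p3 (by rw [p1, h])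
    have n6 : x' ≠ y' := fun h => p3 (by rw [p1, h, p2])
    simp only [s1, s2, s3, s4, p1, p2, n1, n2, n1.symm, n2.symm, true_and, and_true, ne_eq,
      not_false_eq_true, (by rw [← p1, ← p2]; exact p3 : ¬ π x' = π y'),
      (by rw [← p1, ← p2]; exact fun h => p3 h.symm : ¬ π y' = π x')]
    have inj : ∀ a b : H, a ≠ b → (Fintype.equivFin H a : ℕ) ≠ Fintype.equivFin H b :=
      fun a b h e => h ((Fintype.equivFin H).injective (Fin.ext e))
    refine (first_of_four (inj _ _ n1) (inj _ _ n3) (inj _ _ n4) (inj _ _ n5) (inj _ _ n6)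
      (inj _ _ n2)).symm.trans ?_
    simp only [Before, Fin.lt_def]
  rw [hsum, sum_add_distrib, sum_add_distrib, sum_add_distrib, ← card_filter, ← card_filter,
    ← card_filter, ← card_filter, e0, e1, e2, e3, h0]
  ring

/-- The points of `S` over the vertex of `x`. -/
noncomputable def fiber (π : H → V) (S : Finset H) (v : V) : Finset H := S.filter fun h => π h = v

theorem mem_fiber {v : V} {h : H} : h ∈ fiber π S v ↔ h ∈ S ∧ π h = v := by simp [fiber]

theorem card_quads_le : (quads π S).card ≤ (siblings π S).card ^ 2 := by
  rw [sq, ← card_product]; exact card_filter_le _ _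

/-- The pairs of sibling pairs that are lost lie at one vertex; given the first, there are at most
`Δ ^ 2` choices for the second. Only the upper bound for simplicity needs this, since the lower
bound can use `card_quads_le`. -/
theorem le_card_quads {Δ : ℕ} (hΔ : ∀ v, (fiber π S v).card ≤ Δ) :
    (siblings π S).card ^ 2 ≤ (quads π S).card + (siblings π S).card * Δ ^ 2 := by
  rw [sq, ← card_product, ← card_filter_add_card_filter_not
    (s := siblings π S ×ˢ siblings π S) fun z => π z.1.1 ≠ π z.2.1]
  have : ((siblings π S ×ˢ siblings π S).filter fun z => ¬ π z.1.1 ≠ π z.2.1).card ≤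
      (siblings π S).card * Δ ^ 2 := by
    calc _ ≤ ((siblings π S).sigma fun z => fiber π S (π z.1) ×ˢ fiber π S (π z.1)).card := by
          refine card_le_card_of_injOn (fun z => ⟨z.1, z.2⟩) ?_ ?_
          · rintro ⟨⟨x, x'⟩, ⟨y, y'⟩⟩ hz
            simp only [coe_filter, mem_product, mem_siblings, Set.mem_ofPred_eq, coe_sigma,
              Set.mem_sigma_iff, mem_coe, mem_fiber] at hz ⊢
            grind
          · rintro ⟨z, w⟩ _ ⟨z', w'⟩ _ h
            simp only [Sigma.mk.injEq] at h
            grind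
      _ = ∑ z ∈ siblings π S, (fiber π S (π z.1)).card ^ 2 := by
          rw [card_sigma]; simp [card_product, sq]
      _ ≤ ∑ z ∈ siblings π S, Δ ^ 2 := sum_le_sum fun z _ => Nat.pow_le_pow_left (hΔ _) 2
      _ = _ := by simp
  exact Nat.add_le_add_left this _

theorem loops_disjoint_doubles : Disjoint (loops π S) (doubles π S) := by
  rw [disjoint_left]
  intro j h1 h2
  rw [mem_loops] at h1
  rw [mem_doubles] at h2
  exact h2.2.2.2.1.ne (by rw [h1.1])

theorem sum_weight (L : ℝ) : ∑ j ∈ loops π S ∪ doubles π S, weight L j =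
    (siblings π S).card / (2 * (L - 1)) + (quads π S).card / (4 * ((L - 1) * (L - 3))) := by
  have e1 : ∑ j ∈ loops π S, weight L j = (loops π S).card * (1 / (L - 1)) := by
    rw [← nsmul_eq_mul, ← sum_const]
    exact sum_congr rfl fun j hj => if_pos (mem_loops.1 hj).1
  have e2 : ∑ j ∈ doubles π S, weight L j = (doubles π S).card * (1 / ((L - 1) * (L - 3))) := by
    rw [← nsmul_eq_mul, ← sum_const]
    exact sum_congr rfl fun j hj => if_neg fun h => (mem_doubles.1 hj).2.2.2.1.ne (by rw [h])
  rw [sum_union loops_disjoint_doubles, e1, e2, ← card_loops, ← card_doubles]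
  push_cast
  congr 1
  · rw [mul_one_div, mul_div_mul_left _ _ (by norm_num : (2 : ℝ) ≠ 0)]
  · rw [mul_one_div, mul_div_mul_left _ _ (by norm_num : (4 : ℝ) ≠ 0)]

theorem card_loops_through_le {Δ : ℕ} (hΔ : ∀ v, (fiber π S v).card ≤ Δ) (h : H) :
    ((loops π S).filter fun j => h ∈ points j).card ≤ 2 * Δ := by
  have e : ((loops π S).filter fun j => h ∈ points j) ⊆
      ((loops π S).filter fun j => j.1.1 = h) ∪ ((loops π S).filter fun j => j.1.2 = h) := by
    rintro ⟨⟨x, y⟩, ⟨x', y'⟩⟩ hj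
    simp only [mem_filter, mem_union, mem_loops, points, mem_insert, mem_singleton,
      Prod.mk.injEq] at hj ⊢
    grind
  have h1 : ((loops π S).filter fun j => j.1.1 = h).card ≤ Δ := by
    refine (card_le_card_of_injOn (fun j => j.1.2) ?_ ?_).trans (hΔ (π h))
    · rintro ⟨⟨x, y⟩, ⟨x', y'⟩⟩ hj
      simp only [coe_filter, Set.mem_ofPred_eq, mem_loops, mem_coe, mem_fiber] at hj ⊢
      grind
    · rintro ⟨⟨x, y⟩, ⟨x', y'⟩⟩ hj ⟨⟨x₁, y₁⟩, ⟨x₁', y₁'⟩⟩ hj' e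
      simp only [coe_filter, Set.mem_ofPred_eq, mem_loops] at hj hj' e
      grind
  have h2 : ((loops π S).filter fun j => j.1.2 = h).card ≤ Δ := by
    refine (card_le_card_of_injOn (fun j => j.1.1) ?_ ?_).trans (hΔ (π h))
    · rintro ⟨⟨x, y⟩, ⟨x', y'⟩⟩ hj
      simp only [coe_filter, Set.mem_ofPred_eq, mem_loops, mem_coe, mem_fiber] at hj ⊢
      grind
    · rintro ⟨⟨x, y⟩, ⟨x', y'⟩⟩ hj ⟨⟨x₁, y₁⟩, ⟨x₁', y₁'⟩⟩ hj' e
      simp only [coe_filter, Set.mem_ofPred_eq, mem_loops] at hj hj' e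
      grind
  calc _ ≤ _ := card_le_card e
    _ ≤ _ := card_union_le _ _
    _ ≤ _ := by omega

/-- Once `h` occupies a given one of the four places, the double edge is determined by the other
point at the vertex of `h`, at most `Δ` choices, and a sibling pair at the other vertex. -/
theorem card_doubles_through_le {Δ : ℕ} (hΔ : ∀ v, (fiber π S v).card ≤ Δ) (h : H) :
    ((doubles π S).filter fun j => h ∈ points j).card ≤ 4 * (Δ * (siblings π S).card) := by
  have e : ((doubles π S).filter fun j => h ∈ points j) ⊆
      (((doubles π S).filter fun j => j.1.1 = h) ∪ ((doubles π S).filter fun j => j.1.2 = h)) ∪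
      (((doubles π S).filter fun j => j.2.1 = h) ∪ ((doubles π S).filter fun j => j.2.2 = h)) := by
    intro j hj
    simp only [mem_filter, mem_union, points, mem_insert, mem_singleton] at hj ⊢
    grind
  have key : ∀ (f : (H × H) × (H × H) → H) (g : (H × H) × (H × H) → H × (H × H)),
      (∀ j ∈ doubles π S, f j = h → g j ∈ fiber π S (π h) ×ˢ siblings π S) →
      (∀ j ∈ doubles π S, ∀ j' ∈ doubles π S, f j = f j' → g j = g j' → j = j') →
      ((doubles π S).filter fun j => f j = h).card ≤ Δ * (siblings π S).card := by
    intro f g h1 h2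
    calc _ ≤ (fiber π S (π h) ×ˢ siblings π S).card := by
          refine card_le_card_of_injOn g ?_ ?_
          · intro j hj
            rw [mem_coe, mem_filter] at hj
            exact h1 j hj.1 hj.2
          · intro j hj j' hj' e
            rw [mem_coe, mem_filter] at hj hj'
            exact h2 j hj.1 j' hj'.1 (hj.2.trans hj'.2.symm) e
      _ ≤ _ := by rw [card_product]; exact Nat.mul_le_mul_right _ (hΔ _)
  have h1 := key (fun j => j.1.1) (fun j => (j.2.1, (j.1.2, j.2.2)))
    (fun j hj e => by simp only [mem_doubles, mem_product, mem_fiber, mem_siblings] at *; grind)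
    (fun ⟨⟨_, _⟩, ⟨_, _⟩⟩ _ ⟨⟨_, _⟩, ⟨_, _⟩⟩ _ e e' => by simp at e e' ⊢; tauto)
  have h2 := key (fun j => j.1.2) (fun j => (j.2.2, (j.1.1, j.2.1)))
    (fun j hj e => by
      have := (mem_doubles.1 hj).2.2.2.1.ne
      simp only [mem_doubles, mem_product, mem_fiber, mem_siblings] at *; grind)
    (fun ⟨⟨_, _⟩, ⟨_, _⟩⟩ _ ⟨⟨_, _⟩, ⟨_, _⟩⟩ _ e e' => by simp at e e' ⊢; tauto)
  have h3 := key (fun j => j.2.1) (fun j => (j.1.1, (j.1.2, j.2.2)))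
    (fun j hj e => by simp only [mem_doubles, mem_product, mem_fiber, mem_siblings] at *; grind)
    (fun ⟨⟨_, _⟩, ⟨_, _⟩⟩ _ ⟨⟨_, _⟩, ⟨_, _⟩⟩ _ e e' => by simp at e e' ⊢; tauto)
  have h4 := key (fun j => j.2.2) (fun j => (j.1.2, (j.1.1, j.2.1)))
    (fun j hj e => by
      have := (mem_doubles.1 hj).2.2.2.1.ne
      simp only [mem_doubles, mem_product, mem_fiber, mem_siblings] at *; grind)
    (fun ⟨⟨_, _⟩, ⟨_, _⟩⟩ _ ⟨⟨_, _⟩, ⟨_, _⟩⟩ _ e e' => by simp at e e' ⊢; tauto)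
  have u1 := card_union_le ((doubles π S).filter fun j => j.1.1 = h)
    ((doubles π S).filter fun j => j.1.2 = h)
  have u2 := card_union_le ((doubles π S).filter fun j => j.2.1 = h)
    ((doubles π S).filter fun j => j.2.2 = h)
  refine (card_le_card e).trans ((card_union_le _ _).trans ?_)
  omega

/-- The total probability of the patterns through a given one. -/
noncomputable def conflictBound (L Δ q : ℝ) : ℝ :=
  4 * (2 * Δ / (L - 1) + 4 * (Δ * q) / ((L - 1) * (L - 3)))

theorem weight_nonneg {L : ℝ} (hL : 3 ≤ L) (j : (H × H) × (H × H)) : 0 ≤ weight L j := by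
  unfold weight
  have : 0 ≤ L - 1 := by linarith
  have : 0 ≤ L - 3 := by linarith
  split_ifs <;> positivity

theorem weight_le {L : ℝ} (hL : 4 ≤ L) (j : (H × H) × (H × H)) : weight L j ≤ 1 / (L - 1) := by
  unfold weight
  have : 0 < L - 1 := by linarith
  split_ifs
  · rfl
  · gcongr
    nlinarith

omit [Fintype H] [DecidableEq H] in
theorem sum_biUnion_le_of_nonneg {ι κ : Type*} [DecidableEq κ] (s : Finset ι) (t : ι → Finset κ)
    {f : κ → ℝ} (hf : ∀ k, 0 ≤ f k) : ∑ k ∈ s.biUnion t, f k ≤ ∑ i ∈ s, ∑ k ∈ t i, f k := by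
  induction s using Finset.induction_on with
  | empty => simp
  | insert i s hi ih =>
    rw [biUnion_insert, sum_insert hi]
    have := sum_union_inter (s₁ := t i) (s₂ := s.biUnion t) (f := f)
    have : 0 ≤ ∑ k ∈ t i ∩ s.biUnion t, f k := sum_nonneg fun k _ => hf k
    linarith

/-- Conflicting patterns share one of at most four points, and the patterns through a given point
have been counted. The resulting bound is the `δ` of the local lemma. -/
theorem sum_weight_conflict_le (hL : 4 ≤ S.card) {Δ : ℕ} (hΔ : ∀ v, (fiber π S v).card ≤ Δ)
    (i : (H × H) × (H × H)) :
    ∑ j ∈ (loops π S ∪ doubles π S).filter (fun j => ¬ Disjoint (points i) (points j)),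
      weight S.card j ≤ conflictBound S.card Δ (siblings π S).card := by
  have hL' : (4 : ℝ) ≤ S.card := by exact_mod_cast hL
  have a1 : (0 : ℝ) < S.card - 1 := by linarith
  have a3 : (0 : ℝ) < S.card - 3 := by linarith
  have hw := fun j => weight_nonneg (H := H) (L := S.card) (by linarith) j
  have key : ∀ h, ∑ j ∈ (loops π S ∪ doubles π S).filter (fun j => h ∈ points j),
      weight S.card j ≤ 2 * (Δ : ℝ) / (S.card - 1) +
        4 * (Δ * ((siblings π S).card : ℝ)) / (((S.card : ℝ) - 1) * (S.card - 3)) := by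
    intro h
    rw [filter_union, sum_union (disjoint_filter_filter loops_disjoint_doubles)]
    gcongr
    · calc _ ≤ ∑ j ∈ (loops π S).filter (fun j => h ∈ points j), 1 / ((S.card : ℝ) - 1) :=
            sum_le_sum fun j _ => weight_le hL' j
        _ = ((loops π S).filter (fun j => h ∈ points j)).card / ((S.card : ℝ) - 1) := by
            rw [sum_const, nsmul_eq_mul, mul_one_div]
        _ ≤ _ := by
            gcongr
            exact_mod_cast card_loops_through_le hΔ h
    · calc _ = ∑ j ∈ (doubles π S).filter (fun j => h ∈ points j),
              1 / (((S.card : ℝ) - 1) * (S.card - 3)) :=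
            sum_congr rfl fun j hj => if_neg fun e =>
              (mem_doubles.1 (mem_filter.1 hj).1).2.2.2.1.ne (by rw [e])
        _ = ((doubles π S).filter (fun j => h ∈ points j)).card /
              (((S.card : ℝ) - 1) * (S.card - 3)) := by
            rw [sum_const, nsmul_eq_mul, mul_one_div]
        _ ≤ _ := by
            gcongr
            exact_mod_cast card_doubles_through_le hΔ h
  have hnn : 0 ≤ 2 * (Δ : ℝ) / (S.card - 1) +
        4 * (Δ * ((siblings π S).card : ℝ)) / (((S.card : ℝ) - 1) * (S.card - 3)) := by positivity
  calc _ ≤ ∑ j ∈ (points i).biUnion fun h =>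
          (loops π S ∪ doubles π S).filter (fun j => h ∈ points j), weight S.card j := by
        refine sum_le_sum_of_subset_of_nonneg ?_ fun j _ _ => hw j
        intro j hj
        rw [mem_filter, not_disjoint_iff] at hj
        obtain ⟨hj, h, h1, h2⟩ := hj
        rw [mem_biUnion]
        exact ⟨h, h1, mem_filter.2 ⟨hj, h2⟩⟩
    _ ≤ ∑ h ∈ points i, ∑ j ∈ (loops π S ∪ doubles π S).filter (fun j => h ∈ points j),
          weight S.card j := sum_biUnion_le_of_nonneg _ _ hw
    _ ≤ ∑ h ∈ points i, _ := sum_le_sum fun h _ => key h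
    _ ≤ _ := by
        rw [sum_const, nsmul_eq_mul, conflictBound]
        gcongr
        have : (points i).card ≤ 4 := card_le_four
        exact_mod_cast this

theorem pr_avoids_insert (T : Finset ((H × H) × (H × H))) (i : (H × H) × (H × H)) :
    pr S (Avoids (insert i T)) = pr S (Avoids T) - pr S (fun σ => Holds σ i ∧ Avoids T σ) := by
  rw [← pr_and_add_and_not S (Avoids T) (fun σ => Holds σ i)]
  have e1 : pr S (Avoids (insert i T)) = pr S (fun σ => Avoids T σ ∧ ¬ Holds σ i) :=
    pr_congr fun σ _ => by simp only [Avoids, forall_mem_insert]; tauto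
  have e2 : pr S (fun σ => Holds σ i ∧ Avoids T σ) = pr S (fun σ => Avoids T σ ∧ Holds σ i) :=
    pr_congr fun σ _ => by tauto
  rw [e1, e2]; ring

theorem pr_avoids_empty (hS : Even S.card) : pr S (Avoids ∅) = 1 := by
  rw [← pr_true hS]
  exact pr_congr fun σ _ => by simp [Avoids]

/-- Lower bound for the probability that the multigraph is simple. -/
theorem pr_simple_ge (hS : Even S.card) (hL : 8 ≤ S.card) {Δ : ℕ}
    (hΔ : ∀ v, (fiber π S v).card ≤ Δ) {δ : ℝ}
    (hδ : conflictBound S.card Δ (siblings π S).card ≤ δ) (hδ1 : δ ≤ 1 / 4) :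
    Real.exp (-((1 + 4 * δ) / (1 - (1 + 4 * δ) * (1 / ((S.card : ℝ) - 1))) *
      ((siblings π S).card / (2 * ((S.card : ℝ) - 1)) +
        (siblings π S).card ^ 2 / (4 * (((S.card : ℝ) - 1) * ((S.card : ℝ) - 3)))))) ≤
      pr S (Simple π) := by
  have hL' : (8 : ℝ) ≤ S.card := by exact_mod_cast hL
  have a1 : (0 : ℝ) < S.card - 1 := by linarith
  have a3 : (0 : ℝ) < S.card - 3 := by linarith
  have hδ0 : 0 ≤ δ := le_trans (by unfold conflictBound; positivity) hδ
  have hm : (1 + 4 * δ) * (1 / ((S.card : ℝ) - 1)) < 1 := by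
    rw [mul_one_div, div_lt_one a1]; linarith
  -- Patterns conflict when they share a point; for the others the first half of
  -- `pr_holds_and_avoids` is the negative correlation.
  have h := local_lemma (P := fun T => pr S (Avoids T))
    (A := fun i T => pr S (fun σ => Holds σ i ∧ Avoids T σ)) (p := weight S.card)
    (conf := fun i j => ¬ Disjoint (points i) (points j)) (I := loops π S ∪ doubles π S)
    (δ := δ) (m := 1 / ((S.card : ℝ) - 1)) (pr_avoids_empty hS) (fun T => pr_nonneg _ _)
    (fun T i _ => pr_avoids_insert T i)
    (fun i T T' hTT => pr_mono fun σ _ hσ => ⟨hσ.1, fun j hj => hσ.2 j (hTT hj)⟩)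
    (weight_nonneg (by linarith))
    (fun i hi T hT hf => (pr_holds_and_avoids hL hi hT fun j hj => not_not.1 (hf j hj)).1)
    hδ0 hδ1 (fun i _ => (sum_weight_conflict_le (by omega) hΔ i).trans hδ)
    (fun i _ => weight_le (by linarith) i) hm
  rw [pr_congr fun σ hσ => simple_iff_avoids hσ]
  refine le_trans (Real.exp_le_exp.2 ?_) h
  rw [neg_le_neg_iff, sum_weight]
  have : 0 < 1 - (1 + 4 * δ) * (1 / ((S.card : ℝ) - 1)) := by linarith
  gcongr
  exact_mod_cast card_quads_le

/-- A third parallel edge prescribes a third matched pair, with at most `Δ` choices for each of its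
two ends. -/
theorem pr_triple_le (hL : 6 ≤ S.card) {Δ : ℕ} (hΔ : ∀ v, (fiber π S v).card ≤ Δ)
    {i : (H × H) × (H × H)} (hi : i ∈ doubles π S) :
    pr S (fun σ => Holds σ i ∧ ∃ z, z ∉ points i ∧ σ z ∉ points i ∧ z ∈ S ∧ π z = π i.1.1 ∧
      π (σ z) = π i.1.2) ≤
      (Δ : ℝ) ^ 2 / (((S.card : ℝ) - 1) * ((S.card : ℝ) - 3) * ((S.card : ℝ) - 5)) := by
  have hL' : (6 : ℝ) ≤ S.card := by exact_mod_cast hL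
  have a1 : (0 : ℝ) < S.card - 1 := by linarith
  have a3 : (0 : ℝ) < S.card - 3 := by linarith
  have a5 : (0 : ℝ) < S.card - 5 := by linarith
  have hnd := nodup_of_mem_doubles hi
  rw [mem_doubles] at hi
  let I := (fiber π S (π i.1.1) ×ˢ fiber π S (π i.1.2)).filter fun z =>
    z.1 ∉ points i ∧ z.2 ∉ points i
  calc _ ≤ pr S (fun σ => ∃ z ∈ I, σ i.1.1 = i.1.2 ∧ σ i.2.1 = i.2.2 ∧ σ z.1 = z.2) := by
        refine pr_mono fun σ hσ h => ?_
        obtain ⟨⟨h1, h2⟩, z, hz, hz', hzS, e1, e2⟩ := h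
        refine ⟨(z, σ z), ?_, h1, h2, rfl⟩
        simp only [I, mem_filter, mem_product, mem_fiber]
        exact ⟨⟨⟨hzS, e1⟩, (pairings_mem hσ).2 hzS, e2⟩, hz, hz'⟩
    _ ≤ ∑ z ∈ I, _ := pr_exists_le _ _ _
    _ ≤ ∑ z ∈ I, 1 / (((S.card : ℝ) - 1) * ((S.card : ℝ) - 3) * ((S.card : ℝ) - 5)) := by
        refine sum_le_sum fun z hz => ?_
        simp only [I, mem_filter, mem_product, mem_fiber, points, mem_insert, mem_singleton] at hz
        have hne : z.1 ≠ z.2 := fun e => hi.2.1.2.2 (by rw [← hz.1.1.2, e, hz.1.2.2])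
        refine pr_apply_three_le (by simp; tauto) ?_ hL
        simp only [List.nodup_cons, List.mem_cons, List.not_mem_nil, List.nodup_nil] at hnd ⊢
        grind
    _ ≤ _ := by
        rw [sum_const, nsmul_eq_mul, mul_one_div]
        gcongr
        calc (I.card : ℝ) ≤ ((fiber π S (π i.1.1)).card * (fiber π S (π i.1.2)).card : ℕ) := by
              rw [← card_product]; exact_mod_cast card_filter_le _ _
          _ ≤ (Δ * Δ : ℕ) := by exact_mod_cast Nat.mul_le_mul (hΔ _) (hΔ _)
          _ = _ := by push_cast; ring

/-- Upper bound for the probability that the multigraph is simple. -/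
theorem pr_simple_le (hS : Even S.card) (hL : 8 ≤ S.card) {Δ : ℕ}
    (hΔ : ∀ v, (fiber π S v).card ≤ Δ) :
    pr S (Simple π) ≤ Real.exp (-((siblings π S).card / (2 * ((S.card : ℝ) - 1)) +
        ((siblings π S).card ^ 2 - (siblings π S).card * Δ ^ 2) /
          (4 * (((S.card : ℝ) - 1) * ((S.card : ℝ) - 3))))) +
      (((siblings π S).card / (2 * ((S.card : ℝ) - 1)) +
        (siblings π S).card ^ 2 / (4 * (((S.card : ℝ) - 1) * ((S.card : ℝ) - 3)))) *
          sieveError S.card (siblings π S).card +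
        (siblings π S).card ^ 2 *
          (Δ ^ 2 / (((S.card : ℝ) - 1) * ((S.card : ℝ) - 3) * ((S.card : ℝ) - 5)))) := by
  have hL' : (8 : ℝ) ≤ S.card := by exact_mod_cast hL
  have a1 : (0 : ℝ) < S.card - 1 := by linarith
  have a3 : (0 : ℝ) < S.card - 3 := by linarith
  have a5 : (0 : ℝ) < S.card - 5 := by linarith
  set q : ℝ := ((siblings π S).card : ℝ) with hq
  have hq0 : 0 ≤ q := by positivity
  set t : ℝ := Δ ^ 2 / (((S.card : ℝ) - 1) * ((S.card : ℝ) - 3) * ((S.card : ℝ) - 5)) with ht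
  have ht0 : 0 ≤ t := by positivity
  set ε := sieveError S.card q with hε
  have hε0 : 0 ≤ ε := add_nonneg (clashBound_nonneg (by linarith) hq0)
    (clashBound_nonneg (by linarith) hq0)
  have hw := fun j => weight_nonneg (H := H) (L := S.card) (by linarith) j
  let e : (H × H) × (H × H) → ℝ := fun i =>
    weight S.card i * ε + if i ∈ doubles π S then t else 0
  have hlow : ∀ T ⊆ loops π S ∪ doubles π S, ∀ i ∈ loops π S ∪ doubles π S, i ∉ T →
      weight S.card i * pr S (Avoids T) - e i ≤ pr S (fun σ => Holds σ i ∧ Avoids T σ) := by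
    intro T hT i hi hiT
    -- Near independence is available only for the patterns of `T` disjoint from `i`. The discarded
    -- ones can hold together with `i` only in a triple edge, whose probability is the second
    -- summand of `e i`.
    let F := T.filter fun j => Disjoint (points i) (points j)
    have h1 := (pr_holds_and_avoids hL hi (T := F) ((filter_subset _ _).trans hT)
      fun j hj => (mem_filter.1 hj).2).2
    have h2 : pr S (Avoids T) ≤ pr S (Avoids F) :=
      pr_mono fun σ _ h j hj => h j (mem_filter.1 hj).1
    have h3 := pr_and_add_and_not S (fun σ => Holds σ i ∧ Avoids F σ) (Avoids T)
    have h4 : pr S (fun σ => (Holds σ i ∧ Avoids F σ) ∧ Avoids T σ) ≤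
        pr S (fun σ => Holds σ i ∧ Avoids T σ) := pr_mono fun σ _ h => ⟨h.1.1, h.2⟩
    have h5 : pr S (fun σ => (Holds σ i ∧ Avoids F σ) ∧ ¬ Avoids T σ) ≤
        if i ∈ doubles π S then t else 0 := by
      have hF : ∀ σ ∈ pairings S, ((Holds σ i ∧ Avoids F σ) ∧ ¬ Avoids T σ) →
          i ∈ doubles π S ∧ ∃ z, z ∉ points i ∧ σ z ∉ points i ∧ z ∈ S ∧ π z = π i.1.1 ∧
            π (σ z) = π i.1.2 := by
        rintro σ hσ ⟨⟨hi', hF⟩, hnT⟩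
        unfold Avoids at hnT
        push Not at hnT
        obtain ⟨j, hj, hσj⟩ := hnT
        have hd : ¬ Disjoint (points i) (points j) := fun hd =>
          hF j (mem_filter.2 ⟨hj, hd⟩) hσj
        exact triple_of_holds hσ hi (hT hj) (fun h => hiT (h ▸ hj)) hd hi' hσj
      split_ifs with hid
      · exact (pr_mono fun σ hσ h => ⟨h.1.1, (hF σ hσ h).2⟩).trans (pr_triple_le (by omega) hΔ hid)
      · calc _ ≤ pr S (fun _ => False) := pr_mono fun σ hσ h => hid (hF σ hσ h).1
          _ = 0 := by simp [pr]
    have h6 := mul_le_mul_of_nonneg_left h2 (hw i)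
    simp only [e]
    rw [mul_sub] at h1
    linarith
  have h := sieve_upper (P := fun T => pr S (Avoids T))
    (A := fun i T => pr S (fun σ => Holds σ i ∧ Avoids T σ)) (p := weight S.card)
    (I := loops π S ∪ doubles π S) (e := e) (pr_avoids_empty hS)
    (fun T i _ => pr_avoids_insert T i) (fun i _ => hw i)
    (fun i _ => (weight_le (by linarith) i).trans (by rw [div_le_one a1]; linarith))
    (fun i _ => add_nonneg (mul_nonneg (hw i) hε0) (by split_ifs <;> simp [ht0])) hlow
  rw [pr_congr fun σ hσ => simple_iff_avoids hσ]
  refine h.trans ?_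
  have hd : ((doubles π S).card : ℝ) ≤ q ^ 2 := by
    have h1 := card_doubles (π := π) (S := S)
    have h2 := card_quads_le (π := π) (S := S)
    have : (doubles π S).card ≤ (siblings π S).card ^ 2 := by omega
    rw [hq]; exact_mod_cast this
  have hqu : ((quads π S).card : ℝ) ≤ q ^ 2 := by rw [hq]; exact_mod_cast card_quads_le
  have hql : q ^ 2 - q * Δ ^ 2 ≤ (quads π S).card := by
    have := le_card_quads (π := π) hΔ
    have : q ^ 2 ≤ (quads π S).card + q * Δ ^ 2 := by rw [hq]; exact_mod_cast this
    linarith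
  have hse : ∑ i ∈ loops π S ∪ doubles π S, e i =
      (∑ i ∈ loops π S ∪ doubles π S, weight S.card i) * ε + (doubles π S).card * t := by
    simp only [e]
    rw [sum_add_distrib, sum_mul, ← sum_filter, sum_const, nsmul_eq_mul]
    have : (loops π S ∪ doubles π S).filter (fun i => i ∈ doubles π S) = doubles π S := by
      ext i; simp
    rw [this]
  rw [hse, sum_weight]
  gcongr

end PatternCounts

end ConfigModel

namespace ConfigModel

/-! ### Closed sets of low vertices and their behaviour under merging -/

section ClosedSets

open Finset Equiv
open scoped Classical

variable {H V : Type*} [Fintype H] [DecidableEq H] {π : H → V} {S : Finset H} {V₀ : Finset V}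

/-- No edge leaves the vertex set `R`. -/
def Closed (π : H → V) (σ : Perm H) (R : Finset V) : Prop := ∀ h, π h ∈ R → π (σ h) ∈ R

/-- Some non-empty set of vertices from `V₀` is closed. -/
def HasClosed (π : H → V) (V₀ : Finset V) (σ : Perm H) : Prop :=
  ∃ R ⊆ V₀, (∃ h, σ h ≠ h ∧ π h ∈ R) ∧ Closed π σ R

/-- The vertex `v` lies in a closed set of vertices from `V₀`. -/
def ClosedAt (π : H → V) (V₀ : Finset V) (v : V) (σ : Perm H) : Prop :=
  ∃ R ⊆ V₀, v ∈ R ∧ Closed π σ R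

/-- The substitute for "simple and connected". Being closed inside `V₀` is a property that behaves
well when vertices of `V₀` are removed, whereas connectedness involves all vertices. -/
def Good (π : H → V) (V₀ : Finset V) (σ : Perm H) : Prop := Simple π σ ∧ ¬ HasClosed π V₀ σ

variable {σ : Perm H} {x y : H}

/-- The hypothesis `hf` covers a vertex of degree two, which merging suppresses, and two vertices of
degree one, which merging removes while joining their neighbours. The only edge gained joins the
partners of `x` and `y`, and the exclusion of a clash says that it is neither a loop nor parallel to
another edge; the edges lost at `x` and `y` could not violate simplicity either. -/
theorem simple_merge_iff (hσ : σ ∈ pairings S) (hx : x ∈ S) (hy : y ∈ S) (hxy : x ≠ y)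
    (hf : ∀ h ∈ S, π h = π x ∨ π h = π y → h = x ∨ h = y) (hc : ¬ Clash π x y σ) :
    Simple π σ ↔ Simple π (merge x y σ) := by
  have hS := fun h => (mem_pairings.1 hσ).2 h
  have hi := pairings_invol hσ
  have hm := fun h => pairings_mem hσ (h := h)
  have ma := fun h => merge_apply hσ hx hy hxy h
  have hSi : ∀ u v : H, σ u = v → σ v = u := fun u v h => by rw [← h, hi]
  simp only [Clash, not_or, not_exists, List.mem_cons, List.not_mem_nil, or_false] at hc
  obtain ⟨c1, c2, c3⟩ := hc
  have c4 : σ x ≠ x := (hS x).2 hx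
  have c5 : σ y ≠ y := (hS y).2 hy
  have mo : ∀ h, merge x y σ h ≠ h → h ≠ x ∧ h ≠ y ∧ σ h ≠ h := by
    intro h hh
    rw [ma] at hh
    grind
  constructor
  · rintro ⟨h1, h2⟩
    constructor
    · intro h hh
      obtain ⟨n1, n2, n3⟩ := mo h hh
      rw [ma]
      have := h1 h n3
      grind
    · intro h h' hh hh' e1 e2
      obtain ⟨n1, n2, n3⟩ := mo h hh
      obtain ⟨n1', n2', n3'⟩ := mo h' hh'
      by_contra hne
      -- An edge parallel to the new one, listed from the end `σ x`, would be the third kind of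
      -- clash; `key2` lists it from the other end.
      have key : ∀ h h', h ≠ x → h ≠ y → h' ≠ x → h' ≠ y → σ h ≠ h → σ h' ≠ h' → π h = π h' →
          h ≠ h' → h = σ x → π (merge x y σ h) ≠ π (merge x y σ h') := by
        intro h h' n1 n2 n1' n2' n3 n3' e1 hne hh e2
        rw [ma, ma] at e2
        have t1 : σ h = x := hSi _ _ hh.symm
        have := c3 h'
        grind
      have key2 : ∀ h h', h ≠ x → h ≠ y → h' ≠ x → h' ≠ y → σ h ≠ h → σ h' ≠ h' → π h = π h' →
          h ≠ h' → h = σ y → π (merge x y σ h) ≠ π (merge x y σ h') := by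
        intro h h' n1 n2 n1' n2' n3 n3' e1 hne hh e2
        rw [ma, ma] at e2
        have t1 : σ h = y := hSi _ _ hh.symm
        have := c3 (σ h')
        have := hi h'
        grind
      by_cases q1 : h = σ x
      · exact key h h' n1 n2 n1' n2' n3 n3' e1 hne q1 e2
      by_cases q2 : h = σ y
      · exact key2 h h' n1 n2 n1' n2' n3 n3' e1 hne q2 e2
      by_cases q3 : h' = σ x
      · exact key h' h n1' n2' n1 n2 n3' n3 e1.symm (Ne.symm hne) q3 e2.symm
      by_cases q4 : h' = σ y
      · exact key2 h' h n1' n2' n1 n2 n3' n3 e1.symm (Ne.symm hne) q4 e2.symm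
      have r1 : merge x y σ h = σ h := by
        rw [ma]
        have := hSi h x
        have := hSi h y
        grind
      have r2 : merge x y σ h' = σ h' := by
        rw [ma]
        have := hSi h' x
        have := hSi h' y
        grind
      rw [r1, r2] at e2
      exact hne (h2 h h' n3 n3' e1 e2)
  · rintro ⟨h1, h2⟩
    have r1 : ∀ h, h ≠ x → h ≠ y → σ h ≠ x → σ h ≠ y → merge x y σ h = σ h := by
      intro h _ _ _ _
      rw [ma]
      grind
    constructor
    · intro h hh he
      have hhS := (hS h).1 hh
      have hhS' := (hm h).2 hhS
      have f1 := hf h hhS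
      have f2 := hf (σ h) hhS'
      by_cases q : h = x ∨ h = y ∨ σ h = x ∨ σ h = y
      · have := hSi h x
        have := hSi h y
        clear h1 h2 c3 r1 mo ma
        grind
      · push Not at q
        have r := r1 h q.1 q.2.1 q.2.2.1 q.2.2.2
        have := h1 h (by rw [r]; exact hh)
        rw [r] at this
        exact this he
    · intro h h' hh hh' e1 e2
      by_contra hne
      have hhS := (hS h).1 hh
      have hhS' := (hm h).2 hhS
      have hhT := (hS h').1 hh'
      have hhT' := (hm h').2 hhT
      have f1 := hf h hhS
      have f2 := hf (σ h) hhS'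
      have f3 := hf h' hhT
      have f4 := hf (σ h') hhT'
      have nn : σ h ≠ σ h' := fun e => hne (σ.injective e)
      by_cases q : (h = x ∨ h = y ∨ h' = x ∨ h' = y) ∨ (σ h = x ∨ σ h = y ∨ σ h' = x ∨ σ h' = y)
      · have s1 := hSi h x
        have s2 := hSi h y
        have s3 := hSi h' x
        have s4 := hSi h' y
        clear h1 h2 c3 r1 mo ma
        grind
      · push Not at q
        obtain ⟨⟨q1, q2, q3, q4⟩, q5, q6, q7, q8⟩ := q
        have a1 := r1 h q1 q2 q5 q6
        have a2 := r1 h' q3 q4 q7 q8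
        exact hne (h2 h h' (by rwa [a1]) (by rwa [a2]) e1 (by rw [a1, a2]; exact e2))

/-- Closed sets before and after merging correspond by adding or deleting the vertices of `x` and
`y`. The new edge forces the partners of `x` and `y` to the same side, and `hR` guarantees this
beforehand. -/
theorem hasClosed_merge_iff (hσ : σ ∈ pairings S) (hx : x ∈ S) (hy : y ∈ S) (hxy : x ≠ y)
    (hf : ∀ h ∈ S, π h = π x ∨ π h = π y → h = x ∨ h = y) (hxy' : σ x ≠ y)
    (hVx : π x ∈ V₀) (hVy : π y ∈ V₀)
    (hR : ∀ R ⊆ V₀, Closed π σ R → (π x ∈ R ↔ π y ∈ R)) :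
    HasClosed π V₀ σ ↔ HasClosed π V₀ (merge x y σ) := by
  have hS := fun h => (mem_pairings.1 hσ).2 h
  have hi := pairings_invol hσ
  have hm := fun h => pairings_mem hσ (h := h)
  have ma := fun h => merge_apply hσ hx hy hxy h
  have hSi : ∀ u v : H, σ u = v → σ v = u := fun u v h => by rw [← h, hi]
  have c4 : σ x ≠ x := (hS x).2 hx
  have c5 : σ y ≠ y := (hS y).2 hy
  have m1 : merge x y σ (σ x) = σ y := by
    rw [ma, hi]; grind
  have m2 : merge x y σ (σ y) = σ x := by
    rw [ma, hi]; grind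
  have mo : ∀ h, merge x y σ h ≠ h → h ≠ x ∧ h ≠ y ∧ σ h ≠ h := by
    intro h hh
    rw [ma] at hh
    grind
  have r1 : ∀ h, h ≠ x → h ≠ y → h ≠ σ x → h ≠ σ y → merge x y σ h = σ h := by
    intro h _ _ _ _
    rw [ma]
    have := hSi h x
    have := hSi h y
    grind
  have hinj : σ x ≠ σ y := fun e => hxy (σ.injective e)
  have hf' : ∀ h, σ h ≠ h → h ≠ x → h ≠ y → π h ≠ π x ∧ π h ≠ π y := by
    intro h hh n1 n2
    have := hf h ((hS h).1 hh)
    grind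
  have hax := hf' (σ x) (by rw [hi]; exact c4.symm) c4 hxy'
  have hyx' : σ y ≠ x := fun e => hxy' (hSi _ _ e)
  have hby := hf' (σ y) (by rw [hi]; exact c5.symm) hyx' c5
  constructor
  · rintro ⟨R, hRV, ⟨h, hh, hhR⟩, hcl⟩
    refine ⟨R \ {π x, π y}, sdiff_subset.trans hRV, ?_, ?_⟩
    · by_cases hxR : π x ∈ R
      -- The partner of `x` keeps the smaller set non-empty: it is different from `x` and `y` and so
      -- lies at another vertex.
      · refine ⟨σ x, by rw [m1]; exact hinj.symm, ?_⟩
        simp only [Finset.mem_sdiff, mem_insert, mem_singleton, not_or]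
        exact ⟨hcl x hxR, hax⟩
      · have hyR : π y ∉ R := fun e => hxR ((hR R hRV hcl).2 e)
        have n1 : h ≠ x := fun e => hxR (e ▸ hhR)
        have n2 : h ≠ y := fun e => hyR (e ▸ hhR)
        have n3 : h ≠ σ x := fun e => hxR (by have := hcl h hhR; rwa [e, hi] at this)
        have n4 : h ≠ σ y := fun e => hyR (by have := hcl h hhR; rwa [e, hi] at this)
        refine ⟨h, by rwa [r1 h n1 n2 n3 n4], ?_⟩
        simp only [Finset.mem_sdiff, mem_insert, mem_singleton, not_or]
        exact ⟨hhR, hf' h hh n1 n2⟩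
    · intro h hhR
      simp only [Finset.mem_sdiff, mem_insert, mem_singleton, not_or] at hhR ⊢
      obtain ⟨hhR, p1, p2⟩ := hhR
      have n1 : h ≠ x := fun e => p1 (by rw [e])
      have n2 : h ≠ y := fun e => p2 (by rw [e])
      by_cases n3 : h = σ x
      · subst n3
        rw [m1]
        refine ⟨hcl _ ((hR R hRV hcl).1 ?_), hby⟩
        have := hcl _ hhR; rwa [hi] at this
      by_cases n4 : h = σ y
      · subst n4
        rw [m2]
        refine ⟨hcl _ ((hR R hRV hcl).2 ?_), hax⟩
        have := hcl _ hhR; rwa [hi] at this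
      rw [r1 h n1 n2 n3 n4]
      refine ⟨hcl h hhR, ?_⟩
      by_cases hh : σ h = h
      · rw [hh]; exact ⟨p1, p2⟩
      · exact hf' (σ h) (by rw [hi]; exact Ne.symm hh) (fun e => n3 (hSi _ _ e).symm)
          (fun e => n4 (hSi _ _ e).symm)
  · rintro ⟨R, hRV, ⟨h, hh, hhR⟩, hcl⟩
    obtain ⟨n1, n2, n3⟩ := mo h hh
    have hab : π (σ x) ∈ R ↔ π (σ y) ∈ R :=
      ⟨fun e => by have := hcl _ e; rwa [m1] at this, fun e => by have := hcl _ e; rwa [m2] at this⟩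
    by_cases ha : π (σ x) ∈ R
    · have hb := hab.1 ha
      refine ⟨insert (π x) (insert (π y) R), ?_, ⟨h, n3, by simp [hhR]⟩, ?_⟩
      · intro v hv
        simp only [mem_insert] at hv
        rcases hv with rfl | rfl | hv
        exacts [hVx, hVy, hRV hv]
      · intro k hk
        simp only [mem_insert] at hk ⊢
        by_cases k0 : σ k = k
        · rw [k0]; exact hk
        by_cases k1 : k = x
        · rw [k1]; exact Or.inr (Or.inr ha)
        by_cases k2 : k = y
        · rw [k2]; exact Or.inr (Or.inr hb)
        by_cases k3 : k = σ x
        · rw [k3, hi]; exact Or.inl rfl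
        by_cases k4 : k = σ y
        · rw [k4, hi]; exact Or.inr (Or.inl rfl)
        have hk' := hf' k k0 k1 k2
        have := hcl k (by tauto)
        rw [r1 k k1 k2 k3 k4] at this
        exact Or.inr (Or.inr this)
    · have hb := fun e => ha (hab.2 e)
      refine ⟨R \ {π x, π y}, sdiff_subset.trans hRV, ⟨h, n3, ?_⟩, ?_⟩
      · simp only [Finset.mem_sdiff, mem_insert, mem_singleton, not_or]
        exact ⟨hhR, hf' h n3 n1 n2⟩
      · intro k hk
        simp only [Finset.mem_sdiff, mem_insert, mem_singleton, not_or] at hk ⊢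
        by_cases k0 : σ k = k
        · rw [k0]; exact hk
        have k1 : k ≠ x := fun e => hk.2.1 (by rw [e])
        have k2 : k ≠ y := fun e => hk.2.2 (by rw [e])
        have k3 : k ≠ σ x := fun e => ha (by rw [← e]; exact hk.1)
        have k4 : k ≠ σ y := fun e => hb (by rw [← e]; exact hk.1)
        have := hcl k hk.1
        rw [r1 k k1 k2 k3 k4] at this
        exact ⟨this, hf' (σ k) (by rw [hi]; exact Ne.symm k0) (fun e => k3 (hSi _ _ e).symm)
          (fun e => k4 (hSi _ _ e).symm)⟩

/-- Removing a vertex of degree two, or two vertices of degree one, hardly affects `Good`. -/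
theorem abs_pr_good_sub_le (hx : x ∈ S) (hy : y ∈ S) (hxy : x ≠ y)
    (hf : ∀ h ∈ S, π h = π x ∨ π h = π y → h = x ∨ h = y) (hL : 6 ≤ S.card)
    (hVx : π x ∈ V₀) (hVy : π y ∈ V₀) :
    |pr (S \ {x, y}) (Good π V₀) - pr S (Good π V₀)| ≤
      clashBound S.card (siblings π S).card + pr S (fun σ => π x ≠ π y ∧
        (ClosedAt π V₀ (π x) σ ∨ ClosedAt π V₀ (π y) σ)) := by
  set E : Perm H → Prop := fun σ => Clash π x y σ ∨ (π x ≠ π y ∧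
        (ClosedAt π V₀ (π x) σ ∨ ClosedAt π V₀ (π y) σ)) with hE
  have hiff : ∀ σ ∈ pairings S, ¬ E σ → (Good π V₀ σ ↔ Good π V₀ (merge x y σ)) := by
    intro σ hσ hnE
    simp only [hE, not_or] at hnE
    refine and_congr (simple_merge_iff hσ hx hy hxy hf hnE.1) (not_congr
      (hasClosed_merge_iff hσ hx hy hxy hf (fun h => hnE.1 (Or.inl h)) hVx hVy ?_))
    intro R hRV hcl
    by_cases h : π x = π y
    · rw [h]
    · have := hnE.2
      simp only [ne_eq, h, not_false_eq_true, true_and, not_or] at this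
      exact ⟨fun h' => (this.1 ⟨R, hRV, h', hcl⟩).elim, fun h' => (this.2 ⟨R, hRV, h', hcl⟩).elim⟩
  have hb : pr S E ≤ clashBound S.card (siblings π S).card + pr S (fun σ => π x ≠ π y ∧
        (ClosedAt π V₀ (π x) σ ∨ ClosedAt π V₀ (π y) σ)) :=
    (pr_or_le _ _ _).trans (by gcongr; exact pr_clash_le hx hy hxy hL)
  rw [← pr_merge hx hy hxy]
  refine le_trans (abs_sub_le_iff.2 ⟨?_, ?_⟩) hb
  · have := pr_le_add S (fun σ => Good π V₀ (merge x y σ)) (Good π V₀)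
    have h2 : pr S (fun σ => Good π V₀ (merge x y σ) ∧ ¬ Good π V₀ σ) ≤ pr S E :=
      pr_mono fun σ hσ h => by
        by_contra hnE; exact h.2 ((hiff σ hσ hnE).2 h.1)
    linarith
  · have := pr_le_add S (Good π V₀) (fun σ => Good π V₀ (merge x y σ))
    have h2 : pr S (fun σ => Good π V₀ σ ∧ ¬ Good π V₀ (merge x y σ)) ≤ pr S E :=
      pr_mono fun σ hσ h => by
        by_contra hnE; exact h.2 ((hiff σ hσ hnE).1 h.1)
    linarith

/-- The points of `S` over a set of vertices. -/
noncomputable def above (π : H → V) (S : Finset H) (R : Finset V) : Finset H :=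
  S.filter fun h => π h ∈ R

theorem mem_above {R : Finset V} {h : H} : h ∈ above π S R ↔ h ∈ S ∧ π h ∈ R := by simp [above]

theorem above_subset {R : Finset V} : above π S R ⊆ S := filter_subset _ _

/-- A simple matching consists of a simple matching of the largest closed set of vertices from
`V₀`, and a good matching of the rest. -/
theorem card_simple_eq_sum (hV : ∀ v ∈ V₀, ∃ h ∈ S, π h = v) :
    ((pairings S).filter (Simple π)).card = ∑ R ∈ V₀.powerset,
      ((pairings (above π S R)).filter (Simple π)).card *
        ((pairings (S \ above π S R)).filter (Good π V₀)).card := by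
  -- The union of all closed subsets of `V₀`; it is closed itself and therefore the largest one.
  let m : Perm H → Finset V := fun σ => V₀.filter fun v => ClosedAt π V₀ v σ
  have hmV : ∀ σ, m σ ⊆ V₀ := fun σ => filter_subset _ _
  have hmcl : ∀ σ, Closed π σ (m σ) := by
    intro σ h hh
    simp only [m, mem_filter] at hh ⊢
    obtain ⟨R, hRV, hhR, hcl⟩ := hh.2
    exact ⟨hRV (hcl h hhR), R, hRV, hcl h hhR, hcl⟩
  have hle : ∀ σ R, R ⊆ V₀ → Closed π σ R → R ⊆ m σ := fun σ R hRV hcl v hv => by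
    simp only [m, mem_filter]; exact ⟨hRV hv, R, hRV, hv, hcl⟩
  rw [card_eq_sum_card_fiberwise (f := m) (t := V₀.powerset)
    (fun σ _ => by rw [mem_coe, mem_powerset]; exact hmV σ)]
  refine sum_congr rfl fun R hR => ?_
  rw [mem_powerset] at hR
  rw [← card_product, ← filter_product]
  have e1 : ((pairings S).filter (Simple π)).filter (fun σ => m σ = R) =
      (pairings S).filter fun σ => (∀ h ∈ above π S R, σ h ∈ above π S R) ∧
        (Simple π σ ∧ m σ = R) := by
    rw [filter_filter]
    refine filter_congr fun σ hσ => ⟨fun h => ⟨fun k hk => ?_, h⟩, fun h => h.2⟩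
    rw [mem_above] at hk ⊢
    refine ⟨(pairings_mem hσ).2 hk.1, ?_⟩
    have := hmcl σ k (by rw [h.2]; exact hk.2)
    rwa [h.2] at this
  rw [e1]
  refine Eq.trans (by congr!) ((card_closed (above_subset (π := π) (S := S) (R := R))
    (fun σ => Simple π σ ∧ m σ = R)).trans ?_)
  congr 1
  ext ⟨τ, ρ⟩
  simp only [mem_filter]
  refine and_congr_right fun hτρ => ?_
  rw [mem_product] at hτρ
  obtain ⟨hτ, hρ⟩ := hτρ
  simp only at hτ hρ ⊢
  have mτ := fun h => (mem_pairings.1 hτ).2 h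
  have mρ := fun h => (mem_pairings.1 hρ).2 h
  have fτ := fun h => pairings_mem hτ (h := h)
  have fρ := fun h => pairings_mem hρ (h := h)
  simp only [Finset.mem_sdiff, mem_above, not_and] at mτ mρ fτ fρ
  have a1 : ∀ h, h ∈ S → π h ∈ R → (τ * ρ) h = τ h := by
    intro h h1 h2
    rw [Perm.mul_apply]
    congr 1
    by_contra hne
    exact ((mρ h).1 hne).2 h1 h2
  have a2 : ∀ h, π h ∉ R → (τ * ρ) h = ρ h := by
    intro h h2
    rw [Perm.mul_apply]
    by_contra hne
    have h3 := (mτ _).1 hne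
    by_cases h4 : ρ h = h
    · rw [h4] at h3; exact h2 h3.2
    · exact ((fρ h).2 ((mρ h).1 h4)).2 h3.1 h3.2
  have a3 : ∀ h, h ∉ S → (τ * ρ) h = h := by
    intro h h2
    have h3 : ρ h = h := by
      by_contra hne; exact h2 ((mρ h).1 hne).1
    rw [Perm.mul_apply, h3]
    by_contra hne; exact h2 ((mτ h).1 hne).1
  have hclR : Closed π (τ * ρ) R := by
    intro h hh
    by_cases hS : h ∈ S
    · rw [a1 h hS hh]; exact ((fτ h).2 ⟨hS, hh⟩).2
    · rw [a3 h hS]; exact hh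
  have hS' : Simple π (τ * ρ) ↔ Simple π τ ∧ Simple π ρ := by
    constructor
    · rintro ⟨h1, h2⟩
      refine ⟨⟨fun h hh => ?_, fun h h' hh hh' e1 e2 => ?_⟩,
        ⟨fun h hh => ?_, fun h h' hh hh' e1 e2 => ?_⟩⟩
      · have := (mτ h).1 hh
        have e := a1 h this.1 this.2
        have := h1 h (by rwa [e])
        rwa [e] at this
      · have t1 := (mτ h).1 hh
        have t2 := (mτ h').1 hh'
        have e := a1 h t1.1 t1.2
        have e' := a1 h' t2.1 t2.2
        exact h2 h h' (by rwa [e]) (by rwa [e']) e1 (by rw [e, e', e2])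
      · have := (mρ h).1 hh
        have e := a2 h (this.2 this.1)
        have := h1 h (by rwa [e])
        rwa [e] at this
      · have t1 := (mρ h).1 hh
        have t2 := (mρ h').1 hh'
        have e := a2 h (t1.2 t1.1)
        have e' := a2 h' (t2.2 t2.1)
        exact h2 h h' (by rwa [e]) (by rwa [e']) e1 (by rw [e, e', e2])
    · rintro ⟨⟨h1, h2⟩, h3, h4⟩
      refine ⟨fun h hh => ?_, fun h h' hh hh' e1 e2 => ?_⟩
      · by_cases hR : π h ∈ R
        · have hS : h ∈ S := by by_contra hS; exact hh (a3 h hS)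
          rw [a1 h hS hR] at hh ⊢
          exact h1 h hh
        · rw [a2 h hR] at hh ⊢
          exact h3 h hh
      · have hS : h ∈ S := by by_contra hS; exact hh (a3 h hS)
        have hS' : h' ∈ S := by by_contra hS; exact hh' (a3 h' hS)
        by_cases hR : π h ∈ R
        · have hR' : π h' ∈ R := e1 ▸ hR
          rw [a1 h hS hR] at hh e2
          rw [a1 h' hS' hR'] at hh' e2
          exact h2 h h' hh hh' e1 e2
        · have hR' : π h' ∉ R := e1 ▸ hR
          rw [a2 h hR] at hh e2
          rw [a2 h' hR'] at hh' e2
          exact h4 h h' hh hh' e1 e2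
  -- A closed set of the remaining matching could be added to `R`. Conversely, the part of the
  -- largest closed set outside `R` is closed for the remaining matching, and `hV` supplies the
  -- point of `S` that makes it non-trivial.
  have hm' : m (τ * ρ) = R ↔ ¬ HasClosed π V₀ ρ := by
    constructor
    · rintro hm ⟨R', hRV, ⟨h, hh, hhR⟩, hcl⟩
      have hcl2 : Closed π (τ * ρ) (R ∪ R') := by
        intro k hk
        rw [mem_union] at hk ⊢
        by_cases hR : π k ∈ R
        · exact Or.inl (hclR k hR)
        · rw [a2 k hR]; exact Or.inr (hcl k (hk.resolve_left hR))
      have h1 := hle _ _ (union_subset hR hRV) hcl2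
      rw [hm] at h1
      have h2 := (mρ h).1 hh
      exact h2.2 h2.1 (h1 (mem_union_right _ hhR))
    · intro hnc
      refine Subset.antisymm ?_ (hle _ _ hR hclR)
      intro v hv
      by_contra hvR
      obtain ⟨h, hS, rfl⟩ := hV v (hmV _ hv)
      refine hnc ⟨m (τ * ρ) \ R, sdiff_subset.trans (hmV _), ⟨h, (mρ h).2 ⟨hS, fun _ => hvR⟩, ?_⟩, ?_⟩
      · rw [Finset.mem_sdiff]; exact ⟨hv, hvR⟩
      · intro k hk
        rw [Finset.mem_sdiff] at hk ⊢
        have h1 := hmcl _ k hk.1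
        rw [a2 k hk.2] at h1
        refine ⟨h1, ?_⟩
        by_cases h2 : ρ k = k
        · rw [h2]; exact hk.2
        · have := (fρ k).2 ((mρ k).1 h2)
          exact this.2 this.1
  rw [hS', hm', Good, and_assoc]

end ClosedSets

end ConfigModel

namespace ConfigModel

/-! ### Wallis integrals and Gaussian bounds -/

section WallisIntegrals

open Real

/-- The integrals `∫ cos ^ a * sin ^ b` over a quarter period. -/
noncomputable def wallis (a b : ℕ) : ℝ := ∫ θ in (0 : ℝ)..(π / 2), cos θ ^ a * sin θ ^ b

theorem wallis_integrable (a b : ℕ) (x y : ℝ) :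
    IntervalIntegrable (fun θ => cos θ ^ a * sin θ ^ b) volume x y :=
  Continuous.intervalIntegrable (by fun_prop) _ _

theorem wallis_recurrence (a b : ℕ) :
    ((a : ℝ) + 1) * wallis a (b + 2) = ((b : ℝ) + 1) * wallis (a + 2) b := by
  have h : ∀ θ ∈ Set.uIcc (0 : ℝ) (π / 2), HasDerivAt (fun θ => cos θ ^ (a + 1) * sin θ ^ (b + 1))
      (((b : ℝ) + 1) * (cos θ ^ (a + 2) * sin θ ^ b) -
        ((a : ℝ) + 1) * (cos θ ^ a * sin θ ^ (b + 2))) θ := by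
    intro θ _
    have h1 := (hasDerivAt_cos θ).pow (a + 1)
    have h2 := (hasDerivAt_sin θ).pow (b + 1)
    refine (h1.mul h2).congr_deriv ?_
    simp only [Nat.add_sub_cancel, Pi.pow_apply]
    push_cast
    ring
  have hint : IntervalIntegrable (fun θ => ((b : ℝ) + 1) * (cos θ ^ (a + 2) * sin θ ^ b) -
        ((a : ℝ) + 1) * (cos θ ^ a * sin θ ^ (b + 2))) volume 0 (π / 2) :=
    Continuous.intervalIntegrable (by fun_prop) _ _
  have h3 := intervalIntegral.integral_eq_sub_of_hasDerivAt h hint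
  rw [intervalIntegral.integral_sub ((wallis_integrable _ _ _ _).const_mul _)
    ((wallis_integrable _ _ _ _).const_mul _), intervalIntegral.integral_const_mul, intervalIntegral.integral_const_mul] at h3
  simp at h3
  unfold wallis
  linarith

/-- Integration by parts trades two sines for two cosines at the same ratio as the double
factorials. The product of matching counts of two parts, divided by the count of the whole, is
thereby a ratio of integrals. Its numerator has an integrand that is multiplicative over the points,
which makes union bounds factor. -/
theorem wallis_eq (u : ℕ) : ∀ a, Even a →
    wallis a (2 * u) * matchingCount (a + 2 * u) =
      matchingCount a * matchingCount (2 * u) * wallis (a + 2 * u) 0 := by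
  induction u with
  | zero => intro a _; simp [matchingCount_zero, mul_comm]
  | succ u ih =>
    intro a ha
    have h1 := wallis_recurrence a (2 * u)
    have h2 := ih (a + 2) (ha.add even_two)
    have e : a + 2 + 2 * u = a + 2 * (u + 1) := by ring
    rw [e, matchingCount_add_two ha] at h2
    have e2 : 2 * (u + 1) = 2 * u + 2 := by ring
    rw [e2, matchingCount_add_two (by simp)]
    rw [e2] at h2
    have ha1 : ((a : ℝ) + 1) ≠ 0 := by positivity
    apply mul_left_cancel₀ ha1
    push_cast at h1 h2 ⊢
    calc _ = ((a : ℝ) + 1) * wallis a (2 * u + 2) * matchingCount (a + (2 * u + 2)) := by ring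
      _ = (2 * u + 1) * (wallis (a + 2) (2 * u) * matchingCount (a + (2 * u + 2))) := by
          rw [h1]; ring
      _ = _ := by rw [h2]; ring

/-- On `[0, 1 / √L]` Bernoulli's inequality gives `cos ^ L ≥ (1 - 1 / (2 * L)) ^ L ≥ 1 / 2`. -/
theorem wallis_zero_ge {L : ℕ} (hL : 1 ≤ L) : 1 / (2 * √L) ≤ wallis L 0 := by
  have hL' : (1 : ℝ) ≤ L := by exact_mod_cast hL
  have hs : 1 ≤ √(L : ℝ) := by rw [one_le_sqrt]; exact hL'
  have hs0 : 0 < √(L : ℝ) := by linarith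
  have hle : 1 / √(L : ℝ) ≤ π / 2 := by
    have : 1 / √(L : ℝ) ≤ 1 := by rw [div_le_one hs0]; exact hs
    linarith [two_le_pi]
  have h0 : 0 ≤ 1 / √(L : ℝ) := by positivity
  unfold wallis
  rw [← intervalIntegral.integral_add_adjacent_intervals (wallis_integrable L 0 0 (1 / √L))
    (wallis_integrable L 0 (1 / √L) (π / 2))]
  have h2 : 0 ≤ ∫ θ in (1 / √(L : ℝ))..(π / 2), cos θ ^ L * sin θ ^ 0 := by
    refine intervalIntegral.integral_nonneg hle fun θ hθ => ?_
    have : 0 ≤ cos θ := cos_nonneg_of_mem_Icc ⟨by linarith [hθ.1, pi_pos], hθ.2⟩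
    simp only [pow_zero, mul_one]
    positivity
  have h1 : ∫ _ in (0 : ℝ)..(1 / √(L : ℝ)), (1 / 2 : ℝ) ≤
      ∫ θ in (0 : ℝ)..(1 / √(L : ℝ)), cos θ ^ L * sin θ ^ 0 := by
    refine intervalIntegral.integral_mono_on h0 (by simp) (wallis_integrable _ _ _ _) fun θ hθ => ?_
    have hθ2 : θ ^ 2 ≤ 1 / (L : ℝ) := by
      calc θ ^ 2 ≤ (1 / √(L : ℝ)) ^ 2 := by
            have := hθ.1; have := hθ.2; gcongr
        _ = 1 / (L : ℝ) := by rw [div_pow, sq_sqrt (by positivity), one_pow]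
    have hinv : 1 / (L : ℝ) ≤ 1 := by rw [div_le_one (by positivity)]; exact hL'
    have h3 : 1 - θ ^ 2 / 2 ≤ cos θ := one_sub_sq_div_two_le_cos
    have h4 : 0 ≤ 1 - 1 / (2 * L : ℝ) := by
      have : 1 / (2 * L : ℝ) = 1 / L / 2 := by field_simp
      rw [this]; linarith
    have h5 : 1 - 1 / (2 * L : ℝ) ≤ cos θ := by
      have : 1 / (2 * L : ℝ) = 1 / L / 2 := by field_simp
      rw [this]; linarith
    have h6 := one_add_mul_le_pow (a := -(1 / (2 * L : ℝ))) (by linarith) L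
    simp only [pow_zero, mul_one]
    calc (1 / 2 : ℝ) = 1 + L * -(1 / (2 * L : ℝ)) := by field_simp; ring
      _ ≤ (1 + -(1 / (2 * L : ℝ))) ^ L := h6
      _ ≤ cos θ ^ L := by rw [← sub_eq_add_neg]; gcongr
  have h7 : ∫ _ in (0 : ℝ)..(1 / √(L : ℝ)), (1 / 2 : ℝ) = 1 / (2 * √L) := by
    rw [intervalIntegral.integral_const]; simp
  linarith

/-- The function `log (cos t) + t ^ 2 / 2` vanishes at zero and has derivative `t - tan t`, which is
not positive. -/
theorem cos_le_exp_neg_sq {θ : ℝ} (h0 : 0 ≤ θ) (h1 : θ ≤ π / 2) :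
    cos θ ≤ exp (-(θ ^ 2 / 2)) := by
  rcases h1.eq_or_lt with rfl | h1
  · rw [cos_pi_div_two]; positivity
  have hd : ∀ t ∈ Set.Ico 0 (π / 2), HasDerivAt (fun t => log (cos t) + t ^ 2 / 2)
      (-sin t / cos t + t) t := by
    intro t ht
    have hc : 0 < cos t := cos_pos_of_mem_Ioo ⟨by linarith [ht.1, pi_pos], ht.2⟩
    refine (((hasDerivAt_cos t).log hc.ne').add (((hasDerivAt_id t).pow 2).div_const 2)).congr_deriv ?_
    simp
  have hanti : AntitoneOn (fun t => log (cos t) + t ^ 2 / 2) (Set.Ico 0 (π / 2)) := by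
    refine antitoneOn_of_deriv_nonpos (convex_Ico _ _)
      (fun t ht => (hd t ht).continuousAt.continuousWithinAt)
      (fun t ht => (hd t (interior_subset ht)).differentiableAt.differentiableWithinAt) ?_
    intro t ht
    rw [(hd t (interior_subset ht)).deriv]
    rw [interior_Ico] at ht
    have := lt_tan ht.1 ht.2
    rw [tan_eq_sin_div_cos] at this
    rw [neg_div]
    linarith
  have h2 := hanti (Set.mem_Ico.2 ⟨le_rfl, by linarith [pi_pos]⟩) (Set.mem_Ico.2 ⟨h0, h1⟩) h0
  simp only [cos_zero, log_one] at h2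
  have hc : 0 < cos θ := cos_pos_of_mem_Ioo ⟨by linarith [pi_pos], h1⟩
  rw [← log_le_iff_le_exp hc]
  linarith

theorem integral_mul_exp_neg_sq_le {c : ℝ} (hc : 0 < c) :
    ∫ θ in (0 : ℝ)..(π / 2), θ * exp (-(c * θ ^ 2)) ≤ 1 / (2 * c) := by
  have h : ∀ θ ∈ Set.uIcc (0 : ℝ) (π / 2), HasDerivAt (fun θ => -(1 / (2 * c)) * exp (-(c * θ ^ 2)))
      (θ * exp (-(c * θ ^ 2))) θ := by
    intro θ _
    refine (((((hasDerivAt_id θ).pow 2).const_mul c).neg).exp.const_mul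
      (-(1 / (2 * c)))).congr_deriv ?_
    simp
    field_simp
  rw [intervalIntegral.integral_eq_sub_of_hasDerivAt h (Continuous.intervalIntegrable (by fun_prop) _ _)]
  have : 0 ≤ 1 / (2 * c) * exp (-(c * (π / 2) ^ 2)) := by positivity
  simp
  simp at this
  linarith

/-- Completing the square: half of the exponent `m * θ ^ 2 / 2` absorbs the linear term that comes
from vertices of degree one. -/
theorem linear_le_sq {a m θ : ℝ} (hm : 0 < m) : a * θ ≤ a ^ 2 / m + m * θ ^ 2 / 4 := by
  have h : 0 ≤ (a - m * θ / 2) ^ 2 / m := by positivity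
  have e : (a - m * θ / 2) ^ 2 / m = a ^ 2 / m - a * θ + m * θ ^ 2 / 4 := by
    field_simp; ring
  linarith

theorem integral_first_le {a m : ℝ} (hm : 0 < m) :
    ∫ θ in (0 : ℝ)..(π / 2), θ * exp (a * θ - m * θ ^ 2 / 2) ≤ exp (a ^ 2 / m) * (2 / m) := by
  calc _ ≤ ∫ θ in (0 : ℝ)..(π / 2), exp (a ^ 2 / m) * (θ * exp (-(m / 4 * θ ^ 2))) := by
        refine intervalIntegral.integral_mono_on (by positivity) (Continuous.intervalIntegrable (by fun_prop) _ _)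
          (Continuous.intervalIntegrable (by fun_prop) _ _) fun θ hθ => ?_
        have h0 := hθ.1
        have h1 := linear_le_sq (a := a) (θ := θ) hm
        calc _ ≤ θ * exp (a ^ 2 / m + -(m / 4 * θ ^ 2)) := by gcongr; linarith
          _ = _ := by rw [exp_add]; ring
    _ ≤ _ := by
        rw [intervalIntegral.integral_const_mul]
        gcongr
        refine (integral_mul_exp_neg_sq_le (by positivity : 0 < m / 4)).trans_eq ?_
        field_simp; ring

theorem integral_third_le {a m : ℝ} (hm : 0 < m) :
    ∫ θ in (0 : ℝ)..(π / 2), θ ^ 3 * exp (a * θ - m * θ ^ 2 / 2) ≤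
      exp (a ^ 2 / m) * (32 / m ^ 2) := by
  calc _ ≤ ∫ θ in (0 : ℝ)..(π / 2), exp (a ^ 2 / m) * (8 / m) * (θ * exp (-(m / 8 * θ ^ 2))) := by
        refine intervalIntegral.integral_mono_on (by positivity) (Continuous.intervalIntegrable (by fun_prop) _ _)
          (Continuous.intervalIntegrable (by fun_prop) _ _) fun θ hθ => ?_
        have h0 := hθ.1
        have h1 := linear_le_sq (a := a) (θ := θ) hm
        have h2 := add_one_le_exp (m * θ ^ 2 / 8)
        -- Half of the remaining decay `m * θ ^ 2 / 4` pays for the extra factor `θ ^ 2`.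
        have h3 : θ ^ 2 ≤ 8 / m * exp (m * θ ^ 2 / 8) := by
          rw [div_mul_eq_mul_div, le_div_iff₀ hm]; linarith
        calc θ ^ 3 * exp (a * θ - m * θ ^ 2 / 2)
            = θ * θ ^ 2 * exp (a * θ - m * θ ^ 2 / 2) := by ring
          _ ≤ θ * (8 / m * exp (m * θ ^ 2 / 8)) * exp (a ^ 2 / m + -(m / 4 * θ ^ 2)) := by
              gcongr; linarith
          _ = exp (a ^ 2 / m) * (8 / m) * (θ * (exp (m * θ ^ 2 / 8) * exp (-(m / 4 * θ ^ 2)))) := by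
              rw [exp_add]; ring
          _ = _ := by rw [← exp_add]; congr 3; ring_nf
    _ ≤ _ := by
        rw [intervalIntegral.integral_const_mul]
        calc _ ≤ exp (a ^ 2 / m) * (8 / m) * (1 / (2 * (m / 8))) := by
              gcongr; exact integral_mul_exp_neg_sq_le (by positivity)
          _ = _ := by field_simp; ring

end WallisIntegrals

/-! ### The union bound for closed sets of vertices -/

section ClosedProbability

open Finset Equiv
open scoped Classical

variable {H V : Type*} [Fintype H] [DecidableEq H] [Fintype V] {π : H → V} {S : Finset H}
  {V₀ : Finset V}

theorem card_pairings_odd (hS : ¬ Even S.card) : (pairings S).card = 0 := by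
  rw [card_eq_zero, eq_empty_iff_forall_notMem]
  intro σ hσ
  refine hS (even_iff_two_dvd.2 ?_)
  have h1 : σ ^ 2 = 1 := by
    ext h; rw [sq, Perm.mul_apply, pairings_invol hσ, Perm.one_apply]
  have h2 := Perm.two_dvd_card_support h1
  have h3 : σ.support = S := by
    ext h; rw [Perm.mem_support]; exact (mem_pairings.1 hσ).2 h
  rwa [h3] at h2

/-- For even `T` the quotient of matching counts is evaluated by `wallis_eq` with equality; for odd
`T` the probability is zero. The inequality makes it unnecessary to track parity in the union bound.
-/
theorem pr_closed_le (hS : Even S.card) {T : Finset H} (hT : T ⊆ S) :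
    pr S (fun σ => ∀ h ∈ T, σ h ∈ T) * wallis S.card 0 ≤ wallis (S \ T).card T.card := by
  have hc := card_closed hT (fun _ => True)
  simp only [and_true, filter_true, card_product] at hc
  have hcard := card_sdiff_add_card_eq_card hT
  have hnn : 0 ≤ wallis (S \ T).card T.card := by
    refine intervalIntegral.integral_nonneg (by positivity) fun θ hθ => ?_
    have : 0 ≤ Real.cos θ :=
      Real.cos_nonneg_of_mem_Icc ⟨by linarith [hθ.1, Real.pi_pos], hθ.2⟩
    have : 0 ≤ Real.sin θ :=
      Real.sin_nonneg_of_mem_Icc ⟨hθ.1, by linarith [hθ.2, Real.pi_pos]⟩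
    positivity
  by_cases he : Even T.card
  · have he' : Even (S \ T).card := by
      rw [← hcard] at hS; exact (Nat.even_add.1 hS).2 he
    obtain ⟨u, hu⟩ := he.two_dvd
    have h := wallis_eq u (S \ T).card he'
    rw [← hu, hcard] at h
    rw [pr_def, hc, card_pairings hS, card_pairings he, card_pairings he']
    have : (0 : ℝ) < matchingCount S.card := by exact_mod_cast matchingCount_pos _
    rw [div_mul_eq_mul_div, div_le_iff₀ this, h]
    push_cast
    exact le_of_eq (by ring)
  · rw [pr_def, hc, card_pairings_odd he]
    simpa using hnn

theorem card_above (Q : Finset V) : (above π S Q).card = ∑ w ∈ Q, (fiber π S w).card := by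
  rw [card_eq_sum_card_fiberwise (f := π) (t := Q) fun h hh => by
    rw [mem_coe, mem_above] at hh; exact hh.2]
  refine sum_congr rfl fun w hw => ?_
  congr 1
  ext h
  simp only [mem_filter, mem_above, mem_fiber]
  constructor
  · rintro ⟨⟨a, b⟩, c⟩; exact ⟨a, c⟩
  · rintro ⟨a, c⟩; exact ⟨⟨a, c ▸ hw⟩, c⟩

theorem card_sdiff_above (Q : Finset V) :
    (S \ above π S Q).card = ∑ w ∈ Qᶜ, (fiber π S w).card := by
  rw [← card_above]
  congr 1
  ext h
  simp only [Finset.mem_sdiff, mem_above, mem_compl]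
  tauto

/-- A union bound for closed sets of vertices. -/
theorem pr_exists_closed_le (hS : Even S.card) (h1 : 1 ≤ S.card) {ι : Type*} (I : Finset ι)
    (R : ι → Finset V) {G : ℝ → ℝ} (hGc : Continuous G)
    (hG : ∀ θ, 0 ≤ θ → θ ≤ Real.pi / 2 → ∑ i ∈ I, (∏ w ∈ R i, Real.sin θ ^ (fiber π S w).card) *
      (∏ w ∈ (R i)ᶜ, Real.cos θ ^ (fiber π S w).card) ≤ G θ) :
    pr S (fun σ => ∃ i ∈ I, Closed π σ (R i)) ≤
      2 * √S.card * ∫ θ in (0 : ℝ)..(Real.pi / 2), G θ := by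
  have hw := wallis_zero_ge h1
  have hs : 0 < √(S.card : ℝ) := Real.sqrt_pos.2 (by exact_mod_cast h1)
  have hw0 : 0 < wallis S.card 0 := lt_of_lt_of_le (by positivity) hw
  have hsum : ∑ i ∈ I, wallis (S \ above π S (R i)).card (above π S (R i)).card ≤
      ∫ θ in (0 : ℝ)..(Real.pi / 2), G θ := by
    unfold wallis
    -- After sum and integral are exchanged, the integrand at a fixed angle is a sum over vertex
    -- sets of products over vertices, to which `hG` applies.
    rw [← intervalIntegral.integral_finsetSum fun i _ => wallis_integrable _ _ _ _]
    refine intervalIntegral.integral_mono_on (by positivity)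
      (Continuous.intervalIntegrable (by fun_prop) _ _) (hGc.intervalIntegrable _ _) fun θ hθ => ?_
    refine le_trans (le_of_eq ?_) (hG θ hθ.1 hθ.2)
    refine sum_congr rfl fun i _ => ?_
    rw [card_above, card_sdiff_above, prod_pow_eq_pow_sum, prod_pow_eq_pow_sum, mul_comm]
  have hG0 : 0 ≤ ∫ θ in (0 : ℝ)..(Real.pi / 2), G θ := by
    refine intervalIntegral.integral_nonneg (by positivity) fun θ hθ => ?_
    refine le_trans (sum_nonneg fun i _ => ?_) (hG θ hθ.1 hθ.2)
    have : 0 ≤ Real.cos θ :=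
      Real.cos_nonneg_of_mem_Icc ⟨by linarith [hθ.1, Real.pi_pos], hθ.2⟩
    have : 0 ≤ Real.sin θ :=
      Real.sin_nonneg_of_mem_Icc ⟨hθ.1, by linarith [hθ.2, Real.pi_pos]⟩
    positivity
  calc pr S (fun σ => ∃ i ∈ I, Closed π σ (R i))
      ≤ pr S (fun σ => ∃ i ∈ I, ∀ h ∈ above π S (R i), σ h ∈ above π S (R i)) := by
        refine pr_mono fun σ hσ => ?_
        rintro ⟨i, hi, hcl⟩
        refine ⟨i, hi, fun h hh => ?_⟩
        rw [mem_above] at hh ⊢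
        exact ⟨(pairings_mem hσ).2 hh.1, hcl h hh.2⟩
    _ ≤ ∑ i ∈ I, pr S (fun σ => ∀ h ∈ above π S (R i), σ h ∈ above π S (R i)) :=
        pr_exists_le _ _ _
    _ ≤ ∑ i ∈ I, wallis (S \ above π S (R i)).card (above π S (R i)).card / wallis S.card 0 := by
        refine sum_le_sum fun i _ => ?_
        rw [le_div_iff₀ hw0]
        exact pr_closed_le hS above_subset
    _ = (∑ i ∈ I, wallis (S \ above π S (R i)).card (above π S (R i)).card) / wallis S.card 0 := by
        rw [sum_div]
    _ ≤ (∫ θ in (0 : ℝ)..(Real.pi / 2), G θ) / (1 / (2 * √S.card)) := by gcongr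
    _ = _ := by field_simp

end ClosedProbability

end ConfigModel

namespace ConfigModel

/-! ### Closed sets at a given low vertex, and closed sets that separate high vertices -/

section ClosedBounds

open Finset Equiv
open scoped Classical

variable {H V : Type*} [Fintype H] [DecidableEq H] [Fintype V] {π : H → V} {S : Finset H}
  {V₀ : Finset V}

theorem cos_sin_mem {θ : ℝ} (h0 : 0 ≤ θ) (h1 : θ ≤ Real.pi / 2) :
    0 ≤ Real.cos θ ∧ 0 ≤ Real.sin θ ∧ Real.cos θ ≤ 1 ∧ Real.sin θ ≤ 1 ∧ Real.sin θ ≤ θ :=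
  ⟨Real.cos_nonneg_of_mem_Icc ⟨by linarith [Real.pi_pos], h1⟩,
    Real.sin_nonneg_of_mem_Icc ⟨h0, by linarith [Real.pi_pos]⟩, Real.cos_le_one _,
    Real.sin_le_one _, Real.sin_le h0⟩

theorem cos_pow_le_exp {θ : ℝ} (h0 : 0 ≤ θ) (h1 : θ ≤ Real.pi / 2) {m k : ℕ} (hm : m ≤ k) :
    Real.cos θ ^ k ≤ Real.exp (-(m * θ ^ 2 / 2)) := by
  obtain ⟨hc, -, hc1, -, -⟩ := cos_sin_mem h0 h1
  calc Real.cos θ ^ k ≤ Real.cos θ ^ m := pow_le_pow_of_le_one hc hc1 hm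
    _ ≤ Real.exp (-(θ ^ 2 / 2)) ^ m := by gcongr; exact cos_le_exp_neg_sq h0 h1
    _ = _ := by rw [← Real.exp_nat_mul]; congr 1; ring

/-- Vertices of degree two contribute a factor one, vertices of degree one a factor
`cos θ + sin θ`. -/
theorem prod_sin_add_cos_le {θ : ℝ} (h0 : 0 ≤ θ) (h1 : θ ≤ Real.pi / 2) (U : Finset V) {f : V → ℕ}
    (hU : ∀ w ∈ U, f w = 1 ∨ f w = 2) {k : ℕ} (hk : (U.filter fun w => f w = 1).card ≤ k) :
    ∏ w ∈ U, (Real.sin θ ^ f w + Real.cos θ ^ f w) ≤ Real.exp (k * θ) := by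
  obtain ⟨hc, hs, hc1, hs1, hsθ⟩ := cos_sin_mem h0 h1
  calc ∏ w ∈ U, (Real.sin θ ^ f w + Real.cos θ ^ f w)
      ≤ ∏ w ∈ U, (if f w = 1 then Real.exp θ else 1) := by
        refine prod_le_prod (fun w _ => by positivity) fun w hw => ?_
        rcases hU w hw with h | h
        · rw [if_pos h, h, pow_one, pow_one]
          linarith [Real.add_one_le_exp θ]
        · rw [if_neg (by omega), h, Real.sin_sq_add_cos_sq]
    _ = Real.exp θ ^ (U.filter fun w => f w = 1).card := by
        rw [prod_ite, prod_const, prod_const_one, mul_one]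
    _ ≤ Real.exp θ ^ k := pow_le_pow_right₀ (Real.one_le_exp h0) hk
    _ = _ := by rw [← Real.exp_nat_mul]

/-- A given vertex of degree at most two is unlikely to lie in a closed set of such vertices. -/
theorem pr_closedAt_le (hS : Even S.card) (h1 : 1 ≤ S.card)
    (hdeg : ∀ w ∈ V₀, (fiber π S w).card ≤ 2) {v : V} (hv : v ∈ V₀) (hne : (fiber π S v).Nonempty) {k m : ℕ}
    (hk : (V₀.filter fun w => (fiber π S w).card = 1).card ≤ k) (hm : 0 < m)
    (hm' : m ≤ (S \ above π S V₀).card) :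
    pr S (ClosedAt π V₀ v) ≤
      2 * √S.card * (Real.exp ((k : ℝ) ^ 2 / m) * (2 / m)) := by
  -- The set `S` may already have lost some vertices. A vertex without points would contribute `sin
  -- ^ 0 + cos ^ 0 = 2` to the product, so the closed set is first restricted to vertices that still
  -- carry points.
  set U := V₀.filter fun w => (fiber π S w).Nonempty with hUdef
  have hmono : pr S (ClosedAt π V₀ v) ≤
      pr S (fun σ => ∃ i ∈ (U.erase v).powerset, Closed π σ (insert v i)) := by
    refine pr_mono fun σ hσ => ?_
    rintro ⟨R, hR, hvR, hcl⟩
    have hvU : v ∈ U := mem_filter.2 ⟨hv, hne⟩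
    refine ⟨(R ∩ U).erase v, ?_, ?_⟩
    · rw [mem_powerset]
      exact erase_subset_erase _ inter_subset_right
    · rw [insert_erase (mem_inter.2 ⟨hvR, hvU⟩)]
      intro h hh
      rw [mem_inter] at hh ⊢
      have h2 := hcl h hh.1
      refine ⟨h2, mem_filter.2 ⟨hR h2, ?_⟩⟩
      by_cases hhS : h ∈ S
      · exact ⟨σ h, mem_fiber.2 ⟨(pairings_mem hσ).2 hhS, rfl⟩⟩
      · rw [pairings_fix hσ hhS]
        exact (mem_filter.1 hh.2).2
  refine hmono.trans ?_
  have key := pr_exists_closed_le (π := π) hS h1 (U.erase v).powerset (fun i => insert v i)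
    (G := fun θ => θ * Real.exp (k * θ - m * θ ^ 2 / 2)) (by fun_prop) ?_
  · refine key.trans ?_
    gcongr
    exact integral_first_le (by exact_mod_cast hm)
  intro θ h0 hθ
  obtain ⟨hc, hs, hc1, hs1, hsθ⟩ := cos_sin_mem h0 hθ
  set f := fun w => (fiber π S w).card with hf
  have hcompl : ∀ i ∈ (U.erase v).powerset, (insert v i)ᶜ = (U.erase v \ i) ∪ Uᶜ := by
    intro i hi
    rw [mem_powerset] at hi
    ext w
    have := @hi w
    simp only [mem_compl, mem_insert, mem_union, Finset.mem_sdiff, mem_erase] at this ⊢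
    grind
  -- The vertex `v` is forced to be inside and contributes a power of the sine, other vertices of
  -- `U` are free and contribute a sum, and vertices outside `U` contribute cosines.
  have e : ∑ i ∈ (U.erase v).powerset, (∏ w ∈ insert v i, Real.sin θ ^ f w) *
      (∏ w ∈ (insert v i)ᶜ, Real.cos θ ^ f w) = Real.sin θ ^ f v *
        (∏ w ∈ U.erase v, (Real.sin θ ^ f w + Real.cos θ ^ f w)) * ∏ w ∈ Uᶜ, Real.cos θ ^ f w := by
    rw [prod_add, mul_sum, sum_mul]
    refine sum_congr rfl fun i hi => ?_
    have hi' := mem_powerset.1 hi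
    rw [hcompl i hi, prod_insert fun hvi => by simpa using hi' hvi, prod_union]
    · ring
    rw [disjoint_left]
    · intro w hw hw2
      simp only [mem_compl, Finset.mem_sdiff, mem_erase] at hw hw2
      tauto
  rw [e]
  have h2 : Real.sin θ ^ f v ≤ θ := by
    refine le_trans ?_ hsθ
    exact pow_le_of_le_one hs hs1 (card_ne_zero.2 hne)
  have h3 := prod_sin_add_cos_le h0 hθ (U.erase v) (f := f) (k := k) (fun w hw => by
      have hw := mem_filter.1 (mem_of_mem_erase hw)
      have a := hdeg w hw.1
      have b := card_pos.2 hw.2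
      simp only [hf]
      omega) (le_trans (card_le_card fun w hw => by
      simp only [mem_filter, mem_erase, hUdef] at hw ⊢
      exact ⟨hw.1.2.1, hw.2⟩) hk)
  have h4 : ∏ w ∈ Uᶜ, Real.cos θ ^ f w ≤ Real.exp (-(m * θ ^ 2 / 2)) := by
    rw [prod_pow_eq_pow_sum, ← card_sdiff_above]
    refine cos_pow_le_exp h0 hθ (hm'.trans (card_le_card ?_))
    refine sdiff_subset_sdiff subset_rfl fun h hh => ?_
    rw [mem_above] at hh ⊢
    exact ⟨hh.1, filter_subset _ _ hh.2⟩
  calc _ ≤ θ * Real.exp (k * θ) * Real.exp (-(m * θ ^ 2 / 2)) := by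
        gcongr
    _ = _ := by rw [mul_assoc, ← Real.exp_add, ← sub_eq_add_neg]

theorem add_pow_sub_pow_le {x y : ℝ} (hx : 0 ≤ x) (hy : 0 ≤ y) (n : ℕ) :
    (x + y) ^ (n + 1) - y ^ (n + 1) ≤ (n + 1) * x * (x + y) ^ n := by
  induction n with
  | zero => simp
  | succ n ih =>
    have h1 : y ^ (n + 1) ≤ (x + y) ^ (n + 1) := by gcongr; linarith
    have h2 : (x + y) ^ (n + 1 + 1) - y ^ (n + 1 + 1) =
      (x + y) * ((x + y) ^ (n + 1) - y ^ (n + 1)) + x * y ^ (n + 1) := by ring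
    rw [h2]
    calc _ ≤ (x + y) * ((n + 1) * x * (x + y) ^ n) + x * (x + y) ^ (n + 1) := by gcongr
      _ = _ := by push_cast; ring

/-- Dropping only the empty set from the binomial expansion leaves `(x + y) ^ (n + 1) - y ^ (n +
1)`, and dropping only the full set leaves the same with `x` in place of `y`. The mean value bound
for each yields the minimum. -/
theorem sum_powerset_proper_le {W : Finset V} {n : ℕ} (hW : W.card = n + 1) {x y : ℝ} (hx : 0 ≤ x)
    (hy : 0 ≤ y) :
    ∑ Q ∈ W.powerset.filter (fun Q => Q.Nonempty ∧ Q ≠ W), x ^ Q.card * y ^ (W.card - Q.card) ≤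
      (n + 1) * min x y * (x + y) ^ n := by
  have htot := sum_pow_mul_eq_add_pow x y W
  have hnn : ∀ Q ∈ W.powerset, 0 ≤ x ^ Q.card * y ^ (W.card - Q.card) := fun Q _ => by positivity
  have h1 : ∀ Q₀ ∈ W.powerset, (Q₀ = ∅ ∨ Q₀ = W) →
      ∑ Q ∈ W.powerset.filter (fun Q => Q.Nonempty ∧ Q ≠ W), x ^ Q.card * y ^ (W.card - Q.card) ≤
        (x + y) ^ W.card - x ^ Q₀.card * y ^ (W.card - Q₀.card) := by
    intro Q₀ hQ₀ hQ
    rw [← htot, ← sum_erase_eq_sub hQ₀]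
    refine sum_le_sum_of_subset_of_nonneg (fun Q hQ' => ?_) fun Q hQ' _ => by positivity
    rw [mem_filter] at hQ'
    rw [mem_erase]
    refine ⟨?_, hQ'.1⟩
    rintro rfl
    rcases hQ with rfl | rfl
    · simpa using hQ'.2.1
    · simpa using hQ'.2.2
  have ha := h1 ∅ (by simp) (Or.inl rfl)
  have hb := h1 W (by simp) (Or.inr rfl)
  simp only [card_empty, pow_zero, one_mul, Nat.sub_zero, hW] at ha
  simp only [hW, Nat.sub_self, pow_zero, mul_one] at hb
  rw [hW]
  rcases min_cases x y with ⟨h, -⟩ | ⟨h, -⟩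
  · rw [h]
    exact ha.trans (add_pow_sub_pow_le hx hy n)
  · rw [h]
    have := add_pow_sub_pow_le hy hx n
    rw [add_comm y x] at this
    exact hb.trans this

/-- Both sides of a closed set are unlikely to contain vertices of degree at least three. -/
theorem pr_split_le (hS : Even S.card) (h1 : 1 ≤ S.card)
    (hdeg : ∀ w ∈ V₀, (fiber π S w).card = 1 ∨ (fiber π S w).card = 2)
    (hdeg' : ∀ w ∉ V₀, 3 ≤ (fiber π S w).card) {k m : ℕ}
    (hk : (V₀.filter fun w => (fiber π S w).card = 1).card ≤ k) (hm : 0 < m)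
    (hm' : V₀ᶜ.card = m + 1) :
    pr S (fun σ => ∃ R, Closed π σ R ∧ (∃ w ∈ R, w ∉ V₀) ∧ ∃ w ∉ R, w ∉ V₀) ≤
      4 * √S.card * ((m + 1) * (Real.exp ((k : ℝ) ^ 2 / m) * (32 / m ^ 2))) := by
  set W := V₀ᶜ with hWdef
  set I := V₀.powerset ×ˢ W.powerset.filter (fun Q => Q.Nonempty ∧ Q ≠ W) with hI
  have hmono : pr S (fun σ => ∃ R, Closed π σ R ∧ (∃ w ∈ R, w ∉ V₀) ∧ ∃ w ∉ R, w ∉ V₀) ≤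
      pr S (fun σ => ∃ i ∈ I, Closed π σ (i.1 ∪ i.2)) := by
    refine pr_mono fun σ hσ => ?_
    rintro ⟨R, hcl, ⟨w, hw, hw'⟩, ⟨u, hu, hu'⟩⟩
    refine ⟨(R ∩ V₀, R ∩ W), ?_, ?_⟩
    · rw [hI, mem_product, mem_powerset, mem_filter, mem_powerset]
      refine ⟨inter_subset_right, inter_subset_right, ⟨w, ?_⟩, fun h => hu ?_⟩
      · rw [mem_inter, hWdef, mem_compl]; exact ⟨hw, hw'⟩
      · have : u ∈ W := by rw [hWdef, mem_compl]; exact hu'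
        rw [← h] at this
        exact (mem_inter.1 this).1
    · have : (R ∩ V₀) ∪ (R ∩ W) = R := by
        rw [← inter_union_distrib_left, hWdef, union_compl, inter_univ]
      simpa only [this] using hcl
  refine hmono.trans ?_
  -- The factor `min (sin ^ 3) (cos ^ 3)` is at most the cube of the distance to the nearer end of
  -- the quarter period. The reflection `θ ↦ π / 2 - θ` exchanges the two ends.
  set g : ℝ → ℝ := fun θ => θ ^ 3 * Real.exp (k * θ - m * θ ^ 2 / 2) with hg
  have hgc : Continuous g := by fun_prop
  have hrefl : ∫ θ in (0 : ℝ)..(Real.pi / 2), g (Real.pi / 2 - θ) =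
      ∫ θ in (0 : ℝ)..(Real.pi / 2), g θ := by
    rw [intervalIntegral.integral_comp_sub_left]; simp
  have key := pr_exists_closed_le (π := π) hS h1 I (fun i => i.1 ∪ i.2)
    (G := fun θ => (m + 1) * (g θ + g (Real.pi / 2 - θ))) (by fun_prop) ?_
  · refine key.trans ?_
    rw [intervalIntegral.integral_const_mul, intervalIntegral.integral_add
      (hgc.intervalIntegrable _ _) (Continuous.intervalIntegrable (by fun_prop) _ _), hrefl]
    have := integral_third_le (a := k) (m := m) (by exact_mod_cast hm)
    calc _ ≤ 2 * √(S.card : ℝ) * ((m + 1) * (Real.exp ((k : ℝ) ^ 2 / m) * (32 / m ^ 2) +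
          Real.exp ((k : ℝ) ^ 2 / m) * (32 / m ^ 2))) := by gcongr
      _ = _ := by ring
  set f := fun w => (fiber π S w).card with hf
  -- the estimate with the product over `V₀` left aside
  have half : ∀ θ, 0 ≤ θ → θ ≤ Real.pi / 2 → ∀ x y : ℝ, x = Real.sin θ ^ 3 → y = Real.cos θ ^ 3 →
      Real.sin θ ≤ Real.cos θ → ∀ P ≤ Real.exp (k * θ), 0 ≤ P →
      P * ((m + 1) * min x y * (x + y) ^ m) ≤ (m + 1) * g θ := by
    intro θ h0 hθ x y hx hy hsc P hP hP0
    obtain ⟨hc, hs, hc1, hs1, hsθ⟩ := cos_sin_mem h0 hθ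
    have h2 : min x y ≤ θ ^ 3 := (min_le_left _ _).trans (by rw [hx]; gcongr)
    -- Here degree at least three matters: `sin ^ 3 + cos ^ 3 ≤ (sin ^ 2 + cos ^ 2) * cos`. The
    -- power `m` of this gives Gaussian decay, against which `θ ^ 3` integrates to order `m ^ (-2)`,
    -- enough to beat `(m + 1)` times the square root of the total degree.
    have h3 : x + y ≤ Real.cos θ := by
      have := Real.sin_sq_add_cos_sq θ
      have a : Real.sin θ ^ 3 ≤ Real.sin θ ^ 2 * Real.cos θ := by
        rw [pow_succ]; gcongr
      rw [hx, hy]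
      calc _ ≤ Real.sin θ ^ 2 * Real.cos θ + Real.cos θ ^ 2 * Real.cos θ := by
            rw [pow_succ (Real.cos θ)]; linarith
        _ = (Real.sin θ ^ 2 + Real.cos θ ^ 2) * Real.cos θ := by ring
        _ = _ := by rw [this, one_mul]
    have hx0 : 0 ≤ x := by rw [hx]; positivity
    have hy0 : 0 ≤ y := by rw [hy]; positivity
    have hmin : 0 ≤ min x y := le_min hx0 hy0
    calc P * ((m + 1) * min x y * (x + y) ^ m)
        ≤ Real.exp (k * θ) * ((m + 1) * θ ^ 3 * Real.exp (-(m * θ ^ 2 / 2))) := by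
          gcongr
          exact (pow_le_pow_left₀ (by positivity) h3 m).trans (cos_pow_le_exp h0 hθ le_rfl)
      _ = (m + 1) * (θ ^ 3 * (Real.exp (k * θ) * Real.exp (-(m * θ ^ 2 / 2)))) := by ring
      _ = _ := by rw [hg, ← Real.exp_add, ← sub_eq_add_neg]
  have hg0 : ∀ θ, 0 ≤ θ → 0 ≤ g θ := fun θ h => by rw [hg]; positivity
  intro θ h0 hθ
  obtain ⟨hc, hs, hc1, hs1, hsθ⟩ := cos_sin_mem h0 hθ
  have hcompl : ∀ A ∈ V₀.powerset, ∀ Q ∈ W.powerset, (A ∪ Q)ᶜ = (V₀ \ A) ∪ (W \ Q) := by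
    intro A hA Q hQ
    rw [mem_powerset] at hA hQ
    ext w
    have h1 := @hA w
    have h2 := @hQ w
    simp only [hWdef, mem_compl, mem_union, Finset.mem_sdiff] at h1 h2 ⊢
    tauto
  set P := ∏ w ∈ V₀, (Real.sin θ ^ f w + Real.cos θ ^ f w) with hP
  have hP0 : 0 ≤ P := prod_nonneg fun w _ => by positivity
  set x := Real.sin θ ^ 3 with hx
  set y := Real.cos θ ^ 3 with hy
  have e : ∑ i ∈ I, (∏ w ∈ i.1 ∪ i.2, Real.sin θ ^ f w) *
      (∏ w ∈ (i.1 ∪ i.2)ᶜ, Real.cos θ ^ f w) ≤ P *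
        ((m + 1) * min x y * (x + y) ^ m) := by
    calc _ ≤ ∑ i ∈ I, ((∏ w ∈ i.1, Real.sin θ ^ f w) * ∏ w ∈ V₀ \ i.1, Real.cos θ ^ f w) *
          (x ^ i.2.card * y ^ (W.card - i.2.card)) := by
          refine sum_le_sum fun i hi => ?_
          rw [hI, mem_product, mem_filter] at hi
          obtain ⟨hA, hQ, -⟩ := hi
          rw [hcompl _ hA _ hQ]
          rw [mem_powerset] at hA hQ
          rw [prod_union, prod_union]
          · have a : ∏ w ∈ i.2, Real.sin θ ^ f w ≤ x ^ i.2.card := by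
              rw [← prod_const]
              refine prod_le_prod (fun w _ => by positivity) fun w hw => ?_
              exact pow_le_pow_of_le_one hs hs1 (hdeg' w (mem_compl.1 (hQ hw)))
            have b : ∏ w ∈ W \ i.2, Real.cos θ ^ f w ≤ y ^ (W.card - i.2.card) := by
              rw [← card_sdiff_of_subset hQ, ← prod_const]
              refine prod_le_prod (fun w _ => by positivity) fun w hw => ?_
              exact pow_le_pow_of_le_one hc hc1 (hdeg' w (mem_compl.1 (Finset.mem_sdiff.1 hw).1))
            have c : 0 ≤ (∏ w ∈ i.1, Real.sin θ ^ f w) * ∏ w ∈ V₀ \ i.1, Real.cos θ ^ f w :=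
              mul_nonneg (prod_nonneg fun w _ => by positivity) (prod_nonneg fun w _ => by positivity)
            calc _ = ((∏ w ∈ i.1, Real.sin θ ^ f w) * ∏ w ∈ V₀ \ i.1, Real.cos θ ^ f w) *
                  ((∏ w ∈ i.2, Real.sin θ ^ f w) * ∏ w ∈ W \ i.2, Real.cos θ ^ f w) := by ring
              _ ≤ _ := by
                refine mul_le_mul_of_nonneg_left ?_ c
                exact mul_le_mul a b (prod_nonneg fun w _ => by positivity) (by positivity)
          · rw [disjoint_left]
            intro w hw hw2
            simp only [hWdef, mem_compl, Finset.mem_sdiff] at hw hw2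
            tauto
          · rw [disjoint_left]
            intro w hw hw2
            have a := hA hw
            have b := hQ hw2
            rw [hWdef, mem_compl] at b
            tauto
      _ = P * ∑ Q ∈ W.powerset.filter (fun Q => Q.Nonempty ∧ Q ≠ W),
            x ^ Q.card * y ^ (W.card - Q.card) := by
          rw [hP, prod_add, sum_mul_sum, hI, sum_product]
      _ ≤ _ := by
          gcongr
          exact sum_powerset_proper_le hm' (by positivity) (by positivity)
  refine e.trans ?_
  have hPle : ∀ t, 0 ≤ t → t ≤ Real.pi / 2 → (t = θ ∨ t = Real.pi / 2 - θ) →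
      P ≤ Real.exp (k * t) := by
    rintro t ht0 ht1 (rfl | rfl)
    · exact prod_sin_add_cos_le ht0 ht1 V₀ hdeg hk
    · have := prod_sin_add_cos_le ht0 ht1 V₀ hdeg hk
      rw [Real.sin_pi_div_two_sub, Real.cos_pi_div_two_sub] at this
      rw [hP]
      simpa only [add_comm] using this
  have ht0 : 0 ≤ Real.pi / 2 - θ := by linarith
  have ht1 : Real.pi / 2 - θ ≤ Real.pi / 2 := by linarith
  rcases le_total (Real.sin θ) (Real.cos θ) with hsc | hsc
  · have := half θ h0 hθ x y rfl rfl hsc P (hPle θ h0 hθ (Or.inl rfl)) hP0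
    have := mul_nonneg (by positivity : (0 : ℝ) ≤ m + 1) (hg0 _ ht0)
    linarith
  · have := half _ ht0 ht1 y x (by rw [Real.sin_pi_div_two_sub]) (by rw [Real.cos_pi_div_two_sub])
      (by rwa [Real.sin_pi_div_two_sub, Real.cos_pi_div_two_sub]) P (hPle _ ht0 ht1 (Or.inr rfl)) hP0
    rw [min_comm, add_comm y x] at this
    have := mul_nonneg (by positivity : (0 : ℝ) ≤ m + 1) (hg0 _ h0)
    linarith

end ClosedBounds

end ConfigModel

namespace ConfigModel

/-! ### Simple matchings when all degrees are at most two -/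

section SmallDegrees

open Finset Equiv
open scoped Classical

variable {H V : Type*} [Fintype H] [DecidableEq H] [Fintype V] {π : H → V} {S : Finset H}

/-- The number of vertices that carry `k` points of `S`. -/
noncomputable def degCount (π : H → V) (S : Finset H) (k : ℕ) : ℕ :=
  (univ.filter fun v => (fiber π S v).card = k).card

/-- The number of simple matchings on `a` vertices of degree one and `r` of degree two. -/
def simpleCount (a : ℕ) : ℕ → ℕ
  | 0 => if Even a then matchingCount a else 0
  -- One vertex of degree two is suppressed. It can be reinserted into any of `(a + 2 * r) / 2`
  -- edges in two directions, unless it lay on a triangle. The second term counts triangles through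
  -- it: `2 * r` sibling pairs at one vertex and `2 * (r - 1)` at another. The truncated `r - 2` is
  -- harmless because its coefficient vanishes for `r < 2`.
  | r + 1 => (a + 2 * r) * simpleCount a r + 4 * (r * (r - 1)) * simpleCount a (r - 2)
termination_by r => r

theorem fiber_sdiff_above (R : Finset V) (v : V) :
    fiber π (S \ above π S R) v = if v ∈ R then ∅ else fiber π S v := by
  ext h
  split_ifs with hv
  · simp only [mem_fiber, Finset.mem_sdiff, mem_above, notMem_empty, iff_false]
    rintro ⟨⟨h1, h2⟩, rfl⟩
    exact h2 ⟨h1, hv⟩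
  · simp only [mem_fiber, Finset.mem_sdiff, mem_above]
    constructor
    · rintro ⟨⟨h1, h2⟩, h3⟩; exact ⟨h1, h3⟩
    · rintro ⟨h1, rfl⟩; exact ⟨⟨h1, fun h => hv h.2⟩, rfl⟩

theorem degCount_sdiff_above (R : Finset V) {k : ℕ} (hk : 0 < k) :
    degCount π (S \ above π S R) k + (R.filter fun v => (fiber π S v).card = k).card =
      degCount π S k := by
  unfold degCount
  rw [← card_union_of_disjoint]
  · congr 1
    ext v
    simp only [fiber_sdiff_above, mem_union, mem_filter, mem_univ, true_and]
    split_ifs with hv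
    · simp [hv, hk.ne]
    · simp [hv]
  · rw [disjoint_left]
    intro v
    simp only [fiber_sdiff_above, mem_filter, mem_univ, true_and]
    split_ifs with hv
    · simp [hk.ne]
    · tauto

theorem card_eq_sum_fiber : S.card = ∑ v, (fiber π S v).card := by
  rw [card_eq_sum_card_fiberwise (f := π) (t := univ) fun _ _ => by simp]
  rfl

theorem card_eq_degCount (hdeg : ∀ v, (fiber π S v).card ≤ 2) :
    S.card = degCount π S 1 + 2 * degCount π S 2 := by
  rw [card_eq_sum_fiber (π := π), degCount, degCount, card_filter, card_filter, mul_sum,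
    ← sum_add_distrib]
  refine sum_congr rfl fun v _ => ?_
  have := hdeg v
  interval_cases (fiber π S v).card <;> rfl

theorem card_siblings : (siblings π S).card =
    ∑ v, (fiber π S v).card * ((fiber π S v).card - 1) := by
  rw [card_eq_sum_card_fiberwise (f := fun z => π z.1) (t := univ) fun _ _ => by simp]
  refine sum_congr rfl fun v _ => ?_
  rw [Nat.mul_sub_one, ← offDiag_card]
  congr 1
  ext ⟨h, h'⟩
  simp only [mem_filter, mem_siblings, mem_offDiag, mem_fiber]
  grind

theorem card_siblings_two (hdeg : ∀ v, (fiber π S v).card ≤ 2) :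
    (siblings π S).card = 2 * degCount π S 2 := by
  rw [card_siblings, degCount, card_filter, mul_sum]
  refine sum_congr rfl fun v _ => ?_
  have := hdeg v
  interval_cases (fiber π S v).card <;> rfl

theorem above_eq_pair {x y : H} {w : V} (hf : fiber π S w = {x, y}) : above π S {w} = {x, y} := by
  rw [← hf]; ext h; simp [mem_above, mem_fiber]

/-- Pairs of siblings with an ordered pair of siblings at another vertex. -/
theorem card_quads_two (hdeg : ∀ v, (fiber π S v).card ≤ 2) :
    (quads π S).card = 2 * degCount π S 2 * (2 * (degCount π S 2 - 1)) := by
  have h1 : quads π S = (siblings π S).biUnion fun z => {z} ×ˢ siblings π (S \ above π S {π z.1}) := by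
    ext ⟨z, z'⟩
    simp only [quads, mem_filter, mem_product, mem_siblings, mem_biUnion, mem_singleton,
      Finset.mem_sdiff, mem_above]
    grind
  rw [h1, card_biUnion]
  · rw [← card_siblings_two hdeg, ← smul_eq_mul, ← sum_const]
    refine sum_congr rfl fun z hz => ?_
    rw [mem_siblings] at hz
    have h2 : (fiber π S (π z.1)).card = 2 := by
      refine le_antisymm (hdeg _) (one_lt_card.2 ⟨z.1, ?_, z.2, ?_, hz.2.1⟩)
      · exact mem_fiber.2 ⟨hz.1.1, rfl⟩
      · exact mem_fiber.2 ⟨hz.1.2, hz.2.2.symm⟩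
    have h3 := degCount_sdiff_above (π := π) (S := S) {π z.1} (k := 2) (by norm_num)
    rw [filter_singleton, if_pos h2, card_singleton] at h3
    rw [card_product, card_singleton, one_mul, card_siblings_two]
    · congr 1; omega
    · intro v; rw [fiber_sdiff_above]; split_ifs; · simp
      · exact hdeg v
  · intro z _ z' _ hne
    rw [Function.onFun, disjoint_left]
    rintro ⟨a, b⟩ h h'
    simp only [mem_product, mem_singleton] at h h'
    exact hne (h.1.symm.trans h'.1)

/-- A triangle can be removed from a simple matching. -/
theorem simple_triangle_iff {σ τ : Perm H} {x y a a' b b' : H} (hx : σ x = a) (hy : σ y = b)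
    (ha' : σ a' = b') (ha : σ a = x) (hb : σ b = y) (hb' : σ b' = a')
    (hτ : ∀ h ∈ [x, y, a, a', b, b'], τ h = h) (hστ : ∀ h ∉ [x, y, a, a', b, b'], τ h = σ h)
    (hxy : π x = π y) (haa : π a = π a') (hbb : π b = π b') (hxa : π x ≠ π a) (hxb : π x ≠ π b)
    (hab : π a ≠ π b)
    (hf : ∀ h, σ h ≠ h → π h = π x ∨ π h = π a ∨ π h = π b → h ∈ [x, y, a, a', b, b']) :
    Simple π σ ↔ Simple π τ := by
  have in6 : ∀ h ∈ [x, y, a, a', b, b'], (π h = π x ∨ π h = π a ∨ π h = π b) ∧ π (σ h) ≠ π h := by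
    intro h hh
    simp only [List.mem_cons, List.not_mem_nil, or_false] at hh
    rcases hh with rfl | rfl | rfl | rfl | rfl | rfl <;> clear hf hτ hστ <;> grind
  have out : ∀ h, τ h ≠ h → h ∉ [x, y, a, a', b, b'] ∧ σ h = τ h := by
    intro h hh
    have : h ∉ [x, y, a, a', b, b'] := fun hm => hh (hτ h hm)
    exact ⟨this, (hστ h this).symm⟩
  constructor
  · rintro ⟨h1, h2⟩
    refine ⟨fun h e1 => ?_, fun h h' e1 e2 e3 e4 => ?_⟩
    · have := (out h e1).2
      rw [← this] at e1 ⊢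
      exact h1 h e1
    · have o1 := (out h e1).2
      have o2 := (out h' e2).2
      rw [← o1] at e1 e4
      rw [← o2] at e2 e4
      exact h2 h h' e1 e2 e3 e4
  · rintro ⟨h1, h2⟩
    refine ⟨fun h e1 => ?_, fun h h' e1 e2 e3 e4 => ?_⟩
    · by_cases m1 : h ∈ [x, y, a, a', b, b']
      · exact (in6 h m1).2
      · rw [← hστ h m1] at e1 ⊢
        exact h1 h e1
    by_cases m1 : h ∈ [x, y, a, a', b, b']
    · have m2 : h' ∈ [x, y, a, a', b, b'] := hf h' e2 (by rw [← e3]; exact (in6 h m1).1)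
      clear hf hστ hτ h1 h2 in6 out
      simp only [List.mem_cons, List.not_mem_nil, or_false] at m1 m2
      rcases m1 with rfl | rfl | rfl | rfl | rfl | rfl <;>
        rcases m2 with rfl | rfl | rfl | rfl | rfl | rfl <;> first | rfl | grind
    · have m2 : h' ∉ [x, y, a, a', b, b'] := fun m2 =>
        m1 (hf h e1 (by rw [e3]; exact (in6 h' m2).1))
      rw [← hστ h m1] at e1 e4
      rw [← hστ h' m2] at e2 e4
      exact h2 h h' e1 e2 e3 e4

/-- The three prescribed pairs form a triangle on three vertices of degree two. As no degree exceeds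
two, the triangle is a whole component, and the rest is an arbitrary simple matching. -/
theorem card_simple_triangle {x y a a' b b' : H} (hx : x ∈ S) (hy : y ∈ S) (hxy : x ≠ y)
    (hxy' : π x = π y) (hdeg : ∀ v, (fiber π S v).card ≤ 2)
    (hq : ((a, a'), (b, b')) ∈ quads π (S \ {x, y})) :
    ((pairings S).filter fun σ => (σ x = a ∧ σ y = b ∧ σ a' = b') ∧ Simple π σ).card =
      ((pairings (S \ above π S {π x, π a, π b})).filter (Simple π)).card := by
  simp only [quads, mem_filter, mem_product, mem_siblings, Finset.mem_sdiff, mem_insert,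
    mem_singleton, not_or] at hq
  obtain ⟨⟨⟨⟨⟨ha, hax, hay⟩, ha', hax', hay'⟩, haa, haa'⟩, ⟨⟨hb, hbx, hby⟩, hb', hbx', hby'⟩, hbb, hbb'⟩, hab⟩ := hq
  have hfib : ∀ u v h, u ∈ S → v ∈ S → u ≠ v → π u = π v → h ∈ S → π h = π u → h = u ∨ h = v := by
    intro u v h hu hv huv e hh e'
    by_contra! hne
    have : ({u, v, h} : Finset H) ⊆ fiber π S (π u) := by
      intro z hz
      simp only [mem_insert, mem_singleton] at hz
      rw [mem_fiber]
      rcases hz with rfl | rfl | rfl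
      · exact ⟨hu, rfl⟩
      · exact ⟨hv, e.symm⟩
      · exact ⟨hh, e'⟩
    have h3 := (card_le_card this).trans (hdeg _)
    rw [card_eq_three.2 ⟨u, v, h, huv, hne.1.symm, hne.2.symm, rfl⟩] at h3
    omega
  have fx := fun h => hfib x y h hx hy hxy hxy'
  have fa := fun h => hfib a a' h ha ha' haa haa'
  have fb := fun h => hfib b b' h hb hb' hbb hbb'
  clear hfib
  have hxa : π x ≠ π a := fun e => by have := fx a ha e.symm; tauto
  have hxb : π x ≠ π b := fun e => by have := fx b hb e.symm; tauto
  have hset : S \ above π S {π x, π a, π b} = ((S \ {x, a}) \ {y, b}) \ {a', b'} := by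
    ext h
    simp only [Finset.mem_sdiff, mem_above, mem_insert, mem_singleton]
    constructor
    · rintro ⟨h1, h2⟩
      refine ⟨⟨⟨h1, ?_⟩, ?_⟩, ?_⟩ <;> grind
    · rintro ⟨⟨⟨h1, h2⟩, h3⟩, h4⟩
      refine ⟨h1, fun h5 => ?_⟩
      rcases h5.2 with h5 | h5 | h5
      · have := fx h h1 h5; tauto
      · have := fa h h1 h5; tauto
      · have := fb h h1 h5; tauto
  rw [hset]
  have nab : a ≠ b := fun e => hab (by rw [e])
  have nab' : a' ≠ b := fun e => hab (by rw [haa', e])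
  have na'b' : a' ≠ b' := fun e => hab (by rw [haa', hbb', e])
  have nb'a : b' ≠ a := fun e => hab (by rw [hbb', e])
  have e1 : ((pairings S).filter fun σ => (σ x = a ∧ σ y = b ∧ σ a' = b') ∧ Simple π σ).card =
      ((pairings S).filter fun σ => σ x = a ∧ (σ y = b ∧ σ a' = b' ∧ Simple π σ)).card := by
    congr 1; ext σ; simp only [mem_filter]; tauto
  rw [e1]
  refine Eq.trans (by congr!) ((card_apply_eq hx ha (Ne.symm hax)
    (fun σ => σ y = b ∧ σ a' = b' ∧ Simple π σ)).trans ?_)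
  have e2 : ((pairings (S \ {x, a})).filter fun τ => (swap x a * τ) y = b ∧ (swap x a * τ) a' = b' ∧
      Simple π (swap x a * τ)).card = ((pairings (S \ {x, a})).filter fun τ => τ y = b ∧ (τ a' = b' ∧
      Simple π (swap x a * τ))).card := by
    congr 1
    refine filter_congr fun τ hτ => and_congr ?_ (and_congr ?_ Iff.rfl)
    · exact swap_mul_apply_eq hτ (by simp; grind) (by simp; grind) hy
    · exact swap_mul_apply_eq hτ (by simp; grind) (by simp; grind) ha'
  refine Eq.trans (by congr!) (e2.trans ?_)
  refine Eq.trans (by congr!) ((card_apply_eq (S := S \ {x, a}) (x := y) (y := b)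
    (by simp; grind) (by simp; grind) (by grind)
    (fun τ => τ a' = b' ∧ Simple π (swap x a * τ))).trans ?_)
  have e3 : ((pairings ((S \ {x, a}) \ {y, b})).filter fun τ => (swap y b * τ) a' = b' ∧
      Simple π (swap x a * (swap y b * τ))).card = ((pairings ((S \ {x, a}) \ {y, b})).filter
        fun τ => τ a' = b' ∧ Simple π (swap x a * (swap y b * τ))).card := by
    congr 1
    refine filter_congr fun τ hτ => and_congr ?_ Iff.rfl
    exact swap_mul_apply_eq hτ (by simp; grind) (by simp; grind) (by simp; grind)
  refine Eq.trans (by congr!) (e3.trans ?_)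
  refine Eq.trans (by congr!) ((card_apply_eq (S := (S \ {x, a}) \ {y, b}) (x := a') (y := b')
    (by simp; grind) (by simp; grind) (by grind)
    (fun τ => Simple π (swap x a * (swap y b * τ)))).trans ?_)
  congr 1
  refine filter_congr fun τ hτ => ?_
  have hfix : ∀ h ∈ [x, y, a, a', b, b'], τ h = h := fun h hh => by
    refine pairings_fix hτ ?_
    simp only [Finset.mem_sdiff, mem_insert, mem_singleton]
    simp only [List.mem_cons, List.not_mem_nil, or_false] at hh
    tauto
  have hst : ∀ h ∉ [x, y, a, a', b, b'], τ h ∉ [x, y, a, a', b, b'] := by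
    intro h hh hh'
    have := hfix _ hh'
    rw [pairings_invol hτ] at this
    rw [this] at hh
    exact hh hh'
  have hSS : ∀ h ∉ S, τ h = h := fun h hh => by
    refine pairings_fix hτ ?_
    simp only [Finset.mem_sdiff]
    tauto
  have hval : ∀ h, (swap x a * (swap y b * (swap a' b' * τ))) h =
      swap x a (swap y b (swap a' b' (τ h))) := fun h => rfl
  have hout : ∀ h ∉ [x, y, a, a', b, b'],
      τ h = (swap x a * (swap y b * (swap a' b' * τ))) h := by
    intro h hh
    have := hst h hh
    simp only [List.mem_cons, List.not_mem_nil, or_false, not_or] at this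
    rw [hval, swap_apply_of_ne_of_ne this.2.2.2.1 this.2.2.2.2.2,
      swap_apply_of_ne_of_ne this.2.1 this.2.2.2.2.1, swap_apply_of_ne_of_ne this.1 this.2.2.1]
  refine simple_triangle_iff (x := x) (y := y) (a := a) (a' := a') (b := b) (b' := b')
    ?_ ?_ ?_ ?_ ?_ ?_ hfix hout hxy' haa' hbb' hxa hxb hab ?_
  · rw [hval, hfix x (by simp), swap_apply_of_ne_of_ne (Ne.symm hax') (Ne.symm hbx'),
      swap_apply_of_ne_of_ne hxy (Ne.symm hbx), swap_apply_left]
  · rw [hval, hfix y (by simp), swap_apply_of_ne_of_ne (Ne.symm hay') (Ne.symm hby'),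
      swap_apply_left, swap_apply_of_ne_of_ne hbx nab.symm]
  · rw [hval, hfix a' (by simp), swap_apply_left, swap_apply_of_ne_of_ne hby' hbb.symm,
      swap_apply_of_ne_of_ne hbx' nb'a]
  · rw [hval, hfix a (by simp), swap_apply_of_ne_of_ne haa nb'a.symm,
      swap_apply_of_ne_of_ne hay nab, swap_apply_right]
  · rw [hval, hfix b (by simp), swap_apply_of_ne_of_ne nab'.symm hbb,
      swap_apply_right, swap_apply_of_ne_of_ne (Ne.symm hxy) (Ne.symm hay)]
  · rw [hval, hfix b' (by simp), swap_apply_right, swap_apply_of_ne_of_ne hay' nab',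
      swap_apply_of_ne_of_ne hax' haa.symm]
  · intro h hh hor
    by_cases hhS : h ∈ S
    · rcases hor with hor | hor | hor
      · have := fx h hhS hor; simp; tauto
      · have := fa h hhS hor; simp; tauto
      · have := fb h hhS hor; simp; tauto
    · by_contra hn
      rw [← hout h hn] at hh
      exact hh (hSS h hhS)

/-- Suppress `w` by merging. Each simple matching of the rest has `S.card - 1` preimages; the one
with `σ x = y` has a loop at `w`, and the others are the simple matchings without a clash. A simple
matching with a clash has an edge between the two neighbours of `w`, so that `w` lies on a triangle,
recorded by a unique element of `quads`. -/
theorem card_simple_two_step {x y : H} {w : V} (hxy : x ≠ y) (hw : fiber π S w = {x, y})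
    (hdeg : ∀ v, (fiber π S v).card ≤ 2) :
    ((pairings S).filter (Simple π)).card =
      (S.card - 2) * ((pairings (S \ {x, y})).filter (Simple π)).card +
        ∑ z ∈ quads π (S \ {x, y}),
          ((pairings (S \ above π S {w, π z.1.1, π z.2.1})).filter (Simple π)).card := by
  have hx : x ∈ S ∧ π x = w := mem_fiber.1 (by rw [hw]; simp)
  have hy : y ∈ S ∧ π y = w := mem_fiber.1 (by rw [hw]; simp)
  have hf : ∀ h ∈ S, π h = π x ∨ π h = π y → h = x ∨ h = y := by
    intro h hh e
    have : h ∈ fiber π S w := by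
      rw [mem_fiber]; rw [hx.2, hy.2, or_self] at e; exact ⟨hh, e⟩
    rw [hw] at this; simpa using this
  have h1 : ((pairings S).filter fun σ => Simple π σ ∧ ¬ Clash π x y σ).card +
      ((pairings (S \ {x, y})).filter (Simple π)).card =
        (S.card - 1) * ((pairings (S \ {x, y})).filter (Simple π)).card := by
    rw [← card_merge hx.1 hy.1 hxy]
    have e : ((pairings (S \ {x, y})).filter (Simple π)).card =
        ((pairings S).filter fun σ => σ x = y ∧ Simple π (merge x y σ)).card := by
      refine Eq.trans ?_ ((card_apply_eq hx.1 hy.1 hxy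
        (fun σ => Simple π (merge x y σ))).symm.trans (by congr!))
      congr 1
      refine filter_congr fun τ hτ => ?_
      have fx : τ x = x := pairings_fix hτ (by simp)
      have fy : τ y = y := pairings_fix hτ (by simp)
      have : merge x y (swap x y * τ) = τ := by
        unfold merge
        have e0 : (swap x y * τ) y = x := by rw [Perm.mul_apply, fy, swap_apply_right]
        have hc : swap x y * τ = τ * swap x y := by
          ext h
          simp only [Perm.mul_apply]
          by_cases e1 : h = x
          · rw [e1, fx, swap_apply_left, fy]
          by_cases e2 : h = y
          · rw [e2, fy, swap_apply_right, fx]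
          rw [swap_apply_of_ne_of_ne e1 e2, swap_apply_of_ne_of_ne]
          · intro e; rw [← fx] at e; exact e1 (τ.injective e)
          · intro e; rw [← fy] at e; exact e2 (τ.injective e)
        rw [e0, hc, swap_self]
        ext h; simp [Perm.mul_apply]
      rw [this]
    rw [e, ← card_union_of_disjoint]
    · congr 1
      ext σ
      simp only [mem_union, mem_filter, ← and_or_left]
      refine and_congr_right fun hσ => ?_
      have hs := simple_merge_iff (π := π) hσ hx.1 hy.1 hxy hf
      have i := pairings_invol hσ
      have ma := fun h => merge_apply hσ hx.1 hy.1 hxy h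
      constructor
      · rintro (⟨a, b⟩ | ⟨a, b⟩)
        · exact (hs b).1 a
        · exact b
      · intro hm
        by_cases hxy' : σ x = y
        · exact Or.inr ⟨hxy', hm⟩
        -- A clash would show in the merged matching, as a loop at the partners or as an edge
        -- parallel to the new one.
        have hnc : ¬ Clash π x y σ := by
          have nx := pairings_ne hσ hx.1
          have ny := pairings_ne hσ hy.1
          have nyx : σ y ≠ x := fun e => hxy' (by rw [← e, i])
          have nab : σ x ≠ σ y := fun e => hxy (σ.injective e)
          have m1 : merge x y σ (σ x) = σ y := by
            rw [ma, if_neg (by rintro (e | e); exacts [nx e, hxy' e]), if_pos (i x)]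
          rintro (h | h | ⟨c, hc, h2, h3, h4⟩)
          · exact hxy' h
          · refine hm.1 (σ x) ?_ ?_
            · rw [m1]; exact nab.symm
            · rw [m1, h]
          · simp only [List.mem_cons, List.not_mem_nil, or_false, not_or] at hc
            have m2 : merge x y σ c = σ c := by
              rw [ma, if_neg (by tauto), if_neg, if_neg]
              · intro e; exact hc.2.2.2 (by rw [← e, i])
              · intro e; exact hc.2.2.1 (by rw [← e, i])
            exact hc.2.2.1 (hm.2 c (σ x) (by rwa [m2]) (by rw [m1]; exact nab.symm) h2
              (by rw [m1, m2, h4]))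
        exact Or.inl ⟨(hs hnc).2 hm, hnc⟩
    · rw [disjoint_left]
      intro σ a b
      simp only [mem_filter] at a b
      exact a.2.2 (Or.inl b.2.1)
  have h2 : ((pairings S).filter fun σ => Simple π σ ∧ Clash π x y σ).card =
      ∑ z ∈ quads π (S \ {x, y}),
          ((pairings (S \ above π S {w, π z.1.1, π z.2.1})).filter (Simple π)).card := by
    have hz : ∀ z ∈ quads π (S \ {x, y}),
        ((pairings (S \ above π S {w, π z.1.1, π z.2.1})).filter (Simple π)).card =
        (((pairings S).filter (Simple π)).filter fun σ =>
          σ x = z.1.1 ∧ σ y = z.2.1 ∧ σ z.1.2 = z.2.2).card := by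
      rintro ⟨⟨a, a'⟩, ⟨b, b'⟩⟩ hz
      have := card_simple_triangle hx.1 hy.1 hxy (hx.2.trans hy.2.symm) hdeg hz
      rw [hx.2] at this
      rw [← this, filter_filter]
      congr 1; ext σ; simp only [mem_filter]; tauto
    rw [sum_congr rfl hz]
    refine Eq.trans ?_ ((sum_card_bipartiteAbove_eq_sum_card_bipartiteBelow
      (s := (pairings S).filter (Simple π)) (t := quads π (S \ {x, y}))
      (fun (σ : Perm H) (z : (H × H) × (H × H)) => σ x = z.1.1 ∧ σ y = z.2.1 ∧ σ z.1.2 = z.2.2)).trans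
        (sum_congr rfl fun z _ => by unfold bipartiteBelow; congr!))
    rw [← filter_filter, card_filter]
    refine sum_congr rfl fun σ hσ => ?_
    rw [mem_filter] at hσ
    obtain ⟨hσ, hsim⟩ := hσ
    have i := pairings_invol hσ
    have hm := fun h => pairings_mem hσ (h := h)
    have hloop : σ x ≠ y := fun e => hsim.1 x (pairings_ne hσ hx.1) (by rw [e, hx.2, hy.2])
    have nx := pairings_ne hσ hx.1
    have ny := pairings_ne hσ hy.1
    have nyx : σ y ≠ x := fun e => hloop (by rw [← e, i])
    have nab : π (σ x) ≠ π (σ y) := fun e => hxy (hsim.2 x y nx ny (by rw [hx.2, hy.2]) e)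
    symm
    split_ifs with hc
    · rcases hc with hc | hc | ⟨c, hc, h2, h3, h4⟩
      · exact absurd hc hloop
      · exact absurd hc nab
      · simp only [List.mem_cons, List.not_mem_nil, or_false, not_or] at hc
        have hcS : c ∈ S := by
          by_contra hcS; exact h3 (pairings_fix hσ hcS)
        rw [card_eq_one]
        -- The only candidate: `a` and `b` are the partners of `x` and `y`, and degree two leaves
        -- `c` as the only other point at the vertex of `σ x`.
        refine ⟨((σ x, c), (σ y, σ c)), ?_⟩
        ext ⟨⟨a, a'⟩, ⟨b, b'⟩⟩
        simp only [bipartiteAbove, mem_filter, mem_singleton, Prod.mk.injEq]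
        constructor
        · rintro ⟨hq, e1, e2, e3⟩
          simp only [quads, mem_filter, mem_product, mem_siblings, Finset.mem_sdiff, mem_insert,
            mem_singleton, not_or] at hq
          have : a' = c := by
            by_contra hne
            have h3 : ({a, a', c} : Finset H) ⊆ fiber π S (π a) := by
              intro t ht
              simp only [mem_insert, mem_singleton] at ht
              rw [mem_fiber]
              rcases ht with rfl | rfl | rfl
              · exact ⟨hq.1.1.1.1.1, rfl⟩
              · exact ⟨hq.1.1.1.2.1, hq.1.1.2.2.symm⟩
              · exact ⟨hcS, by rw [h2, e1]⟩
            have h4 := (card_le_card h3).trans (hdeg _)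
            rw [card_eq_three.2 ⟨a, a', c, hq.1.1.2.1, by rw [← e1]; exact Ne.symm hc.2.2.1, hne, rfl⟩] at h4
            omega
          exact ⟨⟨e1.symm, this⟩, e2.symm, by rw [← e3, this]⟩
        · rintro ⟨⟨rfl, rfl⟩, rfl, rfl⟩
          refine ⟨?_, rfl, rfl, rfl⟩
          have n1 : σ a' ≠ x := fun e => hc.2.2.1 (by rw [← e, i])
          have n2 : σ a' ≠ y := fun e => hc.2.2.2 (by rw [← e, i])
          simp only [quads, mem_filter, mem_product, mem_siblings, Finset.mem_sdiff, mem_insert,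
            mem_singleton, not_or]
          exact ⟨⟨⟨⟨⟨(hm x).2 hx.1, nx, hloop⟩, hcS, hc.1, hc.2.1⟩, Ne.symm hc.2.2.1, h2.symm⟩,
            ⟨⟨(hm y).2 hy.1, nyx, ny⟩, (hm a').2 hcS, n1, n2⟩,
            fun e => hc.2.1 (σ.injective e).symm, h4.symm⟩, nab⟩
    · rw [card_eq_zero, eq_empty_iff_forall_notMem]
      rintro ⟨⟨a, a'⟩, ⟨b, b'⟩⟩ hz
      simp only [bipartiteAbove, mem_filter, quads, mem_product, mem_siblings, Finset.mem_sdiff,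
        mem_insert, mem_singleton, not_or] at hz
      obtain ⟨⟨⟨⟨⟨ha, ha'⟩, haa⟩, ⟨⟨hb, hb'⟩, hbb⟩⟩, hab⟩, e1, e2, e3⟩ := hz
      refine hc (Or.inr (Or.inr ⟨a', ?_, ?_, pairings_ne hσ ha'.1, ?_⟩))
      · simp only [List.mem_cons, List.not_mem_nil, or_false, not_or]
        refine ⟨ha'.2.1, ha'.2.2, ?_, ?_⟩
        · rw [e1]; exact haa.1.symm
        · rw [e2]; intro e; exact hab (by rw [haa.2, e])
      · rw [e1, haa.2]
      · rw [e3, e2, hbb.2]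
  rw [← card_filter_add_card_filter_not (s := (pairings S).filter (Simple π)) (Clash π x y),
    filter_filter, filter_filter, h2, add_comm]
  congr 1
  have h3 : 2 ≤ S.card := by
    have : ({x, y} : Finset H) ⊆ S := by rw [← hw]; exact filter_subset _ _
    rw [← card_pair hxy]; exact card_le_card this
  obtain ⟨k, hk⟩ := Nat.exists_eq_add_of_le' h3
  rw [hk] at h1 ⊢
  simp only [Nat.add_sub_cancel]
  have : k + 2 - 1 = k + 1 := by omega
  rw [this] at h1
  have h4 : (k + 1) * ((pairings (S \ {x, y})).filter (Simple π)).card =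
    k * ((pairings (S \ {x, y})).filter (Simple π)).card +
      ((pairings (S \ {x, y})).filter (Simple π)).card := by ring
  omega

/-- The number of simple matchings when all degrees are at most two. -/
theorem card_simple_eq_simpleCount (hdeg : ∀ v, (fiber π S v).card ≤ 2) :
    ((pairings S).filter (Simple π)).card = simpleCount (degCount π S 1) (degCount π S 2) := by
  induction hr : degCount π S 2 using Nat.strong_induction_on generalizing S with
  | _ r ih =>
    have hsub : ∀ R : Finset V, ∀ v, (fiber π (S \ above π S R) v).card ≤ 2 := by
      intro R v; rw [fiber_sdiff_above]; split_ifs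
      · simp
      · exact hdeg v
    rcases r with _ | r
    · have hcard := card_eq_degCount hdeg
      rw [hr, mul_zero, add_zero] at hcard
      have hinj : ∀ h ∈ S, ∀ h' ∈ S, π h = π h' → h = h' := by
        intro h hh h' hh' e
        by_contra hne
        have h1 : (fiber π S (π h)).card = 2 := by
          refine le_antisymm (hdeg _) (one_lt_card.2 ⟨h, ?_, h', ?_, hne⟩)
          · exact mem_fiber.2 ⟨hh, rfl⟩
          · exact mem_fiber.2 ⟨hh', e.symm⟩
        have h2 : 0 < degCount π S 2 := card_pos.2 ⟨π h, by simp [h1]⟩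
        omega
      rw [filter_true_of_mem, simpleCount, ← hcard]
      · split_ifs with he
        · exact card_pairings he
        · exact card_pairings_odd he
      · intro σ hσ
        have hm := fun h => pairings_mem hσ (h := h)
        have hmem : ∀ h, σ h ≠ h → h ∈ S := fun h hh => by
          by_contra hS; exact hh (pairings_fix hσ hS)
        exact ⟨fun h hh e => hh (hinj _ ((hm h).2 (hmem h hh)) _ (hmem h hh) e),
          fun h h' hh hh' e _ => hinj _ (hmem h hh) _ (hmem h' hh') e⟩
    · have hpos : 0 < degCount π S 2 := by omega
      obtain ⟨w, hw⟩ := card_pos.1 hpos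
      simp only [mem_filter, mem_univ, true_and] at hw
      obtain ⟨x, y, hxy, hf⟩ := card_eq_two.1 hw
      have hcard := card_eq_degCount hdeg
      have c1 := degCount_sdiff_above (π := π) (S := S) {w} (k := 1) (by norm_num)
      have c2 := degCount_sdiff_above (π := π) (S := S) {w} (k := 2) (by norm_num)
      rw [filter_singleton, if_neg (by omega), card_empty, add_zero] at c1
      rw [filter_singleton, if_pos hw, card_singleton, hr, Nat.add_right_cancel_iff] at c2
      have hd := hsub {w}
      rw [above_eq_pair hf] at c1 c2 hd
      rw [card_simple_two_step hxy hf hdeg, ih r (by omega) hd c2, c1, simpleCount, hcard, hr]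
      have e2 : degCount π S 1 + 2 * (r + 1) - 2 = degCount π S 1 + 2 * r := by omega
      rw [e2]
      congr 1
      · have hq := card_quads_two hd
        rw [c2] at hq
        have : ∀ z ∈ quads π (S \ {x, y}),
            ((pairings (S \ above π S {w, π z.1.1, π z.2.1})).filter (Simple π)).card =
              simpleCount (degCount π S 1) (r - 2) := by
          intro z hz
          have c3 := degCount_sdiff_above (π := π) (S := S) {w, π z.1.1, π z.2.1} (k := 1) (by norm_num)
          have c4 := degCount_sdiff_above (π := π) (S := S) {w, π z.1.1, π z.2.1} (k := 2) (by norm_num)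
          simp only [quads, mem_filter, mem_product, mem_siblings, Finset.mem_sdiff] at hz
          have two : ∀ u v, u ∈ S → v ∈ S → u ≠ v → π u = π v → (fiber π S (π u)).card = 2 :=
            fun u v hu hv hne e => le_antisymm (hdeg _) (one_lt_card.2 ⟨u, mem_fiber.2 ⟨hu, rfl⟩, v,
              mem_fiber.2 ⟨hv, e.symm⟩, hne⟩)
          have t1 := two _ _ hz.1.1.1.1.1 hz.1.1.1.2.1 hz.1.1.2.1 hz.1.1.2.2
          have t2 := two _ _ hz.1.2.1.1.1 hz.1.2.1.2.1 hz.1.2.2.1 hz.1.2.2.2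
          have nw : ∀ u, u ∈ S → u ∉ ({x, y} : Finset H) → w ≠ π u := by
            intro u hu hu' e
            rw [← hf, mem_fiber] at hu'
            exact hu' ⟨hu, e.symm⟩
          have n1 := nw _ hz.1.1.1.1.1 hz.1.1.1.1.2
          have n2 := nw _ hz.1.2.1.1.1 hz.1.2.1.1.2
          rw [filter_false_of_mem (by simp [hw, t1, t2]), card_empty, add_zero] at c3
          rw [filter_true_of_mem (by simp [hw, t1, t2]),
            card_eq_three.2 ⟨w, π z.1.1, π z.2.1, n1, n2, hz.2, rfl⟩, hr] at c4
          rw [ih (r - 2) (by omega) (hsub _) (by omega), c3]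
        rw [sum_congr rfl this, sum_const, smul_eq_mul, hq]
        ring

end SmallDegrees

end ConfigModel

namespace ConfigModel

/-! ### Removing several low vertices -/

section Removal

open Finset Equiv
open scoped Classical

variable {H V : Type*} [Fintype H] [DecidableEq H] [Fintype V] {π : H → V} {S : Finset H}
  {V₀ : Finset V}

theorem clashBound_anti {L L' q : ℝ} (hL : 6 ≤ L) (h : L ≤ L') (hq : 0 ≤ q) :
    clashBound L' q ≤ clashBound L q := by
  have h1 : 0 < L - 1 := by linarith
  have h3 : 0 < L - 3 := by linarith
  have h5 : 0 < L - 5 := by linarith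
  have h3' : 0 < L' - 3 := by linarith
  have h1' : 0 < L' - 1 := by linarith
  have h5' : 0 < L' - 5 := by linarith
  unfold clashBound
  gcongr

/-- Bound for the change of the probability of a good matching when two points are removed. -/
noncomputable def removalError (L L' q : ℝ) (k m : ℕ) : ℝ :=
  clashBound L q + 2 * (2 * √L' * (Real.exp ((k : ℝ) ^ 2 / m) * (2 / m)))

theorem removalError_nonneg {L L' q : ℝ} (hL : 6 ≤ L) (hq : 0 ≤ q) {k m : ℕ} :
    0 ≤ removalError L L' q k m := by
  have := clashBound_nonneg hL hq
  unfold removalError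
  positivity

theorem abs_pr_good_sub_le_removalError {x y : H} (hS : Even S.card) {L L' q : ℝ} {k m : ℕ}
    (hL : 6 ≤ L) (hLS : L ≤ S.card) (hLS' : (S.card : ℝ) ≤ L')
    (hq : ((siblings π S).card : ℝ) ≤ q) (hdeg : ∀ w ∈ V₀, (fiber π S w).card ≤ 2)
    (hk : (V₀.filter fun w => (fiber π S w).card = 1).card ≤ k) (hm : 0 < m)
    (hm' : m ≤ (S \ above π S V₀).card) (hx : x ∈ S) (hy : y ∈ S) (hxy : x ≠ y)
    (hf : ∀ h ∈ S, π h = π x ∨ π h = π y → h = x ∨ h = y) (hVx : π x ∈ V₀) (hVy : π y ∈ V₀) :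
    |pr (S \ {x, y}) (Good π V₀) - pr S (Good π V₀)| ≤ removalError L L' q k m := by
  have h6 : 6 ≤ S.card := by exact_mod_cast hL.trans hLS
  refine (abs_pr_good_sub_le hx hy hxy hf h6 hVx hVy).trans ?_
  have c := fun (v : V) (hv : v ∈ V₀) (hne : (fiber π S v).Nonempty) =>
    pr_closedAt_le hS (by omega) hdeg hv hne hk hm hm'
  have cx := c _ hVx ⟨x, mem_fiber.2 ⟨hx, rfl⟩⟩
  have cy := c _ hVy ⟨y, mem_fiber.2 ⟨hy, rfl⟩⟩
  have h1 : clashBound S.card (siblings π S).card ≤ clashBound L q :=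
    (clashBound_mono (hL.trans hLS) (by positivity) hq).trans
      (clashBound_anti hL hLS ((Nat.cast_nonneg _).trans hq))
  have h2 : pr S (fun σ => π x ≠ π y ∧ (ClosedAt π V₀ (π x) σ ∨ ClosedAt π V₀ (π y) σ)) ≤
      pr S (ClosedAt π V₀ (π x)) + pr S (ClosedAt π V₀ (π y)) :=
    (pr_mono fun σ _ h => h.2).trans (pr_or_le _ _ _)
  have h3 : 2 * √(S.card : ℝ) * (Real.exp ((k : ℝ) ^ 2 / m) * (2 / m)) ≤
      2 * √L' * (Real.exp ((k : ℝ) ^ 2 / m) * (2 / m)) := by gcongr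
  unfold removalError
  linarith

/-- Removing a few vertices of degree at most two hardly changes the probability of a good
matching. -/
theorem abs_pr_good_sdiff_above_sub_le (hS : Even S.card) {L L' q : ℝ} {k m : ℕ}
    (hL : 6 ≤ L) (hLS' : (S.card : ℝ) ≤ L')
    (hq : ((siblings π S).card : ℝ) ≤ q)
    (hdeg : ∀ w ∈ V₀, (fiber π S w).card = 1 ∨ (fiber π S w).card = 2)
    (hk : (V₀.filter fun w => (fiber π S w).card = 1).card ≤ k) (hm : 0 < m)
    (hm' : m ≤ (S \ above π S V₀).card) (R : Finset V) (hR : R ⊆ V₀)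
    (hRe : Even (R.filter fun w => (fiber π S w).card = 1).card)
    (hLS : L ≤ (S \ above π S R).card) :
    |pr (S \ above π S R) (Good π V₀) - pr S (Good π V₀)| ≤ R.card * removalError L L' q k m := by
  have key : ∀ R ⊆ V₀, Even (R.filter fun w => (fiber π S w).card = 1).card →
      L ≤ (S \ above π S R).card → ∀ x y, x ∈ S \ above π S R → y ∈ S \ above π S R → x ≠ y →
      (∀ h ∈ S, π h = π x ∨ π h = π y → h = x ∨ h = y) → π x ∈ V₀ → π y ∈ V₀ →
      |pr ((S \ above π S R) \ {x, y}) (Good π V₀) - pr (S \ above π S R) (Good π V₀)| ≤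
        removalError L L' q k m := by
    intro R hR hRe hLS x y hx hy hxy hf hVx hVy
    refine abs_pr_good_sub_le_removalError ?_ hL hLS ?_ ?_ ?_ ?_ hm ?_ hx hy hxy
      (fun h hh => hf h (Finset.mem_sdiff.1 hh).1) hVx hVy
    · have h1 := card_sdiff_add_card_eq_card (above_subset (π := π) (S := S) (R := R))
      have h2 : Even (above π S R).card := by
        rw [card_above, ← sum_filter_add_sum_filter_not R fun w => (fiber π S w).card = 1]
        rw [sum_congr rfl (g := fun _ => 1) (by simp), sum_congr (s₁ := R.filter fun w => ¬ _) rfl (g := fun _ => 2)]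
        · simpa [Nat.even_add] using hRe
        · intro w hw
          rw [mem_filter] at hw
          exact (hdeg w (hR hw.1)).resolve_left hw.2
      rw [← h1] at hS
      exact (Nat.even_add.1 hS).2 h2
    · refine le_trans ?_ hLS'
      exact_mod_cast card_le_card sdiff_subset
    · refine le_trans ?_ hq
      exact_mod_cast card_le_card (siblings_mono sdiff_subset)
    · intro w hw
      rw [fiber_sdiff_above]
      split_ifs
      · simp
      · rcases hdeg w hw with h | h <;> omega
    · refine le_trans (card_le_card fun w hw => ?_) hk
      rw [mem_filter, fiber_sdiff_above] at hw
      rw [mem_filter]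
      split_ifs at hw
      · simp at hw
      · exact hw
    · refine hm'.trans (card_le_card fun h hh => ?_)
      simp only [Finset.mem_sdiff, mem_above] at hh ⊢
      have := @hR (π h)
      tauto
  induction hn : R.card using Nat.strong_induction_on generalizing R with
  | _ n ih =>
    have hε : 0 ≤ removalError L L' q k m := removalError_nonneg hL ((Nat.cast_nonneg _).trans hq)
    rcases R.eq_empty_or_nonempty with rfl | hne
    · have : above π S ∅ = ∅ := by ext; simp [mem_above]
      rw [this, sdiff_empty, sub_self, abs_zero]
      positivity
    have step : ∀ R' x y, R' ⊂ R → Even (R'.filter fun w => (fiber π S w).card = 1).card →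
        x ∈ S \ above π S R' → y ∈ S \ above π S R' → x ≠ y → π x ∈ V₀ → π y ∈ V₀ →
        (∀ h ∈ S, π h = π x ∨ π h = π y → h = x ∨ h = y) →
        S \ above π S R = (S \ above π S R') \ {x, y} →
        |pr (S \ above π S R) (Good π V₀) - pr S (Good π V₀)| ≤
          n * removalError L L' q k m := by
      intro R' x y hss he hx hy hxy hVx hVy hf heq
      have hcard := card_lt_card hss
      have hL' : L ≤ (S \ above π S R').card := by
        refine hLS.trans ?_
        rw [heq]
        exact_mod_cast card_le_card sdiff_subset
      have h1 := ih R'.card (by omega) R' (hss.subset.trans hR) he hL' rfl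
      have h2 := key R' (hss.subset.trans hR) he hL' x y hx hy hxy hf hVx hVy
      rw [heq]
      have h3 : (R'.card : ℝ) + 1 ≤ n := by exact_mod_cast (by omega : R'.card + 1 ≤ n)
      calc _ ≤ _ := abs_sub_le _ (pr (S \ above π S R') (Good π V₀)) _
        _ ≤ removalError L L' q k m + R'.card * removalError L L' q k m := add_le_add h2 h1
        _ = (R'.card + 1) * removalError L L' q k m := by ring
        _ ≤ _ := by gcongr
    -- `R` is built up from single vertices of degree two and pairs of vertices of degree one. Each
    -- such step deletes exactly two points, and by `hRe` the vertices of degree one can be paired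
    -- off.
    by_cases h2 : ∃ w ∈ R, (fiber π S w).card = 2
    · obtain ⟨w, hwR, hw⟩ := h2
      obtain ⟨x, y, hxy, hf⟩ := card_eq_two.1 hw
      have hx : x ∈ S ∧ π x = w := mem_fiber.1 (by rw [hf]; simp)
      have hy : y ∈ S ∧ π y = w := mem_fiber.1 (by rw [hf]; simp)
      have hf' : ∀ h ∈ S, π h = w → h = x ∨ h = y := by
        intro h hh e
        have : h ∈ fiber π S w := mem_fiber.2 ⟨hh, e⟩
        rw [hf] at this; simpa using this
      refine step (R.erase w) x y (erase_ssubset hwR) ?_ ?_ ?_ hxy (by rw [hx.2]; exact hR hwR)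
        (by rw [hy.2]; exact hR hwR) (by rw [hx.2, hy.2]; simpa using hf') ?_
      · rw [filter_erase, erase_eq_of_notMem]
        · exact hRe
        · simp [hw]
      · simp [mem_above, hx]
      · simp [mem_above, hy]
      · ext h
        simp only [Finset.mem_sdiff, mem_above, mem_erase, mem_insert, mem_singleton]
        have := hf' h
        grind
    · push Not at h2
      have h1 : ∀ w ∈ R, (fiber π S w).card = 1 := fun w hw =>
        (hdeg w (hR hw)).resolve_right (h2 w hw)
      rw [filter_true_of_mem h1] at hRe
      have hc : 1 < R.card := by
        have := card_pos.2 hne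
        rcases hRe with ⟨t, ht⟩; omega
      obtain ⟨w, hw, w', hw', hww⟩ := one_lt_card.1 hc
      obtain ⟨x, hf⟩ := card_eq_one.1 (h1 w hw)
      obtain ⟨y, hf'⟩ := card_eq_one.1 (h1 w' hw')
      have hx : x ∈ S ∧ π x = w := mem_fiber.1 (by rw [hf]; simp)
      have hy : y ∈ S ∧ π y = w' := mem_fiber.1 (by rw [hf']; simp)
      have gx : ∀ h ∈ S, π h = w → h = x := by
        intro h hh e
        have : h ∈ fiber π S w := mem_fiber.2 ⟨hh, e⟩
        rw [hf] at this; simpa using this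
      have gy : ∀ h ∈ S, π h = w' → h = y := by
        intro h hh e
        have : h ∈ fiber π S w' := mem_fiber.2 ⟨hh, e⟩
        rw [hf'] at this; simpa using this
      have hw'e : w' ∈ R.erase w := mem_erase.2 ⟨hww.symm, hw'⟩
      refine step ((R.erase w).erase w') x y
        ((erase_ssubset hw'e).trans (erase_ssubset hw)) ?_ ?_ ?_ ?_ (by rw [hx.2]; exact hR hw)
        (by rw [hy.2]; exact hR hw') ?_ ?_
      · rw [filter_true_of_mem fun u hu => h1 u (mem_of_mem_erase (mem_of_mem_erase hu)),
          card_erase_of_mem hw'e, card_erase_of_mem hw]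
        rcases hRe with ⟨t, ht⟩; exact ⟨t - 1, by omega⟩
      · simp [mem_above, hx]
      · simp [mem_above, hy]
      · rintro rfl; exact hww (hx.2.symm.trans hy.2)
      · rw [hx.2, hy.2]
        exact fun h hh e => e.imp (gx h hh) (gy h hh)
      · ext h
        simp only [Finset.mem_sdiff, mem_above, mem_erase, mem_insert, mem_singleton]
        have := gx h
        have := gy h
        grind

end Removal

end ConfigModel

namespace ConfigModel

/-! ### The generating function of simple matchings -/

section GeneratingFunction

open Finset Equiv
open scoped Classical

theorem card_fiber_sigma {V : Type*} [Fintype V] [DecidableEq V] (d : V → ℕ) (v : V) :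
    (fiber (Sigma.fst : (Σ v, Fin (d v)) → V) univ v).card = d v := by
  have : fiber (Sigma.fst : (Σ v, Fin (d v)) → V) univ v =
      (univ : Finset (Fin (d v))).map (Function.Embedding.sigmaMk v) := by
    ext ⟨w, i⟩
    simp only [mem_fiber, mem_univ, true_and, Finset.mem_map, Function.Embedding.sigmaMk_apply]
    constructor
    · rintro rfl; exact ⟨i, rfl⟩
    · rintro ⟨j, hj⟩; exact (congrArg Sigma.fst hj).symm
  rw [this, Finset.card_map, card_univ, Fintype.card_fin]

theorem simpleCount_le (a r : ℕ) : simpleCount (2 * a) r ≤ matchingCount (2 * a + 2 * r) := by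
  set d : Fin (2 * a) ⊕ Fin r → ℕ := Sum.elim (fun _ => 1) (fun _ => 2) with hd
  have hdeg : ∀ v, (fiber (Sigma.fst : (Σ v, Fin (d v)) → _) univ v).card ≤ 2 := by
    intro v; rw [card_fiber_sigma]; rcases v with v | v <;> simp [hd]
  have h1 : degCount (Sigma.fst : (Σ v, Fin (d v)) → _) univ 1 = 2 * a := by
    unfold degCount
    have : (univ.filter fun v => (fiber (Sigma.fst : (Σ v, Fin (d v)) → _) univ v).card = 1) =
        (univ : Finset (Fin (2 * a))).map Function.Embedding.inl := by
      ext v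
      rw [mem_filter, card_fiber_sigma]
      rcases v with v | v <;> simp [hd]
    rw [this, Finset.card_map, card_univ, Fintype.card_fin]
  have h2 : degCount (Sigma.fst : (Σ v, Fin (d v)) → _) univ 2 = r := by
    unfold degCount
    have : (univ.filter fun v => (fiber (Sigma.fst : (Σ v, Fin (d v)) → _) univ v).card = 2) =
        (univ : Finset (Fin r)).map Function.Embedding.inr := by
      ext v
      rw [mem_filter, card_fiber_sigma]
      rcases v with v | v <;> simp [hd]
    rw [this, Finset.card_map, card_univ, Fintype.card_fin]
  have h3 := card_simple_eq_simpleCount hdeg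
  have h4 := card_eq_degCount hdeg
  rw [h1, h2] at h3 h4
  have h5 : Even (univ : Finset (Σ v, Fin (d v))).card := by
    rw [h4]; exact ⟨a + r, by ring⟩
  rw [← h3, ← h4, ← card_pairings h5]
  exact card_filter_le _ _

theorem matchingCount_mul_factorial (a : ℕ) : matchingCount (2 * a) * (2 ^ a * a !) = (2 * a)! := by
  induction a with
  | zero => simp [matchingCount_zero]
  | succ a ih =>
    have h : (2 * a + 2)! = (2 * a + 2) * ((2 * a + 1) * (2 * a)!) := by
      rw [Nat.factorial_succ, Nat.factorial_succ]
    rw [mul_add, mul_one, matchingCount_add_two (by simp), h, ← ih, Nat.factorial_succ]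
    ring

theorem matchingCount_mul_factorial_le (a r : ℕ) :
    matchingCount (2 * a + 2 * r) * a ! ≤ matchingCount (2 * a) * 2 ^ r * (r + a)! := by
  induction r with
  | zero => simp
  | succ r ih =>
    rw [mul_add, mul_one, ← add_assoc, matchingCount_add_two ⟨a + r, by ring⟩, add_right_comm r 1 a,
      Nat.factorial_succ]
    calc (2 * a + 2 * r + 1) * matchingCount (2 * a + 2 * r) * a !
        = (2 * a + 2 * r + 1) * (matchingCount (2 * a + 2 * r) * a !) := by ring
      _ ≤ (2 * (r + a + 1)) * (matchingCount (2 * a) * 2 ^ r * (r + a)!) :=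
          Nat.mul_le_mul (by omega) ih
      _ = _ := by ring

/-- A crude bound that ignores simplicity. It loses only polynomial factors in `r` for fixed `a`, so
the majorant still converges in the whole range `2 * y < 1`. -/
theorem simpleCount_div_le (a r : ℕ) :
    (simpleCount (2 * a) r : ℝ) / r ! ≤ matchingCount (2 * a) * ((r + a).choose a * 2 ^ r) := by
  have h1 : (simpleCount (2 * a) r : ℝ) ≤ matchingCount (2 * a + 2 * r) := by
    exact_mod_cast simpleCount_le a r
  have h2 : (matchingCount (2 * a + 2 * r) : ℝ) * a ! ≤ matchingCount (2 * a) * 2 ^ r * (r + a)! := by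
    exact_mod_cast matchingCount_mul_factorial_le a r
  have h3 : ((r + a).choose a : ℝ) * a ! * r ! = (r + a)! := by
    have := Nat.choose_mul_factorial_mul_factorial (Nat.le_add_left a r)
    rw [Nat.add_sub_cancel] at this
    exact_mod_cast this
  have ha : (0 : ℝ) < a ! := by positivity
  have hr : (0 : ℝ) < r ! := by positivity
  rw [div_le_iff₀ hr]
  refine le_of_mul_le_mul_right ?_ ha
  calc (simpleCount (2 * a) r : ℝ) * a ! ≤ matchingCount (2 * a + 2 * r) * a ! := by gcongr
    _ ≤ _ := h2
    _ = _ := by rw [← h3]; ring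

/-- The dominating term for the double series. -/
noncomputable def seriesMajorant (X Y : ℝ) (p : ℕ × ℕ) : ℝ :=
  (X / 2) ^ p.1 / p.1 ! * ((p.2 + p.1).choose p.1 * (2 * Y) ^ p.2)

theorem simpleCount_term_le {X Y : ℝ} (hX : 0 ≤ X) (hY : 0 ≤ Y) (p : ℕ × ℕ) :
    (simpleCount (2 * p.1) p.2 : ℝ) / ((2 * p.1)! * p.2 !) * (X ^ p.1 * Y ^ p.2) ≤
      seriesMajorant X Y p := by
  obtain ⟨a, r⟩ := p
  have h := simpleCount_div_le a r
  have h2 : (matchingCount (2 * a) : ℝ) * (2 ^ a * a !) = (2 * a)! := by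
    exact_mod_cast matchingCount_mul_factorial a
  have hM : (0 : ℝ) < matchingCount (2 * a) := by exact_mod_cast matchingCount_pos _
  unfold seriesMajorant
  simp only
  rw [← h2]
  calc _ = (simpleCount (2 * a) r : ℝ) / r ! * (X ^ a * Y ^ r / (matchingCount (2 * a) * (2 ^ a * a !))) := by
        field_simp
    _ ≤ (matchingCount (2 * a) * ((r + a).choose a * 2 ^ r)) *
          (X ^ a * Y ^ r / (matchingCount (2 * a) * (2 ^ a * a !))) := by gcongr
    _ = _ := by rw [div_pow, mul_pow]; field_simp

/-- The sum over the second index is a negative binomial series with value `(1 - 2 * Y) ^ (-(a +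
1))`; what remains is an exponential series. -/
theorem summable_seriesMajorant {X Y : ℝ} (hX : 0 ≤ X) (hY : 0 ≤ Y) (hY2 : 2 * Y < 1) :
    Summable (seriesMajorant X Y) := by
  have hn : ‖2 * Y‖ < 1 := by rw [Real.norm_eq_abs, abs_of_nonneg (by positivity)]; exact hY2
  have h0 : 0 < 1 - 2 * Y := by linarith
  rw [summable_prod_of_nonneg fun p => by unfold seriesMajorant; positivity]
  constructor
  · intro a
    exact (summable_choose_mul_geometric_of_norm_lt_one a hn).mul_left ((X / 2) ^ a / (a ! : ℝ))
  · have : ∀ a : ℕ, ∑' r, seriesMajorant X Y (a, r) =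
        1 / (1 - 2 * Y) * ((X / 2 / (1 - 2 * Y)) ^ a / a !) := by
      intro a
      simp only [seriesMajorant]
      rw [tsum_mul_left, tsum_choose_mul_geometric_of_norm_lt_one a hn]
      rw [div_pow _ (1 - 2 * Y), pow_succ]
      field_simp
    simp only [this]
    exact (Real.summable_pow_div_factorial _).mul_left _

/-- Comparing coefficients, this form of the recurrence is the differential equation `(1 - 2 * y) *
F' = (a + 4 * y ^ 2) * F` of the exponential generating function. -/
theorem simpleCount_recurrence (a r : ℕ) :
    ((r : ℝ) + 1) * ((simpleCount a (r + 1) : ℝ) / (r + 1)!) =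
      (a + 2 * r) * ((simpleCount a r : ℝ) / r !) +
        if 2 ≤ r then 4 * ((simpleCount a (r - 2) : ℝ) / (r - 2)!) else 0 := by
  rw [simpleCount, Nat.factorial_succ]
  split_ifs with h
  · obtain ⟨k, rfl⟩ := Nat.exists_eq_add_of_le' h
    simp only [Nat.add_sub_cancel]
    rw [Nat.factorial_succ (k + 1), Nat.factorial_succ k]
    have : k + 2 - 1 = k + 1 := by omega
    rw [this]
    push_cast
    have hk : (k ! : ℝ) ≠ 0 := by positivity
    have h1 : (k : ℝ) + 1 ≠ 0 := by positivity
    have h2 : (k : ℝ) + 1 + 1 ≠ 0 := by positivity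
    have h3 : (k : ℝ) + 2 + 1 ≠ 0 := by positivity
    field_simp
    ring
  · have : r * (r - 1) = 0 := by interval_cases r <;> rfl
    rw [this]
    push_cast
    have hk : (r ! : ℝ) ≠ 0 := by positivity
    have h1 : (r : ℝ) + 1 ≠ 0 := by positivity
    field_simp
    ring

theorem summable_simpleCount (a : ℕ) {y : ℝ} (hy : 0 ≤ y) (hy2 : 2 * y < 1) :
    Summable fun r => (simpleCount (2 * a) r : ℝ) / r ! * y ^ r := by
  have hn : ‖2 * y‖ < 1 := by rw [Real.norm_eq_abs, abs_of_nonneg (by positivity)]; exact hy2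
  refine Summable.of_nonneg_of_le (fun r => by positivity) (fun r => ?_)
    ((summable_choose_mul_geometric_of_norm_lt_one a hn).mul_left (matchingCount (2 * a) : ℝ))
  calc _ ≤ matchingCount (2 * a) * ((r + a).choose a * 2 ^ r) * y ^ r := by
        gcongr; exact simpleCount_div_le a r
    _ = _ := by rw [mul_pow]; ring

/-- Termwise differentiation. Between `|y|` and `R` there are two radii; the terms at the larger one
are bounded, which makes the derivatives up to the smaller one geometrically small. -/
theorem hasDerivAt_powerSeries {g : ℕ → ℝ} (hg0 : ∀ r, 0 ≤ g r) {R : ℝ} (hR : 0 < R)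
    (hg : ∀ y, 0 ≤ y → y < R → Summable fun r => g r * y ^ r) {y : ℝ} (hy : |y| < R) :
    (Summable fun r : ℕ => ((r : ℝ) + 1) * g (r + 1) * y ^ r) ∧
      HasDerivAt (fun z => ∑' r, g r * z ^ r) (∑' r : ℕ, ((r : ℝ) + 1) * g (r + 1) * y ^ r) y := by
  obtain ⟨R₁, hy1, hR1⟩ := exists_between hy
  obtain ⟨R₂, h12, hR2⟩ := exists_between hR1
  have p1 : 0 < R₁ := (abs_nonneg y).trans_lt hy1
  have p2 : 0 < R₂ := p1.trans h12
  have hs2 := hg R₂ p2.le hR2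
  have hu : Summable fun r : ℕ => g r * (r * R₁ ^ (r - 1)) := by
    have hq : ‖R₁ / R₂‖ < 1 := by
      rw [Real.norm_eq_abs, abs_of_pos (by positivity), div_lt_one p2]; exact h12
    have h1 := (summable_pow_mul_geometric_of_norm_lt_one 1 hq).mul_left
      ((∑' r, g r * R₂ ^ r) * (1 / R₁))
    refine Summable.of_nonneg_of_le (fun r => by have := hg0 r; positivity) (fun r => ?_) h1
    rcases r with _ | r
    · simp
    · have h2 : g (r + 1) * R₂ ^ (r + 1) ≤ ∑' r, g r * R₂ ^ r :=
        hs2.le_tsum (r + 1) fun j _ => by have := hg0 j; positivity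
      calc g (r + 1) * (((r + 1 : ℕ) : ℝ) * R₁ ^ (r + 1 - 1))
          = (g (r + 1) * R₂ ^ (r + 1)) * (1 / R₁) * ((((r + 1 : ℕ) : ℝ)) ^ 1 * (R₁ / R₂) ^ (r + 1)) := by
            rw [div_pow, Nat.add_sub_cancel, pow_one, pow_succ R₁]; field_simp
        _ ≤ _ := by gcongr
  have habs : ∀ z ∈ Set.Ioo (-R₁) R₁, ∀ r : ℕ, ‖g r * (r * z ^ (r - 1))‖ ≤ g r * (r * R₁ ^ (r - 1)) := by
    intro z hz r
    rw [norm_mul, norm_mul, norm_pow, Real.norm_of_nonneg (hg0 r), Real.norm_natCast, Real.norm_eq_abs]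
    have := abs_lt.2 hz
    have := hg0 r
    gcongr
  have hyI : y ∈ Set.Ioo (-R₁) R₁ := abs_lt.1 hy1
  have hsum : Summable fun r : ℕ => g r * (r * y ^ (r - 1)) :=
    Summable.of_norm_bounded hu fun r => habs y hyI r
  have hder := hasDerivAt_tsum_of_isPreconnected hu isOpen_Ioo isPreconnected_Ioo
    (g := fun r z => g r * z ^ r) (g' := fun r z => g r * (r * z ^ (r - 1)))
    (fun r z _ => ((hasDerivAt_pow r z).const_mul (g r))) (fun r z hz => habs z hz r)
    (y₀ := 0) ⟨by linarith, p1⟩ (hg 0 le_rfl hR) hyI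
  have hshift := (summable_nat_add_iff (f := fun r : ℕ => g r * (r * y ^ (r - 1))) 1).2 hsum
  have he : ∀ r : ℕ, g (r + 1) * (((r + 1 : ℕ) : ℝ) * y ^ (r + 1 - 1)) =
      ((r : ℝ) + 1) * g (r + 1) * y ^ r := by
    intro r; rw [Nat.add_sub_cancel]; push_cast; ring
  simp only [he] at hshift
  refine ⟨hshift, ?_⟩
  rw [hsum.tsum_eq_zero_add] at hder
  simp only [he] at hder
  simpa using hder

/-- The generating function of simple matchings with a given number of vertices of degree one. -/
theorem tsum_simpleCount (a : ℕ) {y : ℝ} (hy : 0 ≤ y) (hy2 : 2 * y < 1) :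
    ∑' r, (simpleCount (2 * a) r : ℝ) / r ! * y ^ r =
      matchingCount (2 * a) * ((1 - 2 * y) ^ (-(a + 1 / 2 : ℝ)) * Real.exp (-(y + y ^ 2))) := by
  set g : ℕ → ℝ := fun r => (simpleCount (2 * a) r : ℝ) / r ! with hg
  set F : ℝ → ℝ := fun z => ∑' r, g r * z ^ r with hF
  have hg0 : ∀ r, 0 ≤ g r := fun r => by simp only [hg]; positivity
  have hsum : ∀ z, 0 ≤ z → z < 1 / 2 → Summable fun r => g r * z ^ r :=
    fun z h1 h2 => summable_simpleCount a h1 (by linarith)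
  have hder : ∀ z, 0 ≤ z → z < 1 / 2 →
      HasDerivAt F ((2 * a + 4 * z ^ 2) * F z / (1 - 2 * z)) z := by
    intro z h1 h2
    obtain ⟨hs', hd⟩ := hasDerivAt_powerSeries hg0 (by norm_num) hsum
      (by rwa [abs_of_nonneg h1] : |z| < 1 / 2)
    convert hd using 1
    set F' := ∑' r : ℕ, ((r : ℝ) + 1) * g (r + 1) * z ^ r with hF'
    have e1 : ∀ r : ℕ, ((r : ℝ) + 1) * g (r + 1) * z ^ r = 2 * a * (g r * z ^ r) +
        2 * (r * g r * z ^ r) + (if 2 ≤ r then 4 * g (r - 2) else 0) * z ^ r := by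
      intro r
      have := simpleCount_recurrence (2 * a) r
      simp only [hg]
      rw [this]
      push_cast
      ring
    have s1 := hsum z h1 h2
    have s3 : Summable fun r : ℕ => (if 2 ≤ r then 4 * g (r - 2) else 0) * z ^ r := by
      rw [← summable_nat_add_iff 2]
      refine (s1.mul_left (4 * z ^ 2)).congr fun r => ?_
      rw [if_pos (by omega), Nat.add_sub_cancel]; ring
    have t3 : ∑' r : ℕ, (if 2 ≤ r then 4 * g (r - 2) else 0) * z ^ r = 4 * z ^ 2 * F z := by
      rw [hF, ← tsum_mul_left, ← s3.sum_add_tsum_nat_add 2]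
      simp only [sum_range_succ, range_zero, sum_empty]
      norm_num
      exact tsum_congr fun r => by ring
    have s2' : Summable fun r : ℕ => ((r + 1 : ℕ) : ℝ) * g (r + 1) * z ^ (r + 1) := by
      refine (hs'.mul_left z).congr fun r => ?_
      push_cast; ring
    have s2 : Summable fun r : ℕ => (r : ℝ) * g r * z ^ r :=
      (summable_nat_add_iff (f := fun r : ℕ => (r : ℝ) * g r * z ^ r) 1).1 s2'
    have t2 : ∑' r : ℕ, (r : ℝ) * g r * z ^ r = z * F' := by
      rw [s2.tsum_eq_zero_add, hF', ← tsum_mul_left]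
      simp only [Nat.cast_zero, zero_mul, zero_add]
      exact tsum_congr fun r => by push_cast; ring
    have t : F' = 2 * a * F z + 2 * (z * F') + 4 * z ^ 2 * F z := by
      rw [← t2, ← t3, hF, ← tsum_mul_left, ← tsum_mul_left,
        ← (s1.mul_left _).tsum_add (s2.mul_left _),
        ← ((s1.mul_left _).add (s2.mul_left _)).tsum_add s3]
      exact tsum_congr e1
    have : 1 - 2 * z ≠ 0 := by linarith
    rw [div_eq_iff this]
    linarith
  -- `F` is multiplied by the reciprocal of the claimed solution. The differential equation makes
  -- this product constant, and its value at zero is the number of matchings without vertices of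
  -- degree two.
  set h : ℝ → ℝ := fun z => F z * ((1 - 2 * z) ^ (a + 1 / 2 : ℝ) * Real.exp (z + z ^ 2)) with hh
  have hhd : ∀ z, 0 ≤ z → z < 1 / 2 → HasDerivAt h 0 z := by
    intro z h1 h2
    have hp : 0 < 1 - 2 * z := by linarith
    have d1 : HasDerivAt (fun z : ℝ => 1 - 2 * z) (-2) z := by
      simpa using ((hasDerivAt_id z).const_mul 2).const_sub 1
    have d2 := d1.rpow_const (p := (a + 1 / 2 : ℝ)) (Or.inl hp.ne')
    have d3 : HasDerivAt (fun z : ℝ => Real.exp (z + z ^ 2)) (Real.exp (z + z ^ 2) * (1 + 2 * z)) z := by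
      have : HasDerivAt (fun z : ℝ => z + z ^ 2) (1 + 2 * z) z := by
        exact ((hasDerivAt_id z).add ((hasDerivAt_id z).pow 2)).congr_deriv (by simp)
      exact this.exp
    refine ((hder z h1 h2).mul (d2.mul d3)).congr_deriv ?_
    have e : (1 - 2 * z) ^ (a + 1 / 2 : ℝ) = (1 - 2 * z) ^ ((a + 1 / 2 : ℝ) - 1) * (1 - 2 * z) := by
      rw [← Real.rpow_add_one hp.ne']; congr 1; ring
    simp only [Pi.mul_apply]
    rw [e]
    field_simp
    ring
  have hconst := constant_of_has_deriv_right_zero (f := h) (a := 0) (b := y)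
    (fun z hz => (hhd z hz.1 (by linarith [hz.2])).continuousAt.continuousWithinAt)
    (fun z hz => (hhd z hz.1 (by linarith [hz.2])).hasDerivWithinAt) y ⟨hy, le_rfl⟩
  have hF0 : F 0 = matchingCount (2 * a) := by
    rw [hF]
    simp only
    rw [tsum_eq_single 0 (fun r hr => by simp [hr])]
    simp [hg, simpleCount]
  have hp : 0 < 1 - 2 * y := by linarith
  rw [hh] at hconst
  simp only [hF0] at hconst
  simp at hconst
  change F y = _
  rw [← hconst, Real.rpow_neg hp.le, Real.exp_neg]
  have := Real.rpow_pos_of_pos hp (a + 1 / 2 : ℝ)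
  norm_num at this ⊢
  field_simp

/-- The sum of the double series. -/
theorem hasSum_simpleCount {x y : ℝ} (hx : 0 ≤ x) (hy : 0 ≤ y) (hy2 : 2 * y < 1) :
    HasSum (fun p : ℕ × ℕ => (simpleCount (2 * p.1) p.2 : ℝ) / ((2 * p.1)! * p.2 !) *
      (x ^ p.1 * y ^ p.2))
      ((1 - 2 * y) ^ (-(1 / 2) : ℝ) * Real.exp (x / (2 * (1 - 2 * y)) - (y + y ^ 2))) := by
  have hp : 0 < 1 - 2 * y := by linarith
  have hs : Summable (fun p : ℕ × ℕ => (simpleCount (2 * p.1) p.2 : ℝ) / ((2 * p.1)! * p.2 !) *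
      (x ^ p.1 * y ^ p.2)) :=
    Summable.of_nonneg_of_le (fun p => by positivity) (simpleCount_term_le hx hy)
      (summable_seriesMajorant hx hy hy2)
  have h : ∑' p : ℕ × ℕ, (simpleCount (2 * p.1) p.2 : ℝ) / ((2 * p.1)! * p.2 !) *
      (x ^ p.1 * y ^ p.2) =
        (1 - 2 * y) ^ (-(1 / 2) : ℝ) * Real.exp (x / (2 * (1 - 2 * y)) - (y + y ^ 2)) := by
    rw [hs.tsum_prod]
    -- Since `matchingCount (2 * a) / (2 * a)!` is `1 / (2 ^ a * a !)`, the sum over `a` becomes an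
    -- exponential series in `x / (2 * (1 - 2 * y))`.
    have : ∀ a : ℕ, ∑' r : ℕ, (simpleCount (2 * a) r : ℝ) / ((2 * a)! * r !) * (x ^ a * y ^ r) =
        (1 - 2 * y) ^ (-(1 / 2) : ℝ) * Real.exp (-(y + y ^ 2)) *
          ((x / (2 * (1 - 2 * y))) ^ a / a !) := by
      intro a
      have h2 : (matchingCount (2 * a) : ℝ) * (2 ^ a * a !) = (2 * a)! := by
        exact_mod_cast matchingCount_mul_factorial a
      have hM : (0 : ℝ) < matchingCount (2 * a) := by exact_mod_cast matchingCount_pos _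
      calc _ = ∑' r : ℕ, x ^ a / (2 * a)! * ((simpleCount (2 * a) r : ℝ) / r ! * y ^ r) :=
            tsum_congr fun r => by field_simp
        _ = _ := by
          rw [tsum_mul_left, tsum_simpleCount a hy hy2, ← h2, neg_add_rev, Real.rpow_add hp,
            Real.rpow_neg hp.le a, Real.rpow_natCast, div_pow, mul_pow]
          field_simp
    simp only [this]
    rw [tsum_mul_left, sub_eq_add_neg (x / (2 * (1 - 2 * y))), add_comm (x / (2 * (1 - 2 * y))),
      Real.exp_add, ← mul_assoc, Real.exp_eq_exp_ℝ, NormedSpace.exp_eq_tsum_div]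
  rw [← h]
  exact hs.hasSum

end GeneratingFunction

end ConfigModel

namespace ConfigModel

/-! ### Simplicity as a weighted sum over the type of the closed low set -/

section Decomposition

open Finset Equiv
open scoped Classical

variable {H V : Type*} [Fintype H] [DecidableEq H] [Fintype V] {π : H → V} {S : Finset H}
  {V₀ : Finset V}

theorem simpleCount_odd {a : ℕ} (ha : ¬ Even a) (r : ℕ) : simpleCount a r = 0 := by
  induction r using Nat.strong_induction_on with
  | _ r ih =>
    rcases r with _ | r
    · rw [simpleCount, if_neg ha]
    · rw [simpleCount, ih r (by omega), ih (r - 2) (by omega)]; simp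

/-- The sets of vertices from `V₀` with `2 * p.1` vertices of degree one and `p.2` of degree two. -/
noncomputable def typeClass (π : H → V) (S : Finset H) (V₀ : Finset V) (p : ℕ × ℕ) :
    Finset (Finset V) :=
  V₀.powerset.filter fun R => (R.filter fun v => (fiber π S v).card = 1).card = 2 * p.1 ∧
    (R.filter fun v => (fiber π S v).card = 2).card = p.2

theorem card_typeClass (hdeg : ∀ w ∈ V₀, (fiber π S w).card = 1 ∨ (fiber π S w).card = 2)
    (p : ℕ × ℕ) : (typeClass π S V₀ p).card =
      (V₀.filter fun v => (fiber π S v).card = 1).card.choose (2 * p.1) *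
        (V₀.filter fun v => (fiber π S v).card = 2).card.choose p.2 := by
  rw [← card_powersetCard, ← card_powersetCard, ← card_product]
  refine card_nbij' (fun R => (R.filter fun v => (fiber π S v).card = 1,
    R.filter fun v => (fiber π S v).card = 2)) (fun Q => Q.1 ∪ Q.2) ?_ ?_ ?_ ?_
  · intro R hR
    simp only [typeClass, coe_filter, Set.mem_ofPred_eq, mem_powerset] at hR
    simp only [coe_product, Set.mem_prod, mem_coe, mem_powersetCard]
    exact ⟨⟨filter_subset_filter _ hR.1, hR.2.1⟩, filter_subset_filter _ hR.1, hR.2.2⟩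
  · rintro ⟨A, B⟩ hAB
    simp only [coe_product, Set.mem_prod, mem_coe, mem_powersetCard] at hAB
    simp only [typeClass, coe_filter, Set.mem_ofPred_eq, mem_powerset]
    have hA : ∀ v ∈ A, (fiber π S v).card = 1 := fun v hv => (mem_filter.1 (hAB.1.1 hv)).2
    have hB : ∀ v ∈ B, (fiber π S v).card = 2 := fun v hv => (mem_filter.1 (hAB.2.1 hv)).2
    refine ⟨union_subset (hAB.1.1.trans (filter_subset _ _)) (hAB.2.1.trans (filter_subset _ _)),
      ?_, ?_⟩
    · rw [filter_union, filter_true_of_mem hA, filter_false_of_mem, union_empty, hAB.1.2]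
      intro v hv; rw [hB v hv]; norm_num
    · rw [filter_union, filter_true_of_mem hB, filter_false_of_mem, empty_union, hAB.2.2]
      intro v hv; rw [hA v hv]; norm_num
  · intro R hR
    simp only [typeClass, coe_filter, Set.mem_ofPred_eq, mem_powerset] at hR
    simp only [← filter_or]
    exact filter_true_of_mem fun v hv => hdeg v (hR.1 hv)
  · rintro ⟨A, B⟩ hAB
    simp only [coe_product, Set.mem_prod, mem_coe, mem_powersetCard] at hAB
    have hA : ∀ v ∈ A, (fiber π S v).card = 1 := fun v hv => (mem_filter.1 (hAB.1.1 hv)).2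
    have hB : ∀ v ∈ B, (fiber π S v).card = 2 := fun v hv => (mem_filter.1 (hAB.2.1 hv)).2
    ext v
    · simp only [mem_filter, mem_union]
      constructor
      · rintro ⟨h | h, h'⟩
        · exact h
        · rw [hB v h] at h'; omega
      · intro h; exact ⟨Or.inl h, hA v h⟩
    · simp only [mem_filter, mem_union]
      constructor
      · rintro ⟨h | h, h'⟩
        · rw [hA v h] at h'; omega
        · exact h
      · intro h; exact ⟨Or.inr h, hB v h⟩

theorem fiber_above (R : Finset V) (v : V) :
    fiber π (above π S R) v = if v ∈ R then fiber π S v else ∅ := by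
  ext h
  split_ifs with hv
  · simp only [mem_fiber, mem_above]
    constructor
    · rintro ⟨⟨h1, h2⟩, h3⟩; exact ⟨h1, h3⟩
    · rintro ⟨h1, rfl⟩; exact ⟨⟨h1, hv⟩, rfl⟩
  · simp only [mem_fiber, mem_above, notMem_empty, iff_false]
    rintro ⟨⟨h1, h2⟩, rfl⟩
    exact hv h2

theorem card_simple_above {R : Finset V}
    (hdeg : ∀ w ∈ R, (fiber π S w).card = 1 ∨ (fiber π S w).card = 2) :
    ((pairings (above π S R)).filter (Simple π)).card =
      simpleCount (R.filter fun v => (fiber π S v).card = 1).card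
        (R.filter fun v => (fiber π S v).card = 2).card := by
  rw [card_simple_eq_simpleCount]
  · congr 1
    · unfold degCount
      congr 1
      ext v
      simp only [fiber_above, mem_filter, mem_univ, true_and]
      split_ifs with hv <;> simp [hv]
    · unfold degCount
      congr 1
      ext v
      simp only [fiber_above, mem_filter, mem_univ, true_and]
      split_ifs with hv <;> simp [hv]
  · intro v
    rw [fiber_above]
    split_ifs with hv
    · rcases hdeg v hv with h | h <;> omega
    · simp

theorem card_above_eq {R : Finset V}
    (hdeg : ∀ w ∈ R, (fiber π S w).card = 1 ∨ (fiber π S w).card = 2) :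
    (above π S R).card = (R.filter fun v => (fiber π S v).card = 1).card +
      2 * (R.filter fun v => (fiber π S v).card = 2).card := by
  rw [card_above, card_filter, card_filter, mul_sum, ← sum_add_distrib]
  refine sum_congr rfl fun v hv => ?_
  rcases hdeg v hv with h | h <;> rw [h] <;> rfl

/-- The expected number of closed simple configurations with `2 * p.1` vertices of degree one and
`p.2` of degree two, when there are `L` points, `a` vertices of degree one and `r` of degree two. -/
noncomputable def closedWeight (L a r : ℕ) (p : ℕ × ℕ) : ℝ :=
  a.choose (2 * p.1) * r.choose p.2 * simpleCount (2 * p.1) p.2 *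
    matchingCount (L - 2 * (p.1 + p.2)) / matchingCount L

theorem closedWeight_nonneg (L a r : ℕ) (p : ℕ × ℕ) : 0 ≤ closedWeight L a r p := by
  unfold closedWeight; positivity

/-- The probability of simplicity in terms of that of a good matching. -/
theorem abs_pr_simple_sub_le (hS : Even S.card)
    (hdeg : ∀ w ∈ V₀, (fiber π S w).card = 1 ∨ (fiber π S w).card = 2) {a r : ℕ}
    (ha : (V₀.filter fun v => (fiber π S v).card = 1).card = a)
    (hr : (V₀.filter fun v => (fiber π S v).card = 2).card = r) (e : ℕ × ℕ → ℝ)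
    (he : ∀ p, ∀ R ∈ typeClass π S V₀ p,
      |pr (S \ above π S R) (Good π V₀) - pr S (Good π V₀)| ≤ e p) :
    |pr S (Simple π) - (∑' p, closedWeight S.card a r p) * pr S (Good π V₀)| ≤
      ∑' p, closedWeight S.card a r p * e p := by
  set box := range (a + 1) ×ˢ range (r + 1) with hbox
  have hzero : ∀ p ∉ box, closedWeight S.card a r p = 0 := by
    intro p hp
    simp only [hbox, mem_product, mem_range, not_and_or, not_lt] at hp
    unfold closedWeight
    rcases hp with h | h
    · rw [Nat.choose_eq_zero_of_lt (by omega : a < 2 * p.1)]; simp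
    · rw [Nat.choose_eq_zero_of_lt (by omega : r < p.2)]; simp
  rw [tsum_eq_sum hzero, tsum_eq_sum (s := box) fun p hp => by rw [hzero p hp, zero_mul]]
  have hM : (0 : ℝ) < matchingCount S.card := by exact_mod_cast matchingCount_pos _
  set α : Finset V → ℝ := fun R => pr (S \ above π S R) (Good π V₀) with hα
  set w : ℕ × ℕ → ℝ := fun p =>
    simpleCount (2 * p.1) p.2 * matchingCount (S.card - 2 * (p.1 + p.2)) / matchingCount S.card with hw
  have hcw : ∀ p, closedWeight S.card a r p = (typeClass π S V₀ p).card * w p := by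
    intro p
    rw [card_typeClass hdeg, ha, hr, hw]
    unfold closedWeight
    push_cast
    ring
  have hw0 : ∀ p, 0 ≤ w p := fun p => by simp only [hw]; positivity
  have hsub : ∀ R ∈ V₀.powerset, ∀ w ∈ R, (fiber π S w).card = 1 ∨ (fiber π S w).card = 2 :=
    fun R hR w hwR => hdeg w (mem_powerset.1 hR hwR)
  have hcard : ∀ R ∈ V₀.powerset, (S \ above π S R).card =
      S.card - ((R.filter fun v => (fiber π S v).card = 1).card +
        2 * (R.filter fun v => (fiber π S v).card = 2).card) := by
    intro R hR
    rw [card_sdiff_of_subset above_subset, card_above_eq (hsub R hR)]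
  -- `card_simple_eq_sum` divided by the number of matchings and grouped by type. Sets with an odd
  -- number of vertices of degree one carry no matching and drop out.
  have hmain : pr S (Simple π) = ∑ p ∈ box, ∑ R ∈ typeClass π S V₀ p, w p * α R := by
    rw [pr_def, card_simple_eq_sum (V₀ := V₀), card_pairings hS]
    swap
    · intro v hv
      have : (fiber π S v).Nonempty := by
        rw [← card_pos]; rcases hdeg v hv with h | h <;> omega
      obtain ⟨h, hh⟩ := this
      exact ⟨h, mem_fiber.1 hh⟩
    push_cast
    rw [sum_div]
    set T := V₀.powerset.filter fun R => Even (R.filter fun v => (fiber π S v).card = 1).card with hT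
    rw [← sum_filter_of_ne (p := fun R => Even (R.filter fun v => (fiber π S v).card = 1).card)]
    swap
    · intro R hR hne
      by_contra hodd
      refine hne ?_
      rw [card_simple_above (hsub R hR), simpleCount_odd hodd]
      simp
    rw [← hT, ← sum_fiberwise_of_maps_to (s := T) (t := box)
      (g := fun R => ((R.filter fun v => (fiber π S v).card = 1).card / 2,
        (R.filter fun v => (fiber π S v).card = 2).card))]
    swap
    · intro R hR
      rw [hT, mem_filter, mem_powerset] at hR
      have h1 := card_le_card (filter_subset_filter (fun v => (fiber π S v).card = 1) hR.1)
      have h2 := card_le_card (filter_subset_filter (fun v => (fiber π S v).card = 2) hR.1)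
      rw [ha] at h1
      rw [hr] at h2
      rw [hbox, mem_product, mem_range, mem_range]
      constructor
      · simp only; omega
      · simp only; omega
    refine sum_congr rfl fun p _ => ?_
    have hset : (T.filter fun R => ((R.filter fun v => (fiber π S v).card = 1).card / 2,
        (R.filter fun v => (fiber π S v).card = 2).card) = p) = typeClass π S V₀ p := by
      ext R
      simp only [hT, typeClass, mem_filter, Prod.ext_iff]
      rw [and_assoc]
      refine and_congr_right fun _ => ?_
      constructor
      · rintro ⟨⟨t, ht⟩, h1, h2⟩; exact ⟨by omega, h2⟩
      · rintro ⟨h1, h2⟩; exact ⟨⟨p.1, by omega⟩, by omega, h2⟩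
    rw [hset]
    refine sum_congr rfl fun R hR => ?_
    simp only [typeClass, mem_filter] at hR
    have hc := hcard R hR.1
    rw [hR.2.1, hR.2.2] at hc
    have hle : (above π S R).card ≤ S.card := card_le_card above_subset
    rw [card_above_eq (hsub R hR.1), hR.2.1, hR.2.2] at hle
    have hev : Even (S \ above π S R).card := by
      obtain ⟨t, ht⟩ := hS
      exact ⟨t - (p.1 + p.2), by omega⟩
    have e1 : S.card - (2 * p.1 + 2 * p.2) = S.card - 2 * (p.1 + p.2) := by omega
    have hM' : (0 : ℝ) < matchingCount (S.card - 2 * (p.1 + p.2)) := by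
      exact_mod_cast matchingCount_pos _
    rw [card_simple_above (hsub R hR.1), hR.2.1, hR.2.2, hα]
    simp only
    rw [pr_def, card_pairings hev, hc, e1, hw]
    simp only
    field_simp
  rw [hmain, sum_mul, ← sum_sub_distrib]
  refine (abs_sum_le_sum_abs _ _).trans (sum_le_sum fun p _ => ?_)
  have : ∑ R ∈ typeClass π S V₀ p, w p * α R - closedWeight S.card a r p * pr S (Good π V₀) =
      ∑ R ∈ typeClass π S V₀ p, w p * (α R - pr S (Good π V₀)) := by
    simp only [mul_sub, sum_sub_distrib, sum_const, nsmul_eq_mul]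
    rw [hcw]
    ring
  rw [this]
  calc _ ≤ ∑ R ∈ typeClass π S V₀ p, |w p * (α R - pr S (Good π V₀))| := abs_sum_le_sum_abs _ _
    _ ≤ ∑ R ∈ typeClass π S V₀ p, w p * e p := by
        refine sum_le_sum fun R hR => ?_
        rw [abs_mul, abs_of_nonneg (hw0 p)]
        exact mul_le_mul_of_nonneg_left (he p R hR) (hw0 p)
    _ = _ := by rw [sum_const, nsmul_eq_mul, hcw]; ring

theorem matchingCount_sub_two {L : ℕ} (hL : Even L) (h2 : 2 ≤ L) :
    (matchingCount L : ℝ) = ((L : ℝ) - 1) * matchingCount (L - 2) := by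
  obtain ⟨k, rfl⟩ := Nat.exists_eq_add_of_le' h2
  have hk : Even k := by simpa [Nat.even_add] using hL
  rw [matchingCount_add_two hk, Nat.add_sub_cancel]
  push_cast
  ring

/-- The factors of `matchingCount L / matchingCount (L - 2 * (i + j))` are set one by one against
those of the binomial coefficients: `a ^ 2` for two vertices of degree one, `r - j` for a vertex of
degree two. The result is the termwise bound for dominated convergence. -/
theorem closedWeight_le {L a r : ℕ} (hL : Even L) (har : a + 2 * r + 2 ≤ L) {X Y : ℝ}
    (hX : (a : ℝ) ^ 2 ≤ X * (L - a)) (hY : (r : ℝ) ≤ Y * (L - 1 - a)) (p : ℕ × ℕ) :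
    closedWeight L a r p ≤ (simpleCount (2 * p.1) p.2 : ℝ) / ((2 * p.1)! * p.2 !) *
      (X ^ p.1 * Y ^ p.2) := by
  have har' : (a : ℝ) + 2 * r + 2 ≤ L := by exact_mod_cast har
  have hr0 : (0 : ℝ) ≤ r := Nat.cast_nonneg _
  have ha0 : (0 : ℝ) ≤ a := Nat.cast_nonneg _
  have hX0 : 0 ≤ X := by
    by_contra! h
    have : X * (L - a) < 0 := mul_neg_of_neg_of_pos h (by linarith)
    nlinarith [sq_nonneg (a : ℝ)]
  have hY0 : 0 ≤ Y := by
    by_contra! h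
    have : Y * (L - 1 - a) < 0 := mul_neg_of_neg_of_pos h (by linarith)
    linarith
  obtain ⟨i, j⟩ := p
  simp only
  by_cases hi : a < 2 * i
  · unfold closedWeight
    simp only [Nat.choose_eq_zero_of_lt hi]
    simp only [Nat.cast_zero, zero_mul, zero_div]
    positivity
  by_cases hj : r < j
  · unfold closedWeight
    simp only [Nat.choose_eq_zero_of_lt hj]
    simp only [Nat.cast_zero, mul_zero, zero_mul, zero_div]
    positivity
  push Not at hi hj
  have h1 : ∀ i, 2 * i ≤ a → (a : ℝ) ^ (2 * i) * matchingCount (L - 2 * i) ≤ X ^ i * matchingCount L := by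
    intro i
    induction i with
    | zero => intro _; simp
    | succ i ih =>
      intro hi
      have hev : Even (L - 2 * i) := by obtain ⟨t, ht⟩ := hL; exact ⟨t - i, by omega⟩
      have hm := matchingCount_sub_two hev (by omega)
      have e : L - 2 * i - 2 = L - 2 * (i + 1) := by omega
      rw [e, Nat.cast_sub (by omega)] at hm
      push_cast at hm
      have hi' : 2 * (i : ℝ) + 2 ≤ a := by exact_mod_cast hi
      calc (a : ℝ) ^ (2 * (i + 1)) * matchingCount (L - 2 * (i + 1))
          = a ^ (2 * i) * (a ^ 2 * matchingCount (L - 2 * (i + 1))) := by ring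
        _ ≤ a ^ (2 * i) * (X * (L - 2 * i - 1) * matchingCount (L - 2 * (i + 1))) := by
            gcongr
            refine hX.trans (mul_le_mul_of_nonneg_left ?_ hX0)
            linarith
        _ = X * (a ^ (2 * i) * matchingCount (L - 2 * i)) := by rw [hm]; ring
        _ ≤ X * (X ^ i * matchingCount L) :=
            mul_le_mul_of_nonneg_left (ih (by omega)) hX0
        _ = _ := by ring
  have h2 : ∀ j ≤ r, (r.descFactorial j : ℝ) * matchingCount (L - 2 * (i + j)) ≤
      Y ^ j * matchingCount (L - 2 * i) := by
    intro j
    induction j with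
    | zero => intro _; simp
    | succ j ih =>
      intro hj
      have hev : Even (L - 2 * (i + j)) := by obtain ⟨t, ht⟩ := hL; exact ⟨t - (i + j), by omega⟩
      have hm := matchingCount_sub_two hev (by omega)
      have e : L - 2 * (i + j) - 2 = L - 2 * (i + (j + 1)) := by omega
      rw [e, Nat.cast_sub (by omega)] at hm
      push_cast at hm
      have hi' : 2 * (i : ℝ) ≤ a := by exact_mod_cast hi
      have hj' : (j : ℝ) + 1 ≤ r := by exact_mod_cast hj
      -- Because `2 * r ≤ B`, the quotient `(r - j) / (B - 2 * j)` is at most `r / B`, so later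
      -- factors are no worse than the first.
      have hkey : (r : ℝ) - j ≤ Y * (L - 2 * (i + j) - 1) := by
        set B : ℝ := L - 1 - 2 * i with hB
        have hB0 : 0 < B := by rw [hB]; linarith
        have hB2 : 2 * (r : ℝ) ≤ B := by rw [hB]; linarith
        have hrB : (r : ℝ) ≤ Y * B := hY.trans (mul_le_mul_of_nonneg_left (by rw [hB]; linarith) hY0)
        refine le_of_mul_le_mul_right ?_ hB0
        have hj0 : (0 : ℝ) ≤ j := Nat.cast_nonneg _
        calc ((r : ℝ) - j) * B ≤ r * (B - 2 * j) := by
              have := mul_le_mul_of_nonneg_left hB2 hj0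
              linarith
          _ ≤ Y * B * (B - 2 * j) := by
              have : 0 ≤ B - 2 * j := by linarith
              gcongr
          _ = _ := by rw [hB]; ring
      rw [Nat.descFactorial_succ, Nat.cast_mul, Nat.cast_sub (by omega)]
      calc ((r : ℝ) - j) * r.descFactorial j * matchingCount (L - 2 * (i + (j + 1)))
          = r.descFactorial j * (((r : ℝ) - j) * matchingCount (L - 2 * (i + (j + 1)))) := by ring
        _ ≤ r.descFactorial j * (Y * (L - 2 * (i + j) - 1) *
            matchingCount (L - 2 * (i + (j + 1)))) := by gcongr
        _ = Y * (r.descFactorial j * matchingCount (L - 2 * (i + j))) := by rw [hm]; ring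
        _ ≤ Y * (Y ^ j * matchingCount (L - 2 * i)) :=
            mul_le_mul_of_nonneg_left (ih (by omega)) hY0
        _ = _ := by ring
  have hM : (0 : ℝ) < matchingCount L := by exact_mod_cast matchingCount_pos _
  have hc1 : (a.choose (2 * i) : ℝ) ≤ a ^ (2 * i) / (2 * i)! := Nat.choose_le_pow_div _ _
  have hc2 : (r.choose j : ℝ) = r.descFactorial j / j ! := by
    rw [eq_div_iff (by positivity), Nat.descFactorial_eq_factorial_mul_choose]
    push_cast; ring
  unfold closedWeight
  simp only
  rw [div_le_iff₀ hM, hc2]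
  calc _ ≤ (a : ℝ) ^ (2 * i) / (2 * i)! * (r.descFactorial j / j !) * simpleCount (2 * i) j *
        matchingCount (L - 2 * (i + j)) := by gcongr
    _ = simpleCount (2 * i) j / ((2 * i)! * j !) * (a ^ (2 * i) * (r.descFactorial j *
        matchingCount (L - 2 * (i + j)))) := by field_simp
    _ ≤ simpleCount (2 * i) j / ((2 * i)! * j !) * (a ^ (2 * i) * (Y ^ j *
        matchingCount (L - 2 * i))) :=
        mul_le_mul_of_nonneg_left (mul_le_mul_of_nonneg_left (h2 j hj) (by positivity)) (by positivity)
    _ = simpleCount (2 * i) j / ((2 * i)! * j !) * (Y ^ j * (a ^ (2 * i) *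
        matchingCount (L - 2 * i))) := by ring
    _ ≤ simpleCount (2 * i) j / ((2 * i)! * j !) * (Y ^ j * (X ^ i * matchingCount L)) :=
        mul_le_mul_of_nonneg_left (mul_le_mul_of_nonneg_left (h1 i hi) (by positivity)) (by positivity)
    _ = _ := by ring

end Decomposition

/-! ### Convergence of the total closed weight -/

section Limits

open Finset

theorem tendsto_choose_div {f : ℕ → ℕ} {g : ℕ → ℝ} {c : ℝ} (hg : Tendsto g atTop atTop)
    (h : Tendsto (fun n => (f n : ℝ) / g n) atTop (𝓝 c)) (k : ℕ) :
    Tendsto (fun n => ((f n).choose k : ℝ) / g n ^ k) atTop (𝓝 (c ^ k / k !)) := by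
  have h1 : ∀ i : ℕ, Tendsto (fun n => ((f n - i : ℕ) : ℝ) / g n) atTop (𝓝 c) := by
    intro i
    have h0 : Tendsto (fun n => (i : ℝ) / g n) atTop (𝓝 0) := tendsto_const_nhds.div_atTop hg
    have h2 : Tendsto (fun n => (f n : ℝ) / g n - i / g n) atTop (𝓝 c) := by
      simpa using h.sub h0
    refine tendsto_of_tendsto_of_tendsto_of_le_of_le' h2 h ?_ ?_
    · filter_upwards [hg.eventually_gt_atTop 0] with n hn
      rw [← sub_div]
      gcongr
      rw [sub_le_iff_le_add]
      exact_mod_cast Nat.le_add_of_sub_le le_rfl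
    · filter_upwards [hg.eventually_gt_atTop 0] with n hn
      gcongr
      exact Nat.sub_le _ _
  have h2 : Tendsto (fun n => (∏ i ∈ range k, ((f n - i : ℕ) : ℝ) / g n) / k !) atTop
      (𝓝 ((∏ _i ∈ range k, c) / k !)) :=
    (tendsto_finsetProd _ fun i _ => h1 i).div_const _
  rw [prod_const, card_range] at h2
  refine h2.congr fun n => ?_
  rw [prod_div_distrib, prod_const, card_range, Nat.choose_eq_descFactorial_div_factorial,
    Nat.cast_div (Nat.factorial_dvd_descFactorial _ _) (by positivity),
    Nat.descFactorial_eq_prod_range]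
  push_cast
  ring

theorem tendsto_matchingCount_div {L : ℕ → ℕ} {c : ℝ} (hc : 0 < c) (hL : ∀ n, Even (L n))
    (h : Tendsto (fun n : ℕ => (L n : ℝ) / n) atTop (𝓝 c)) (k : ℕ) :
    Tendsto (fun n : ℕ => (n : ℝ) ^ k * matchingCount (L n - 2 * k) / matchingCount (L n)) atTop
      (𝓝 ((1 / c) ^ k)) := by
  have hLtop : Tendsto (fun n => (L n : ℝ)) atTop atTop := by
    have := h.pos_mul_atTop hc tendsto_natCast_atTop_atTop
    refine this.congr' ?_
    filter_upwards [eventually_gt_atTop 0] with n hn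
    field_simp
  induction k with
  | zero =>
    simp only [pow_zero, mul_zero, Nat.sub_zero, one_mul]
    refine tendsto_const_nhds.congr fun n => ?_
    have : (0 : ℝ) < matchingCount (L n) := by exact_mod_cast matchingCount_pos _
    rw [div_self this.ne']
  | succ k ih =>
    have h1 : Tendsto (fun n : ℕ => (n : ℝ) / (L n - 2 * k - 1)) atTop (𝓝 (1 / c)) := by
      have h2 : Tendsto (fun n : ℕ => (L n : ℝ) / n - (2 * k + 1) / n) atTop (𝓝 (c - 0)) :=
        h.sub (tendsto_const_nhds.div_atTop tendsto_natCast_atTop_atTop)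
      rw [sub_zero] at h2
      refine ((h2.inv₀ hc.ne').congr' ?_).trans (by rw [one_div])
      filter_upwards with n
      rw [← sub_div, inv_div]
      congr 1
      ring
    rw [pow_succ]
    refine (ih.mul h1).congr' ?_
    filter_upwards [hLtop.eventually_ge_atTop (2 * k + 2)] with n hn
    have hn' : 2 * k + 2 ≤ L n := by exact_mod_cast hn
    have hev : Even (L n - 2 * k) := by obtain ⟨t, ht⟩ := hL n; exact ⟨t - k, by omega⟩
    have hm := matchingCount_sub_two hev (by omega)
    have e : L n - 2 * k - 2 = L n - 2 * (k + 1) := by omega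
    rw [e, Nat.cast_sub (by omega)] at hm
    push_cast at hm
    have h0 : (L n : ℝ) - 2 * k - 1 ≠ 0 := by linarith
    rw [hm]
    field_simp
    ring

variable {L a r : ℕ → ℕ} {ρ p c : ℝ}

/-- Choosing `2 * q.1` vertices of degree one gives order `n ^ q.1`, choosing `q.2` of degree two
gives `n ^ q.2`, and the ratio of matching counts has order `n ^ (-(q.1 + q.2))`, so the powers of
`n` cancel. -/
theorem tendsto_closedWeight (hc : 0 < c) (hL : ∀ n, Even (L n))
    (hLc : Tendsto (fun n : ℕ => (L n : ℝ) / n) atTop (𝓝 c))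
    (ha : Tendsto (fun n : ℕ => (a n : ℝ) / √n) atTop (𝓝 ρ))
    (hr : Tendsto (fun n : ℕ => (r n : ℝ) / n) atTop (𝓝 p)) (q : ℕ × ℕ) :
    Tendsto (fun n => closedWeight (L n) (a n) (r n) q) atTop
      (𝓝 ((simpleCount (2 * q.1) q.2 : ℝ) / ((2 * q.1)! * q.2 !) *
        ((ρ ^ 2 / c) ^ q.1 * (p / c) ^ q.2))) := by
  have hsq : Tendsto (fun n : ℕ => √(n : ℝ)) atTop atTop :=
    Real.tendsto_sqrt_atTop.comp tendsto_natCast_atTop_atTop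
  have h1 := tendsto_choose_div hsq ha (2 * q.1)
  have h2 := tendsto_choose_div tendsto_natCast_atTop_atTop hr q.2
  have h3 := tendsto_matchingCount_div hc hL hLc (q.1 + q.2)
  have h4 := ((h1.mul h2).mul h3).mul_const (simpleCount (2 * q.1) q.2 : ℝ)
  have e : (simpleCount (2 * q.1) q.2 : ℝ) / ((2 * q.1)! * q.2 !) *
        ((ρ ^ 2 / c) ^ q.1 * (p / c) ^ q.2) = ρ ^ (2 * q.1) / (2 * q.1)! * (p ^ q.2 / q.2 !) *
          (1 / c) ^ (q.1 + q.2) * simpleCount (2 * q.1) q.2 := by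
    rw [div_pow, div_pow, one_div, inv_pow, pow_add, ← pow_mul]
    field_simp
  rw [e]
  refine h4.congr' ?_
  filter_upwards [eventually_gt_atTop 0] with n hn
  have hn' : (0 : ℝ) < n := by exact_mod_cast hn
  unfold closedWeight
  rw [pow_mul √(n : ℝ), Real.sq_sqrt hn'.le, pow_add]
  have : (0 : ℝ) < matchingCount (L n) := by exact_mod_cast matchingCount_pos _
  field_simp

/-- The weighted number of closed configurations converges. -/
theorem tendsto_tsum_closedWeight (hc : 0 < c) (hp : 0 ≤ p) (hpc : 2 * p < c) (hL : ∀ n, Even (L n))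
    (hLc : Tendsto (fun n : ℕ => (L n : ℝ) / n) atTop (𝓝 c))
    (ha : Tendsto (fun n : ℕ => (a n : ℝ) / √n) atTop (𝓝 ρ))
    (hr : Tendsto (fun n : ℕ => (r n : ℝ) / n) atTop (𝓝 p))
    (hLar : ∀ᶠ n in atTop, a n + 2 * r n + 2 ≤ L n) {e : ℕ → ℕ × ℕ → ℝ} {e' : ℝ}
    (he : ∀ n q, 0 ≤ e n q ∧ e n q ≤ 1)
    (he' : ∀ q, Tendsto (fun n => e n q) atTop (𝓝 e')) :
    Tendsto (fun n => ∑' q, closedWeight (L n) (a n) (r n) q * e n q) atTop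
      (𝓝 ((1 - 2 * (p / c)) ^ (-(1 / 2) : ℝ) *
        Real.exp (ρ ^ 2 / c / (2 * (1 - 2 * (p / c))) - (p / c + (p / c) ^ 2)) * e')) := by
  have hpc' : 2 * (p / c) < 1 := by rw [← mul_div_assoc, div_lt_one hc]; exact hpc
  have hpc0 : 0 ≤ p / c := by positivity
  have hx0 : 0 ≤ ρ ^ 2 / c := by positivity
  rw [← ((hasSum_simpleCount hx0 hpc0 hpc').mul_right e').tsum_eq]
  -- Slightly larger parameters `X` and `Y` dominate the weights for all large `n`; `Y` stays below
  -- `1 / 2`, inside the region of convergence.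
  obtain ⟨Y, hY1, hY2⟩ := exists_between (show p / c < 1 / 2 by linarith)
  have hY0 : 0 ≤ Y := hpc0.trans hY1.le
  set X := ρ ^ 2 / c + 1 with hX
  have hX0 : 0 ≤ X := by positivity
  refine tendsto_tsum_of_dominated_convergence (bound := seriesMajorant X Y)
    (summable_seriesMajorant hX0 hY0 (by linarith)) (fun q => ?_) ?_
  · exact (tendsto_closedWeight hc hL hLc ha hr q).mul (he' q)
  · have hinv : Tendsto (fun n : ℕ => 1 / √(n : ℝ)) atTop (𝓝 0) :=
      tendsto_const_nhds.div_atTop (Real.tendsto_sqrt_atTop.comp tendsto_natCast_atTop_atTop)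
    have ha0 : Tendsto (fun n : ℕ => (a n : ℝ) / n) atTop (𝓝 0) := by
      have := ha.mul hinv
      rw [mul_zero] at this
      refine this.congr fun n => ?_
      rw [div_mul_div_comm, mul_one, Real.mul_self_sqrt (Nat.cast_nonneg _)]
    have ha2 : Tendsto (fun n : ℕ => (a n : ℝ) ^ 2 / n) atTop (𝓝 (ρ ^ 2)) := by
      refine (ha.pow 2).congr fun n => ?_
      rw [div_pow, Real.sq_sqrt (Nat.cast_nonneg _)]
    have h1 : Tendsto (fun n : ℕ => (1 : ℝ) / n) atTop (𝓝 0) :=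
      tendsto_const_nhds.div_atTop tendsto_natCast_atTop_atTop
    have t1 : ∀ᶠ n : ℕ in atTop, (a n : ℝ) ^ 2 / n < X * ((L n : ℝ) / n - a n / n) := by
      refine ha2.eventually_lt ((hLc.sub ha0).const_mul X) ?_
      rw [hX, sub_zero, add_mul, div_mul_cancel₀ _ hc.ne']
      linarith
    have t2 : ∀ᶠ n : ℕ in atTop, (r n : ℝ) / n < Y * ((L n : ℝ) / n - 1 / n - a n / n) := by
      refine hr.eventually_lt (((hLc.sub h1).sub ha0).const_mul Y) ?_
      rw [sub_zero, sub_zero]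
      rwa [div_lt_iff₀ hc] at hY1
    filter_upwards [t1, t2, hLar, eventually_gt_atTop 0] with n h1 h2 h3 h4 q
    have hn : (0 : ℝ) < n := by exact_mod_cast h4
    rw [← sub_div, ← mul_div_assoc, div_lt_div_iff_of_pos_right hn] at h1
    rw [← sub_div, ← sub_div, ← mul_div_assoc, div_lt_div_iff_of_pos_right hn] at h2
    have hw := closedWeight_nonneg (L n) (a n) (r n) q
    rw [Real.norm_of_nonneg (mul_nonneg hw (he n q).1)]
    calc _ ≤ closedWeight (L n) (a n) (r n) q * 1 := by gcongr; exact (he n q).2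
      _ ≤ _ := by rw [mul_one]; exact closedWeight_le (hL n) h3 h1.le h2.le q
      _ ≤ _ := simpleCount_term_le hX0 hY0 q

end Limits

end ConfigModel

namespace ConfigModel

/-! ### From pairings of half-edges to graphs -/

section Graphs

open Finset Equiv
open scoped Classical

variable {n : ℕ} {d : Fin n → ℕ}

theorem mem_pairings_univ {σ : Perm (HalfEdge d)} :
    σ ∈ pairings (univ : Finset (HalfEdge d)) ↔ ∀ h, σ h ≠ h ∧ σ (σ h) = h := by
  rw [mem_pairings]
  simp only [mem_univ, iff_true]
  exact ⟨fun h x => ⟨h.2 x, by simpa using h.1 x⟩, fun h => ⟨fun x => by simpa using (h x).2, fun x => (h x).1⟩⟩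

/-- The multigraph of a permutation of the half-edges, with multiplicities forgotten. -/
def edgeGraph (σ : Perm (HalfEdge d)) : SimpleGraph (Fin n) :=
  SimpleGraph.fromRel fun u v => ∃ h : HalfEdge d, h.1 = u ∧ (σ h).1 = v

theorem edgeGraph_adj {σ : Perm (HalfEdge d)} (hσ : ∀ h, σ (σ h) = h) {u v : Fin n} :
    (edgeGraph σ).Adj u v ↔ u ≠ v ∧ ∃ h : HalfEdge d, h.1 = u ∧ (σ h).1 = v := by
  rw [edgeGraph, SimpleGraph.fromRel_adj]
  refine and_congr_right fun _ => ⟨?_, Or.inl⟩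
  rintro (h | ⟨h, h1, h2⟩)
  · exact h
  · exact ⟨σ h, h2, by rw [hσ, h1]⟩

theorem mem_simpleEvent {σ : Pairing d} : σ ∈ simpleEvent d ↔ Simple Sigma.fst σ.1 := by
  have h := fun x => (σ.2 x).1
  exact ⟨fun ⟨h1, h2⟩ => ⟨fun x _ => h1 x, fun x y _ _ => h2 x y⟩,
    fun ⟨h1, h2⟩ => ⟨fun x => h1 x (h x), fun x y => h2 x y (h x) (h y)⟩⟩

theorem closed_reachable {σ : Perm (HalfEdge d)} (hσ : ∀ h, σ (σ h) = h) {R : Finset (Fin n)}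
    (hR : Closed Sigma.fst σ R) {u v : Fin n} (hu : u ∈ R) (huv : (edgeGraph σ).Reachable u v) :
    v ∈ R := by
  obtain ⟨p⟩ := huv
  induction p with
  | nil => exact hu
  | cons h p ih =>
    obtain ⟨-, x, h1, h2⟩ := (edgeGraph_adj hσ).1 h
    exact ih (h2 ▸ hR x (h1 ▸ hu))

theorem not_hasClosed_of_connected {σ : Perm (HalfEdge d)} (hσ : ∀ h, σ (σ h) = h)
    {V₀ : Finset (Fin n)} (hV : ∃ w, w ∉ V₀) (hc : (edgeGraph σ).Connected) :
    ¬ HasClosed Sigma.fst V₀ σ := by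
  rintro ⟨R, hR, ⟨h, -, hh⟩, hcl⟩
  obtain ⟨w, hw⟩ := hV
  exact hw (hR (closed_reachable hσ hcl hh (hc.preconnected _ w)))

/-- A component and its complement are both closed. If one of them lay in `V₀` it would be a
forbidden closed set, so both contain a vertex outside `V₀`. -/
theorem connected_or_split {σ : Perm (HalfEdge d)} (hσ : ∀ h, σ h ≠ h ∧ σ (σ h) = h)
    {V₀ : Finset (Fin n)} (hn : 0 < n) (hd : ∀ v, 0 < d v) (hcl : ¬ HasClosed Sigma.fst V₀ σ) :
    (edgeGraph σ).Connected ∨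
      ∃ R, Closed Sigma.fst σ R ∧ (∃ w ∈ R, w ∉ V₀) ∧ ∃ w ∉ R, w ∉ V₀ := by
  haveI : Nonempty (Fin n) := ⟨⟨0, hn⟩⟩
  by_cases hc : (edgeGraph σ).Connected
  · exact Or.inl hc
  refine Or.inr ?_
  rw [SimpleGraph.connected_iff] at hc
  have hpre : ¬ (edgeGraph σ).Preconnected := fun h => hc ⟨h, inferInstance⟩
  rw [SimpleGraph.Preconnected] at hpre
  push Not at hpre
  obtain ⟨u, w, huw⟩ := hpre
  set R : Finset (Fin n) := univ.filter fun v => (edgeGraph σ).Reachable u v with hRdef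
  have hadj : ∀ h : HalfEdge d, (edgeGraph σ).Reachable h.1 (σ h).1 := by
    intro h
    by_cases e : h.1 = (σ h).1
    · rw [← e]
    · exact SimpleGraph.Adj.reachable ((edgeGraph_adj fun x => (hσ x).2).2 ⟨e, h, rfl, rfl⟩)
  have hR : Closed Sigma.fst σ R := by
    intro h hh
    simp only [hRdef, mem_filter, mem_univ, true_and] at hh ⊢
    exact hh.trans (hadj h)
  have hR' : Closed Sigma.fst σ Rᶜ := by
    intro h hh
    simp only [hRdef, mem_compl, mem_filter, mem_univ, true_and] at hh ⊢
    exact fun h' => hh (h'.trans (hadj h).symm)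
  have hu : u ∈ R := by simp [hRdef]
  have hw : w ∈ Rᶜ := by simp [hRdef, huw]
  refine ⟨R, hR, ?_, ?_⟩
  · by_contra! hall
    exact hcl ⟨R, hall, ⟨⟨u, ⟨0, hd u⟩⟩, (hσ _).1, hu⟩, hR⟩
  · by_contra! hall
    exact hcl ⟨Rᶜ, fun v hv => hall v (mem_compl.1 hv), ⟨⟨w, ⟨0, hd w⟩⟩, (hσ _).1, hw⟩, hR'⟩

/-- Simple and connected. -/
def SimpleConnected (d : Fin n → ℕ) (σ : Perm (HalfEdge d)) : Prop :=
  Simple Sigma.fst σ ∧ (edgeGraph σ).Connected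

theorem abs_pr_simpleConnected_sub_le {V₀ : Finset (Fin n)} (hV : ∃ w, w ∉ V₀)
    (hd : ∀ v, 0 < d v) :
    |pr univ (SimpleConnected d) - pr (univ : Finset (HalfEdge d)) (Good Sigma.fst V₀)| ≤
      pr univ (fun σ : Perm (HalfEdge d) =>
        ∃ R, Closed Sigma.fst σ R ∧ (∃ w ∈ R, w ∉ V₀) ∧ ∃ w ∉ R, w ∉ V₀) := by
  have hn : 0 < n := by obtain ⟨w, -⟩ := hV; exact w.pos
  have h1 : pr univ (SimpleConnected d) ≤
      pr (univ : Finset (HalfEdge d)) (Good Sigma.fst V₀) := by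
    refine pr_mono fun σ hσ h => ⟨h.1, ?_⟩
    exact not_hasClosed_of_connected (fun x => (mem_pairings_univ.1 hσ x).2) hV h.2
  have h2 : pr (univ : Finset (HalfEdge d)) (Good Sigma.fst V₀) ≤ pr univ (fun σ => SimpleConnected d σ ∨
      ∃ R, Closed Sigma.fst σ R ∧ (∃ w ∈ R, w ∉ V₀) ∧ ∃ w ∉ R, w ∉ V₀) := by
    refine pr_mono fun σ hσ h => ?_
    rcases connected_or_split (mem_pairings_univ.1 hσ) hn hd h.2 with hc | hc
    · exact Or.inl ⟨h.1, hc⟩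
    · exact Or.inr hc
  have h3 := h2.trans (pr_or_le _ _ _)
  rw [abs_le]
  constructor
  · linarith
  · have := pr_nonneg (univ : Finset (HalfEdge d)) (fun σ : Perm (HalfEdge d) =>
        ∃ R, Closed Sigma.fst σ R ∧ (∃ w ∈ R, w ∉ V₀) ∧ ∃ w ∉ R, w ∉ V₀)
    linarith

theorem card_filter_pairing (p : Perm (HalfEdge d) → Prop) :
    (univ.filter fun σ : Pairing d => p σ.1).card =
      ((pairings (univ : Finset (HalfEdge d))).filter p).card := by
  rw [← Finset.card_map (Function.Embedding.subtype _)]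
  congr 1
  ext σ
  simp only [Finset.mem_map, mem_filter, mem_univ, true_and, Function.Embedding.subtype_apply,
    mem_pairings_univ]
  constructor
  · rintro ⟨τ, h1, rfl⟩; exact ⟨τ.2, h1⟩
  · rintro ⟨h1, h2⟩; exact ⟨⟨σ, h1⟩, h2, rfl⟩

theorem card_halfEdge : (univ : Finset (HalfEdge d)).card = totalDegree d := by
  rw [card_univ, Fintype.card_sigma]; simp [totalDegree]

instance : MeasurableSingletonClass (Pairing d) := ⟨fun _ => trivial⟩

theorem law_toReal (p : Perm (HalfEdge d) → Prop) :
    (law d {σ | p σ.1}).toReal = pr univ p := by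
  have h1 : Fintype.card (Pairing d) = (pairings (univ : Finset (HalfEdge d))).card := by
    have := card_filter_pairing (d := d) (fun _ => True)
    simpa only [filter_true, card_univ] using this
  have h2 : Measure.count {σ : Pairing d | p σ.1} =
      ((univ.filter fun σ : Pairing d => p σ.1).card : ENNReal) := by
    rw [← Measure.count_apply_finset]
    simp
  rw [law, uniformOn_univ, h2, h1, card_filter_pairing, ENNReal.toReal_div, ENNReal.toReal_natCast,
    ENNReal.toReal_natCast, pr_def]

theorem cond_toReal :
    ((law d)[connectedEvent d | simpleEvent d]).toReal =
      pr univ (SimpleConnected d) / pr (univ : Finset (HalfEdge d)) (Simple Sigma.fst) := by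
  have e1 : simpleEvent d = {σ | Simple Sigma.fst σ.1} := by ext σ; exact mem_simpleEvent
  have e2 : simpleEvent d ∩ connectedEvent d = {σ | SimpleConnected d σ.1} := by
    ext σ
    rw [Set.mem_inter_iff, mem_simpleEvent]
    rfl
  rw [cond_apply (by trivial), ENNReal.toReal_mul, ENNReal.toReal_inv, e2, e1, law_toReal,
    law_toReal, div_eq_inv_mul]

/-- The pairing described by an enumeration of the neighbours of every vertex. -/
noncomputable def pairingOfLabels (G : SimpleGraph (Fin n))
    (lab : ∀ v, Fin (d v) ≃ G.neighborSet v) (h : HalfEdge d) : HalfEdge d :=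
  ⟨lab h.1 h.2, (lab (lab h.1 h.2)).symm ⟨h.1, (lab h.1 h.2).2.symm⟩⟩

theorem pairingOfLabels_ext {G : SimpleGraph (Fin n)} {lab : ∀ v, Fin (d v) ≃ G.neighborSet v}
    {h k : HalfEdge d} (h1 : h.1 = k.1) (h2 : (lab h.1 h.2 : Fin n) = lab k.1 k.2) : h = k := by
  obtain ⟨v, i⟩ := h
  obtain ⟨w, j⟩ := k
  simp only at h1
  subst h1
  exact congrArg (Sigma.mk v) ((lab v).injective (Subtype.ext h2))

theorem pairingOfLabels_fst (G : SimpleGraph (Fin n)) (lab : ∀ v, Fin (d v) ≃ G.neighborSet v)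
    (h : HalfEdge d) : (pairingOfLabels G lab h).1 = lab h.1 h.2 := rfl

theorem label_pairingOfLabels (G : SimpleGraph (Fin n)) (lab : ∀ v, Fin (d v) ≃ G.neighborSet v)
    (h : HalfEdge d) :
    (lab (pairingOfLabels G lab h).1 (pairingOfLabels G lab h).2 : Fin n) = h.1 :=
  congrArg Subtype.val (Equiv.apply_symm_apply (lab (lab h.1 h.2)) _)

theorem pairingOfLabels_invol (G : SimpleGraph (Fin n)) (lab : ∀ v, Fin (d v) ≃ G.neighborSet v)
    (h : HalfEdge d) : pairingOfLabels G lab (pairingOfLabels G lab h) = h := by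
  have h1 : (pairingOfLabels G lab (pairingOfLabels G lab h)).1 = h.1 := by
    rw [pairingOfLabels_fst, label_pairingOfLabels]
  exact pairingOfLabels_ext (lab := lab) h1 (by rw [label_pairingOfLabels, pairingOfLabels_fst])

/-- Every graph with the given degrees arises from `∏ v, (d v)!` simple pairings. -/
theorem card_pairings_of_graph {G : SimpleGraph (Fin n)} (hG : ∀ v, (G.neighborSet v).ncard = d v) :
    ((pairings (univ : Finset (HalfEdge d))).filter fun σ =>
      Simple Sigma.fst σ ∧ edgeGraph σ = G).card = ∏ v, (d v)! := by
  have hcard : Fintype.card (∀ v, Fin (d v) ≃ G.neighborSet v) = ∏ v, (d v)! := by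
    rw [Fintype.card_pi]
    refine prod_congr rfl fun v _ => ?_
    have h1 : Fintype.card (G.neighborSet v) = d v := by
      rw [← hG v, Set.ncard_eq_toFinset_card', Set.toFinset_card]
    have e : Fin (d v) ≃ G.neighborSet v := Fintype.equivOfCardEq (by rw [h1, Fintype.card_fin])
    rw [Fintype.card_equiv e, Fintype.card_fin]
  rw [← hcard, ← card_univ]
  symm
  refine card_bij (fun lab _ => (⟨pairingOfLabels G lab, pairingOfLabels G lab,
    pairingOfLabels_invol G lab, pairingOfLabels_invol G lab⟩ : Perm (HalfEdge d))) ?_ ?_ ?_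
  · intro lab _
    have hinv := pairingOfLabels_invol G lab
    have hadj : ∀ h : HalfEdge d, G.Adj h.1 (pairingOfLabels G lab h).1 := fun h => (lab h.1 h.2).2
    have hloop : ∀ h : HalfEdge d, (pairingOfLabels G lab h).1 ≠ h.1 := fun h e =>
      G.loopless.irrefl h.1 (by simpa only [e] using hadj h)
    rw [mem_filter, mem_pairings_univ]
    refine ⟨fun h => ⟨fun e => hloop h (congrArg Sigma.fst e), hinv h⟩, ⟨fun h _ => hloop h, ?_⟩, ?_⟩
    · intro h h' _ _ e1 e2
      exact pairingOfLabels_ext (lab := lab) e1 e2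
    · ext u v
      rw [edgeGraph_adj (fun h => hinv h)]
      constructor
      · rintro ⟨-, h, rfl, rfl⟩; exact hadj h
      · intro huv
        refine ⟨huv.ne, ⟨u, (lab u).symm ⟨v, huv⟩⟩, rfl, ?_⟩
        simp [pairingOfLabels]
  · intro lab _ lab₂ _ e
    funext v
    ext i
    have := congrArg (fun σ : Perm (HalfEdge d) => (σ ⟨v, i⟩).1) e
    exact congrArg Fin.val this
  · intro σ hσ
    rw [mem_filter, mem_pairings_univ] at hσ
    obtain ⟨hσ, hsim, rfl⟩ := hσ
    have hinv := fun h => (hσ h).2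
    have hadj : ∀ h : HalfEdge d, (edgeGraph σ).Adj h.1 (σ h).1 := fun h =>
      (edgeGraph_adj hinv).2 ⟨(hsim.1 h (hσ h).1).symm, h, rfl, rfl⟩
    -- In a simple pairing the half-edges at `v` correspond to its neighbours, and this labelling
    -- recovers the pairing.
    have hbij : ∀ v, Function.Bijective
        (fun i : Fin (d v) => (⟨(σ ⟨v, i⟩).1, hadj ⟨v, i⟩⟩ : (edgeGraph σ).neighborSet v)) := by
      intro v
      constructor
      · intro i j e
        have := hsim.2 ⟨v, i⟩ ⟨v, j⟩ (hσ _).1 (hσ _).1 rfl (congrArg Subtype.val e)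
        simpa using this
      · rintro ⟨w, hw⟩
        obtain ⟨-, ⟨u, i⟩, h1, h2⟩ := (edgeGraph_adj hinv).1 hw
        simp only at h1
        subst h1
        exact ⟨i, Subtype.ext h2⟩
    refine ⟨fun v => Equiv.ofBijective _ (hbij v), mem_univ _, ?_⟩
    ext1 h
    rw [Equiv.coe_fn_mk]
    refine pairingOfLabels_ext (lab := fun v => Equiv.ofBijective _ (hbij v)) rfl ?_
    refine (label_pairingOfLabels _ (fun v => Equiv.ofBijective _ (hbij v)) h).trans ?_
    exact congrArg Sigma.fst (hinv h).symm

theorem numConnectedSimple_mul :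
    numConnectedSimple d * ∏ v, (d v)! =
      ((pairings (univ : Finset (HalfEdge d))).filter (SimpleConnected d)).card := by
  set T := (univ : Finset (SimpleGraph (Fin n))).filter fun G =>
    G.Connected ∧ ∀ v, (G.neighborSet v).ncard = d v with hT
  have h1 : numConnectedSimple d = T.card := by
    rw [numConnectedSimple, Nat.card_eq_fintype_card, Fintype.card_subtype]
  rw [h1, card_eq_sum_card_fiberwise (f := edgeGraph) (t := T), ← smul_eq_mul, ← sum_const]
  · refine sum_congr rfl fun G hG => ?_
    rw [hT, mem_filter] at hG
    rw [← card_pairings_of_graph hG.2.2, filter_filter]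
    congr 1
    ext σ
    simp only [mem_filter, SimpleConnected]
    grind
  · intro σ hσ
    rw [mem_coe, mem_filter, mem_pairings_univ] at hσ
    obtain ⟨hσ, hsim, hc⟩ := hσ
    rw [mem_coe, hT, mem_filter]
    refine ⟨mem_univ _, hc, fun v => ?_⟩
    have hinv := fun h => (hσ h).2
    have : (edgeGraph σ).neighborSet v =
        (fun i : Fin (d v) => (σ ⟨v, i⟩).1) '' Set.univ := by
      ext w
      rw [SimpleGraph.mem_neighborSet, edgeGraph_adj hinv]
      constructor
      · rintro ⟨-, ⟨u, i⟩, h1, h2⟩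
        simp only at h1
        subst h1
        exact ⟨i, trivial, h2⟩
      · rintro ⟨i, -, rfl⟩
        exact ⟨(hsim.1 ⟨v, i⟩ (hσ _).1).symm, ⟨v, i⟩, rfl, rfl⟩
    rw [this, Set.ncard_image_of_injective, Set.ncard_univ, Nat.card_eq_fintype_card, Fintype.card_fin]
    intro i j e
    have := hsim.2 ⟨v, i⟩ ⟨v, j⟩ (hσ _).1 (hσ _).1 rfl e
    simpa using this

/-- The number of connected simple graphs in terms of the pairing model. -/
theorem numConnectedSimple_eq (hd : Even (totalDegree d)) :
    (numConnectedSimple d : ℝ) = ((totalDegree d - 1)‼ : ℕ) / (∏ v, ((d v)! : ℝ)) *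
      pr univ (SimpleConnected d) := by
  have h := numConnectedSimple_mul (d := d)
  have hp : (0 : ℝ) < ∏ v, ((d v)! : ℝ) := prod_pos fun v _ => by positivity
  have hM : (0 : ℝ) < matchingCount (totalDegree d) := by exact_mod_cast matchingCount_pos _
  rw [pr_def, card_pairings (by rw [card_halfEdge]; exact hd), card_halfEdge, ← h]
  change _ = (matchingCount (totalDegree d) : ℝ) / _ * _
  push_cast
  field_simp

end Graphs

end ConfigModel

namespace ConfigModel

/-! ### Vanishing of the error terms -/

section ErrorLimits

variable {L q : ℕ → ℝ} {ν : ℝ}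

theorem tendsto_div_sub (hL : Tendsto L atTop atTop) (h : Tendsto (fun n => q n / L n) atTop (𝓝 ν))
    (c : ℝ) : Tendsto (fun n => q n / (L n - c)) atTop (𝓝 ν) := by
  have h0 : Tendsto (fun n => 1 - c / L n) atTop (𝓝 (1 - 0)) :=
    tendsto_const_nhds.sub (tendsto_const_nhds.div_atTop hL)
  rw [sub_zero] at h0
  have h1 := h.div h0 one_ne_zero
  rw [div_one] at h1
  refine h1.congr' ?_
  filter_upwards [hL.eventually_gt_atTop 0] with n hn
  simp only [Pi.div_apply]
  rw [one_sub_div hn.ne', div_div_div_cancel_right₀ hn.ne']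

theorem tendsto_one_div_sub (hL : Tendsto L atTop atTop) (c : ℝ) :
    Tendsto (fun n => 1 / (L n - c)) atTop (𝓝 0) :=
  tendsto_const_nhds.div_atTop (tendsto_atTop_add_const_right _ (-c) hL)

theorem tendsto_clashBound (hL : Tendsto L atTop atTop)
    (h : Tendsto (fun n => q n / L n) atTop (𝓝 ν)) :
    Tendsto (fun n => clashBound (L n) (q n)) atTop (𝓝 0) := by
  have i1 := tendsto_one_div_sub hL 1
  have i3 := tendsto_one_div_sub hL 3
  have i5 := tendsto_one_div_sub hL 5
  have q1 := tendsto_div_sub hL h 1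
  have q3 := tendsto_div_sub hL h 3
  have := (i1.add (q1.mul i3)).add ((q1.mul q3).mul i5)
  simp only [mul_zero, add_zero] at this
  refine this.congr fun n => ?_
  unfold clashBound
  simp only [div_mul_div_comm, mul_one, sq]

theorem tendsto_sieveError (hL : Tendsto L atTop atTop)
    (h : Tendsto (fun n => q n / L n) atTop (𝓝 ν)) :
    Tendsto (fun n => sieveError (L n) (q n)) atTop (𝓝 0) := by
  have h2 : Tendsto (fun n => L n - 2) atTop atTop := tendsto_atTop_add_const_right _ (-2) hL
  have := (tendsto_clashBound hL h).add (tendsto_clashBound h2 (tendsto_div_sub hL h 2))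
  rw [add_zero] at this
  exact this

theorem tendsto_conflictBound {Δ : ℕ → ℝ} (hL : Tendsto L atTop atTop)
    (h : Tendsto (fun n => q n / L n) atTop (𝓝 ν))
    (hΔ : Tendsto (fun n => Δ n / L n) atTop (𝓝 0)) :
    Tendsto (fun n => conflictBound (L n) (Δ n) (q n)) atTop (𝓝 0) := by
  have d1 := tendsto_div_sub hL hΔ 1
  have q3 := tendsto_div_sub hL h 3
  have := ((d1.const_mul 2).add ((d1.mul q3).const_mul 4)).const_mul 4
  simp only [mul_zero, zero_mul, add_zero] at this
  refine this.congr fun n => ?_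
  unfold conflictBound
  simp only [div_mul_div_comm, mul_div_assoc]

theorem tendsto_first_moment (hL : Tendsto L atTop atTop)
    (h : Tendsto (fun n => q n / L n) atTop (𝓝 ν)) :
    Tendsto (fun n => q n / (2 * (L n - 1)) + q n ^ 2 / (4 * ((L n - 1) * (L n - 3)))) atTop
      (𝓝 (ν / 2 + ν ^ 2 / 4)) := by
  have q1 := tendsto_div_sub hL h 1
  have q3 := tendsto_div_sub hL h 3
  have := (q1.div_const 2).add ((q1.mul q3).div_const 4)
  rw [← sq] at this
  refine this.congr fun n => ?_
  rw [div_mul_div_comm, div_div, div_div, sq, mul_comm (L n - 1) 2, mul_comm 4]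

/-- The lower bound `L n / 2` for the number of remaining points is convenient: removing a closed
set of fixed type eventually leaves at least half of them. -/
theorem tendsto_removalError {m k : ℕ → ℕ} {κ : ℝ} (hL : Tendsto L atTop atTop)
    (h : Tendsto (fun n => q n / L n) atTop (𝓝 ν))
    (hk : Tendsto (fun n => (k n : ℝ) ^ 2 / m n) atTop (𝓝 κ))
    (hm : Tendsto (fun n => √(L n) / m n) atTop (𝓝 0)) :
    Tendsto (fun n => removalError (L n / 2) (L n) (q n) (k n) (m n)) atTop (𝓝 0) := by
  have h2 : Tendsto (fun n => L n / 2) atTop atTop := hL.atTop_div_const (by norm_num)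
  have hq : Tendsto (fun n => q n / (L n / 2)) atTop (𝓝 (ν * 2)) := by
    refine (h.mul_const 2).congr fun n => ?_
    rw [div_div_eq_mul_div, div_mul_eq_mul_div]
  have hexp := (Real.continuous_exp.tendsto κ).comp hk
  have := (tendsto_clashBound h2 hq).add ((hm.mul hexp).const_mul 8)
  simp only [zero_mul, mul_zero, add_zero] at this
  refine this.congr fun n => ?_
  unfold removalError
  simp only [Function.comp_apply]
  ring

theorem tendsto_split {m k : ℕ → ℕ} {κ : ℝ} (hmt : Tendsto (fun n => (m n : ℝ)) atTop atTop)
    (hk : Tendsto (fun n => (k n : ℝ) ^ 2 / m n) atTop (𝓝 κ))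
    (hm : Tendsto (fun n => √(L n) / m n) atTop (𝓝 0)) :
    Tendsto (fun n => 4 * √(L n) * (((m n : ℝ) + 1) *
      (Real.exp ((k n : ℝ) ^ 2 / m n) * (32 / (m n : ℝ) ^ 2)))) atTop (𝓝 0) := by
  have hexp := (Real.continuous_exp.tendsto κ).comp hk
  have h1 : Tendsto (fun n => 1 + 1 / (m n : ℝ)) atTop (𝓝 (1 + 0)) :=
    tendsto_const_nhds.add (tendsto_const_nhds.div_atTop hmt)
  have := ((hm.mul hexp).mul h1).const_mul 128
  simp only [zero_mul, mul_zero] at this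
  refine this.congr' ?_
  filter_upwards [hmt.eventually_gt_atTop 0] with n hn
  simp only [Function.comp_apply]
  field_simp
  ring

end ErrorLimits

/-! ### Statistics of a degree sequence -/

section DegreeSequences

open Finset
open scoped Classical

variable {n : ℕ} (d : Fin n → ℕ)

/-- The number of ordered pairs of half-edges at the same vertex. -/
noncomputable def siblingCount : ℕ := (siblings Sigma.fst (univ : Finset (HalfEdge d))).card

/-- The vertices of degree one or two. -/
def lowVertices : Finset (Fin n) := univ.filter fun v => d v = 1 ∨ d v = 2

theorem siblingCount_eq : siblingCount d = ∑ v, d v * (d v - 1) := by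
  rw [siblingCount, card_siblings]
  simp only [card_fiber_sigma]

theorem meanDegree_id : meanDegree d (fun k => (k : ℝ)) = totalDegree d / n := by
  simp [meanDegree, totalDegree]

theorem nuParam_eq : nuParam d = siblingCount d / totalDegree d := by
  rw [nuParam, meanDegree_id, siblingCount_eq, meanDegree]
  have h1 : ∑ v, (d v : ℝ) * ((d v : ℝ) - 1) = ((∑ v, d v * (d v - 1) : ℕ) : ℝ) := by
    push_cast
    refine sum_congr rfl fun v _ => ?_
    rcases Nat.eq_zero_or_pos (d v) with h | h
    · simp [h]
    · rw [Nat.cast_sub h, Nat.cast_one]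
  rw [h1]
  rcases Nat.eq_zero_or_pos n with h | h
  · subst h; simp [totalDegree]
  · have : (n : ℝ) ≠ 0 := by positivity
    rw [div_div_div_cancel_right₀ this]

/-- For natural `k` one has `k ^ 2 ≤ 2 * k * (k - 1) + 1`. A bounded `ν_n` therefore keeps the
maximal degree of the order of the square root of the total degree, without a separate assumption.
-/
theorem maxDegree_sq_le : maxDegree d ^ 2 ≤ 2 * siblingCount d + 1 := by
  rw [siblingCount_eq]
  have h : ∀ v, d v ^ 2 ≤ 2 * (∑ v, d v * (d v - 1)) + 1 := by
    intro v
    have h1 : d v * (d v - 1) ≤ ∑ v, d v * (d v - 1) :=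
      single_le_sum (f := fun v => d v * (d v - 1)) (fun _ _ => Nat.zero_le _) (mem_univ v)
    have h2 : d v ^ 2 ≤ 2 * (d v * (d v - 1)) + 1 := by
      rcases d v with _ | k
      · simp
      · rw [Nat.add_sub_cancel]; nlinarith [Nat.le_mul_self k]
    omega
  rcases (univ : Finset (Fin n)).eq_empty_or_nonempty with he | hne
  · rw [maxDegree, he]; simp
  · obtain ⟨v, -, hv⟩ := exists_mem_eq_sup univ hne d
    rw [maxDegree, hv]
    exact h v

theorem fiber_le_maxDegree (v : Fin n) :
    (fiber Sigma.fst (univ : Finset (HalfEdge d)) v).card ≤ maxDegree d := by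
  rw [card_fiber_sigma]
  exact le_sup (mem_univ v)

theorem card_low_one : ((lowVertices d).filter fun v =>
    (fiber Sigma.fst (univ : Finset (HalfEdge d)) v).card = 1).card = numDegree d 1 := by
  rw [numDegree, lowVertices, filter_filter]
  congr 1
  ext v
  simp only [mem_filter, card_fiber_sigma]
  grind

theorem card_low_two : ((lowVertices d).filter fun v =>
    (fiber Sigma.fst (univ : Finset (HalfEdge d)) v).card = 2).card = numDegree d 2 := by
  rw [numDegree, lowVertices, filter_filter]
  congr 1
  ext v
  simp only [mem_filter, card_fiber_sigma]
  grind

theorem card_low : (lowVertices d).card = numDegree d 1 + numDegree d 2 := by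
  rw [lowVertices, filter_or, card_union_of_disjoint]
  · simp only [numDegree]
  · rw [disjoint_left]; intro v h1 h2; simp only [mem_filter] at h1 h2; omega

theorem card_low_add_card_compl :
    numDegree d 1 + numDegree d 2 + (lowVertices d)ᶜ.card = n := by
  rw [← card_low, card_add_card_compl, Fintype.card_fin]

variable {d}

theorem degree_pos (h0 : numDegree d 0 = 0) (v : Fin n) : 0 < d v := by
  rw [numDegree, card_eq_zero, filter_eq_empty_iff] at h0
  exact Nat.pos_of_ne_zero (h0 (mem_univ v))

theorem three_le_degree (h0 : numDegree d 0 = 0) {v : Fin n} (hv : v ∉ lowVertices d) : 3 ≤ d v := by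
  have := degree_pos h0 v
  simp only [lowVertices, mem_filter, mem_univ, true_and] at hv
  omega

theorem totalDegree_ge (h0 : numDegree d 0 = 0) :
    numDegree d 1 + 2 * numDegree d 2 + 3 * (lowVertices d)ᶜ.card ≤ totalDegree d := by
  have h1 : totalDegree d = ∑ v ∈ lowVertices d, d v + ∑ v ∈ (lowVertices d)ᶜ, d v :=
    (sum_add_sum_compl _ _).symm
  have h2 : 3 * (lowVertices d)ᶜ.card ≤ ∑ v ∈ (lowVertices d)ᶜ, d v := by
    rw [mul_comm, ← smul_eq_mul]
    exact card_nsmul_le_sum _ _ _ fun v hv => three_le_degree h0 (mem_compl.1 hv)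
  have h3 : numDegree d 1 + 2 * numDegree d 2 ≤ ∑ v ∈ lowVertices d, d v := by
    rw [← card_low_one d, ← card_low_two d, card_filter, card_filter, mul_sum, ← sum_add_distrib]
    refine sum_le_sum fun v _ => ?_
    rw [card_fiber_sigma]
    split_ifs <;> omega
  omega

theorem card_compl_le (h0 : numDegree d 0 = 0) : (lowVertices d)ᶜ.card ≤
    ((univ : Finset (HalfEdge d)) \ above Sigma.fst univ (lowVertices d)).card := by
  have h : ∑ _v ∈ (lowVertices d)ᶜ, 1 ≤ ∑ v ∈ (lowVertices d)ᶜ,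
      (fiber Sigma.fst (univ : Finset (HalfEdge d)) v).card :=
    sum_le_sum fun v _ => by rw [card_fiber_sigma]; exact degree_pos h0 v
  rw [card_sdiff_above, card_eq_sum_ones]
  convert h

theorem low_degree {w : Fin n} (hw : w ∈ lowVertices d) :
    (fiber Sigma.fst (univ : Finset (HalfEdge d)) w).card = 1 ∨
      (fiber Sigma.fst (univ : Finset (HalfEdge d)) w).card = 2 := by
  rw [card_fiber_sigma]
  simpa [lowVertices] using hw

/-- Bound for the influence of a closed set of type `p` on the probability of a good matching. -/
noncomputable def typeError (d : Fin n → ℕ) (m : ℕ) (p : ℕ × ℕ) : ℝ :=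
  -- The value one is the trivial bound for a difference of probabilities. It covers the finitely
  -- many `n` at which, for a fixed type, the removal estimate is not available, and together with
  -- the minimum it keeps the error at most one for dominated convergence.
  if 6 ≤ (totalDegree d : ℝ) / 2 ∧ 0 < m ∧
      (2 * (p.1 + p.2 : ℕ) : ℝ) ≤ (totalDegree d : ℝ) / 2 then
    min 1 ((2 * p.1 + p.2 : ℕ) *
      removalError ((totalDegree d : ℝ) / 2) (totalDegree d) (siblingCount d) (numDegree d 1) m)
  else 1

theorem typeError_mem (m : ℕ) (p : ℕ × ℕ) : 0 ≤ typeError d m p ∧ typeError d m p ≤ 1 := by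
  unfold typeError
  split_ifs with h
  · have := removalError_nonneg (L' := totalDegree d) (q := siblingCount d) (k := numDegree d 1)
      (m := m) h.1 (by positivity)
    exact ⟨le_min zero_le_one (by positivity), min_le_left _ _⟩
  · exact ⟨zero_le_one, le_rfl⟩

theorem abs_pr_good_sub_le_typeError (h0 : numDegree d 0 = 0) (he : Even (totalDegree d)) {m : ℕ}
    (hm : m ≤ (lowVertices d)ᶜ.card) {p : ℕ × ℕ} {R : Finset (Fin n)}
    (hR : R ∈ typeClass Sigma.fst (univ : Finset (HalfEdge d)) (lowVertices d) p) :
    |pr (univ \ above Sigma.fst (univ : Finset (HalfEdge d)) R) (Good Sigma.fst (lowVertices d)) -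
      pr (univ : Finset (HalfEdge d)) (Good Sigma.fst (lowVertices d))| ≤ typeError d m p := by
  have hone : |pr (univ \ above Sigma.fst (univ : Finset (HalfEdge d)) R)
      (Good Sigma.fst (lowVertices d)) -
      pr (univ : Finset (HalfEdge d)) (Good Sigma.fst (lowVertices d))| ≤ 1 := by
    have a1 := pr_nonneg (univ \ above Sigma.fst (univ : Finset (HalfEdge d)) R)
      (Good Sigma.fst (lowVertices d))
    have a2 := pr_le_one (univ \ above Sigma.fst (univ : Finset (HalfEdge d)) R)
      (Good Sigma.fst (lowVertices d))
    have a3 := pr_nonneg (univ : Finset (HalfEdge d)) (Good Sigma.fst (lowVertices d))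
    have a4 := pr_le_one (univ : Finset (HalfEdge d)) (Good Sigma.fst (lowVertices d))
    rw [abs_le]; constructor <;> linarith
  unfold typeError
  split_ifs with h
  swap
  · exact hone
  refine le_min hone ?_
  simp only [typeClass, mem_filter, mem_powerset] at hR
  obtain ⟨hRV, h1, h2⟩ := hR
  have hlow : ∀ w ∈ R, _ := fun w hw => low_degree (hRV hw)
  have hcard := card_above_eq hlow
  rw [h1, h2] at hcard
  have hRcard : R.card = 2 * p.1 + p.2 := by
    rw [← h1, ← h2, ← card_union_of_disjoint, ← filter_or, filter_true_of_mem hlow]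
    rw [disjoint_left]; intro v a b; simp only [mem_filter] at a b; omega
  rw [← hRcard]
  refine abs_pr_good_sdiff_above_sub_le (by rw [card_halfEdge]; exact he) h.1
    (by rw [card_halfEdge]) (by rfl) (fun w hw => low_degree hw) (card_low_one d).le h.2.1
    (hm.trans (card_compl_le h0)) R hRV ?_ ?_
  · rw [h1]; exact even_two_mul _
  · have hle := card_le_card (above_subset (π := Sigma.fst) (S := (univ : Finset (HalfEdge d))) (R := R))
    have h3 := h.2.2
    rw [card_sdiff_of_subset above_subset, Nat.cast_sub hle, hcard, card_halfEdge]
    push_cast at h3 ⊢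
    linarith

end DegreeSequences

end ConfigModel

namespace ConfigModel

/-! ### The critical window: limits and the ratio -/

section Window

open scoped Classical

variable {d : (n : ℕ) → Fin n → ℕ} {ρ₁ p₂ dbar ν : ℝ}

/-- The probability that the pairing is simple. -/
noncomputable def simpleProb (d : (n : ℕ) → Fin n → ℕ) (n : ℕ) : ℝ :=
  pr (Finset.univ : Finset (HalfEdge (d n))) (Simple Sigma.fst)

/-- The probability that the pairing is simple and connected. -/
noncomputable def connProb (d : (n : ℕ) → Fin n → ℕ) (n : ℕ) : ℝ :=
  pr (Finset.univ : Finset (HalfEdge (d n))) (SimpleConnected (d n))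

namespace CriticalWindow

variable (hd : CriticalWindow d ρ₁ p₂ dbar)

include hd

theorem p₂_nonneg : 0 ≤ p₂ :=
  ge_of_tendsto' hd.tendsto_degree_two fun n => by positivity

theorem tendsto_total : Tendsto (fun n : ℕ => (totalDegree (d n) : ℝ) / n) atTop (𝓝 dbar) :=
  hd.tendsto_mean.congr fun n => meanDegree_id (d n)

theorem tendsto_one_div : Tendsto (fun n : ℕ => (numDegree (d n) 1 : ℝ) / n) atTop (𝓝 0) := by
  have hinv : Tendsto (fun n : ℕ => 1 / √(n : ℝ)) atTop (𝓝 0) :=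
    tendsto_const_nhds.div_atTop (Real.tendsto_sqrt_atTop.comp tendsto_natCast_atTop_atTop)
  have := hd.tendsto_degree_one.mul hinv
  rw [mul_zero] at this
  refine this.congr fun n => ?_
  rw [div_mul_div_comm, mul_one, Real.mul_self_sqrt (Nat.cast_nonneg _)]

theorem tendsto_high :
    Tendsto (fun n : ℕ => ((lowVertices (d n))ᶜ.card : ℝ) / n) atTop (𝓝 (1 - p₂)) := by
  have h := (tendsto_const_nhds (x := (1 : ℝ))).sub (hd.tendsto_one_div.add hd.tendsto_degree_two)
  rw [zero_add] at h
  refine h.congr' ?_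
  filter_upwards [eventually_gt_atTop 0] with n hn
  have hn' : (0 : ℝ) < n := by exact_mod_cast hn
  have h1 : (numDegree (d n) 1 : ℝ) + numDegree (d n) 2 + (lowVertices (d n))ᶜ.card = n := by
    exact_mod_cast card_low_add_card_compl (d n)
  rw [eq_div_iff hn'.ne', sub_mul, add_mul, div_mul_cancel₀ _ hn'.ne', div_mul_cancel₀ _ hn'.ne']
  linarith

/-- A positive proportion `1 - p₂` of the vertices has degree at least three, whence `dbar ≥ 2 * p₂
+ 3 * (1 - p₂)`. Thus `y = p₂ / dbar` lies inside the region of convergence of the generating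
function. -/
theorem two_mul_p₂_lt : 2 * p₂ < dbar := by
  have h1 : Tendsto (fun n : ℕ => 2 * ((numDegree (d n) 2 : ℝ) / n) +
      3 * (((lowVertices (d n))ᶜ.card : ℝ) / n)) atTop (𝓝 (2 * p₂ + 3 * (1 - p₂))) :=
    (hd.tendsto_degree_two.const_mul 2).add (hd.tendsto_high.const_mul 3)
  have h2 := le_of_tendsto_of_tendsto' h1 hd.tendsto_total fun n => by
    have h3 : (numDegree (d n) 1 : ℝ) + 2 * numDegree (d n) 2 + 3 * (lowVertices (d n))ᶜ.card ≤
      totalDegree (d n) := by exact_mod_cast totalDegree_ge (hd.no_degree_zero n)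
    have h4 : (0 : ℝ) ≤ numDegree (d n) 1 := Nat.cast_nonneg _
    rw [← mul_div_assoc, ← mul_div_assoc, ← add_div]
    gcongr
    linarith
  linarith [hd.p₂_lt_one]

theorem dbar_pos : 0 < dbar := by linarith [hd.two_mul_p₂_lt, hd.p₂_nonneg]

theorem tendsto_total_atTop : Tendsto (fun n => (totalDegree (d n) : ℝ)) atTop atTop := by
  refine (hd.tendsto_total.pos_mul_atTop hd.dbar_pos tendsto_natCast_atTop_atTop).congr' ?_
  filter_upwards [eventually_gt_atTop 0] with n hn
  field_simp

/-- One is subtracted because `pr_split_le` takes the number of high vertices in the form `m + 1`.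
-/
theorem tendsto_high_pred :
    Tendsto (fun n : ℕ => (((lowVertices (d n))ᶜ.card - 1 : ℕ) : ℝ) / n) atTop (𝓝 (1 - p₂)) := by
  have h0 : Tendsto (fun n : ℕ => (1 : ℝ) / n) atTop (𝓝 0) :=
    tendsto_const_nhds.div_atTop tendsto_natCast_atTop_atTop
  have h1 := hd.tendsto_high.sub h0
  rw [sub_zero] at h1
  refine tendsto_of_tendsto_of_tendsto_of_le_of_le h1 hd.tendsto_high (fun n => ?_) fun n => ?_
  · simp only
    rw [← sub_div]
    gcongr
    rw [sub_le_iff_le_add]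
    exact_mod_cast Nat.le_add_of_sub_le le_rfl
  · simp only
    gcongr
    exact Nat.sub_le _ _

theorem tendsto_high_pred_atTop :
    Tendsto (fun n : ℕ => (((lowVertices (d n))ᶜ.card - 1 : ℕ) : ℝ)) atTop atTop := by
  have hp : 0 < 1 - p₂ := by linarith [hd.p₂_lt_one]
  refine (hd.tendsto_high_pred.pos_mul_atTop hp tendsto_natCast_atTop_atTop).congr' ?_
  filter_upwards [eventually_gt_atTop 0] with n hn
  field_simp

theorem tendsto_one_sq_div :
    Tendsto (fun n : ℕ => (numDegree (d n) 1 : ℝ) ^ 2 / (((lowVertices (d n))ᶜ.card - 1 : ℕ) : ℝ))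
      atTop (𝓝 (ρ₁ ^ 2 / (1 - p₂))) := by
  have hp : 1 - p₂ ≠ 0 := by linarith [hd.p₂_lt_one]
  have h := (hd.tendsto_degree_one.pow 2).div hd.tendsto_high_pred hp
  refine h.congr' ?_
  filter_upwards [eventually_gt_atTop 0] with n hn
  have hn' : (0 : ℝ) < n := by exact_mod_cast hn
  simp only [Pi.div_apply, Pi.pow_apply]
  rw [div_pow, Real.sq_sqrt hn'.le, div_div_div_cancel_right₀ hn'.ne']

theorem tendsto_sqrt_total_div :
    Tendsto (fun n : ℕ => √(totalDegree (d n) : ℝ) / (((lowVertices (d n))ᶜ.card - 1 : ℕ) : ℝ))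
      atTop (𝓝 0) := by
  have hp : 1 - p₂ ≠ 0 := by linarith [hd.p₂_lt_one]
  have hinv : Tendsto (fun n : ℕ => 1 / √(n : ℝ)) atTop (𝓝 0) :=
    tendsto_const_nhds.div_atTop (Real.tendsto_sqrt_atTop.comp tendsto_natCast_atTop_atTop)
  have h := ((hd.tendsto_total.sqrt).mul hinv).div hd.tendsto_high_pred hp
  rw [mul_zero, zero_div] at h
  refine h.congr' ?_
  filter_upwards [eventually_gt_atTop 0] with n hn
  have hn' : (0 : ℝ) < n := by exact_mod_cast hn
  have hs : √(n : ℝ) ≠ 0 := (Real.sqrt_pos.2 hn').ne'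
  have hs2 : √(n : ℝ) * √(n : ℝ) = n := Real.mul_self_sqrt hn'.le
  simp only [Pi.div_apply]
  rw [Real.sqrt_div (Nat.cast_nonneg _), div_mul_div_comm, mul_one, hs2,
    div_div_div_cancel_right₀ hn'.ne']

/-- The two events differ only if a closed set separates two high vertices. With total degree and
number of high vertices both of order `n`, the bound of `pr_split_le` has order `n ^ (-1/2)`. -/
theorem tendsto_conn_sub_good :
    Tendsto (fun n => connProb d n - pr (Finset.univ : Finset (HalfEdge (d n)))
      (Good Sigma.fst (lowVertices (d n)))) atTop (𝓝 0) := by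
  refine squeeze_zero_norm' ?_ (tendsto_split hd.tendsto_high_pred_atTop hd.tendsto_one_sq_div
    hd.tendsto_sqrt_total_div)
  filter_upwards [hd.tendsto_high_pred_atTop.eventually_ge_atTop 1,
    hd.tendsto_total_atTop.eventually_ge_atTop 1] with n hm hl
  have hm' : 1 ≤ (lowVertices (d n))ᶜ.card - 1 := by exact_mod_cast hm
  have hl' : 1 ≤ totalDegree (d n) := by exact_mod_cast hl
  have hV : ∃ w, w ∉ lowVertices (d n) := by
    obtain ⟨w, hw⟩ := Finset.card_pos.1 (by omega : 0 < (lowVertices (d n))ᶜ.card)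
    exact ⟨w, Finset.mem_compl.1 hw⟩
  have hm2 : (lowVertices (d n))ᶜ.card = (lowVertices (d n))ᶜ.card - 1 + 1 := by omega
  have h0 := hd.no_degree_zero n
  rw [Real.norm_eq_abs]
  refine (abs_pr_simpleConnected_sub_le hV (degree_pos h0)).trans ?_
  have := pr_split_le (π := Sigma.fst) (S := (Finset.univ : Finset (HalfEdge (d n))))
    (V₀ := lowVertices (d n)) (by rw [card_halfEdge]; exact hd.even_total n)
    (by rw [card_halfEdge]; exact hl') (fun w hw => low_degree hw)
    (fun w hw => by rw [card_fiber_sigma]; exact three_le_degree h0 hw) (card_low_one (d n)).le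
    (m := (lowVertices (d n))ᶜ.card - 1) (by omega) (by convert hm2)
  rw [card_halfEdge] at this
  exact this

/-- The weight of the closed sets of vertices of degree at most two. -/
noncomputable def limitWeight (ρ₁ p₂ dbar : ℝ) : ℝ :=
  (1 - 2 * (p₂ / dbar)) ^ (-(1 / 2) : ℝ) *
    Real.exp (ρ₁ ^ 2 / dbar / (2 * (1 - 2 * (p₂ / dbar))) - (p₂ / dbar + (p₂ / dbar) ^ 2))

theorem limitWeight_inv : (limitWeight ρ₁ p₂ dbar)⁻¹ = ((dbar - 2 * p₂) / dbar) ^ (1 / 2 : ℝ) *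
    Real.exp (-(ρ₁ ^ 2 / (2 * (dbar - 2 * p₂))) + (p₂ ^ 2 + dbar * p₂) / dbar ^ 2) := by
  have h1 := hd.dbar_pos
  have h2 : 0 < dbar - 2 * p₂ := by linarith [hd.two_mul_p₂_lt]
  have e : 1 - 2 * (p₂ / dbar) = (dbar - 2 * p₂) / dbar := by field_simp
  have h3 : 0 < (dbar - 2 * p₂) / dbar := by positivity
  unfold limitWeight
  rw [mul_inv, ← Real.exp_neg, e, ← Real.rpow_neg h3.le, neg_neg]
  congr 2
  field_simp
  ring

theorem limitWeight_pos : 0 < limitWeight ρ₁ p₂ dbar := by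
  have h1 := hd.dbar_pos
  have h2 : 0 < dbar - 2 * p₂ := by linarith [hd.two_mul_p₂_lt]
  have e : 1 - 2 * (p₂ / dbar) = (dbar - 2 * p₂) / dbar := by field_simp
  have h3 : 0 < (dbar - 2 * p₂) / dbar := by positivity
  unfold limitWeight
  rw [e]
  exact mul_pos (Real.rpow_pos_of_pos h3 _) (Real.exp_pos _)

variable (hν : Tendsto (fun n => nuParam (d n)) atTop (𝓝 ν))

include hν

theorem tendsto_siblingCount :
    Tendsto (fun n => (siblingCount (d n) : ℝ) / totalDegree (d n)) atTop (𝓝 ν) :=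
  hν.congr fun n => nuParam_eq (d n)

theorem tendsto_typeError (p : ℕ × ℕ) :
    Tendsto (fun n => typeError (d n) ((lowVertices (d n))ᶜ.card - 1) p) atTop (𝓝 0) := by
  have h := (tendsto_removalError hd.tendsto_total_atTop (tendsto_siblingCount hd hν)
    hd.tendsto_one_sq_div hd.tendsto_sqrt_total_div).const_mul ((2 * p.1 + p.2 : ℕ) : ℝ)
  rw [mul_zero] at h
  refine squeeze_zero' (Eventually.of_forall fun n => (typeError_mem _ p).1) ?_ h
  have hhalf : Tendsto (fun n => (totalDegree (d n) : ℝ) / 2) atTop atTop :=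
    hd.tendsto_total_atTop.atTop_div_const (by norm_num)
  filter_upwards [hd.tendsto_high_pred_atTop.eventually_ge_atTop 1,
    hhalf.eventually_ge_atTop 6, hhalf.eventually_ge_atTop (2 * (p.1 + p.2 : ℕ))] with n h1 h2 h3
  have h1' : 1 ≤ (lowVertices (d n))ᶜ.card - 1 := by exact_mod_cast h1
  unfold typeError
  rw [if_pos ⟨h2, h1', h3⟩]
  exact min_le_right _ _

/-- The decomposition gives P(simple) as the total closed weight times P(good), up to a weighted sum
of errors that vanishes by dominated convergence. The total weight tends to `limitWeight`, and
P(good) may be replaced by the probability of being simple and connected. -/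
theorem tendsto_simple_sub_conn :
    Tendsto (fun n => simpleProb d n - limitWeight ρ₁ p₂ dbar * connProb d n) atTop (𝓝 0) := by
  have hLar : ∀ᶠ n in atTop, numDegree (d n) 1 + 2 * numDegree (d n) 2 + 2 ≤ totalDegree (d n) := by
    filter_upwards [hd.tendsto_high_pred_atTop.eventually_ge_atTop 1] with n h1
    have h1' : 1 ≤ (lowVertices (d n))ᶜ.card - 1 := by exact_mod_cast h1
    have := totalDegree_ge (hd.no_degree_zero n)
    omega
  have hW := tendsto_tsum_closedWeight hd.dbar_pos hd.p₂_nonneg hd.two_mul_p₂_lt hd.even_total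
    hd.tendsto_total hd.tendsto_degree_one hd.tendsto_degree_two hLar (e := fun _ _ => 1) (e' := 1)
    (fun _ _ => ⟨zero_le_one, le_rfl⟩) (fun _ => tendsto_const_nhds)
  have hE := tendsto_tsum_closedWeight hd.dbar_pos hd.p₂_nonneg hd.two_mul_p₂_lt hd.even_total
    hd.tendsto_total hd.tendsto_degree_one hd.tendsto_degree_two hLar
    (e := fun n p => typeError (d n) ((lowVertices (d n))ᶜ.card - 1) p) (e' := 0)
    (fun n p => typeError_mem _ p) (tendsto_typeError hd hν)
  simp only [mul_one] at hW
  rw [mul_zero] at hE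
  change Tendsto _ _ (𝓝 (limitWeight ρ₁ p₂ dbar)) at hW
  set a : ℕ → ℝ := fun n => pr (Finset.univ : Finset (HalfEdge (d n)))
    (Good Sigma.fst (lowVertices (d n))) with ha
  set W : ℕ → ℝ := fun n => ∑' p, closedWeight (totalDegree (d n)) (numDegree (d n) 1)
    (numDegree (d n) 2) p with hWdef
  have h1 : Tendsto (fun n => simpleProb d n - W n * a n) atTop (𝓝 0) := by
    refine squeeze_zero_norm (fun n => ?_) hE
    rw [Real.norm_eq_abs]
    have := abs_pr_simple_sub_le (π := Sigma.fst) (S := (Finset.univ : Finset (HalfEdge (d n))))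
      (V₀ := lowVertices (d n)) (by rw [card_halfEdge]; exact hd.even_total n)
      (fun w hw => low_degree hw) (card_low_one (d n)) (card_low_two (d n))
      (typeError (d n) ((lowVertices (d n))ᶜ.card - 1)) (fun p R hR =>
        abs_pr_good_sub_le_typeError (hd.no_degree_zero n) (hd.even_total n) (Nat.sub_le _ _) hR)
    rw [card_halfEdge] at this
    exact this
  have h2 : Tendsto (fun n => (W n - limitWeight ρ₁ p₂ dbar) * a n) atTop (𝓝 0) := by
    have h3 : Tendsto (fun n => W n - limitWeight ρ₁ p₂ dbar) atTop (𝓝 0) := by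
      simpa using hW.sub_const (limitWeight ρ₁ p₂ dbar)
    refine squeeze_zero_norm (fun n => ?_) (tendsto_zero_iff_norm_tendsto_zero.1 h3)
    rw [norm_mul]
    refine mul_le_of_le_one_right (norm_nonneg _) ?_
    rw [Real.norm_of_nonneg (pr_nonneg _ _)]
    exact pr_le_one _ _
  have h4 := (h1.add h2).sub (hd.tendsto_conn_sub_good.const_mul (limitWeight ρ₁ p₂ dbar))
  simp only [add_zero, mul_zero, sub_zero] at h4
  refine h4.congr fun n => ?_
  simp only [ha]
  ring

theorem tendsto_maxDegree_div :
    Tendsto (fun n => (maxDegree (d n) : ℝ) / totalDegree (d n)) atTop (𝓝 0) := by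
  have hL := hd.tendsto_total_atTop
  have h0 : Tendsto (fun n => (1 : ℝ) / totalDegree (d n)) atTop (𝓝 0) :=
    tendsto_const_nhds.div_atTop hL
  have h1 := ((((tendsto_siblingCount hd hν).const_mul 2).add h0).mul h0).sqrt
  rw [mul_zero, Real.sqrt_zero] at h1
  refine squeeze_zero (fun n => by positivity) (fun n => ?_) h1
  refine Real.le_sqrt_of_sq_le ?_
  have h2 : (maxDegree (d n) : ℝ) ^ 2 ≤ 2 * siblingCount (d n) + 1 := by
    exact_mod_cast maxDegree_sq_le (d n)
  rw [← mul_div_assoc (2 : ℝ), ← add_div, div_mul_div_comm, mul_one, div_pow, sq (totalDegree (d n) : ℝ)]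
  gcongr

/-- Separated from the full limit because it needs no hypothesis on the maximal degree: `ν_n`
bounded already makes the conflicts negligible. -/
theorem exists_tendsto_le_simpleProb : ∃ f : ℕ → ℝ,
    Tendsto f atTop (𝓝 (Real.exp (-(ν / 2 + ν ^ 2 / 4)))) ∧ ∀ᶠ n in atTop, f n ≤ simpleProb d n := by
  have hL := hd.tendsto_total_atTop
  have hq := tendsto_siblingCount hd hν
  set δ : ℕ → ℝ := fun n => conflictBound (totalDegree (d n)) (maxDegree (d n)) (siblingCount (d n))
    with hδdef
  have hδ : Tendsto δ atTop (𝓝 0) := tendsto_conflictBound hL hq (tendsto_maxDegree_div hd hν)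
  have h1 : Tendsto (fun n => 1 + 4 * δ n) atTop (𝓝 1) := by
    simpa using (hδ.const_mul 4).const_add 1
  have h2 : Tendsto (fun n => 1 - (1 + 4 * δ n) * (1 / ((totalDegree (d n) : ℝ) - 1))) atTop (𝓝 1) := by
    simpa using (h1.mul (tendsto_one_div_sub hL 1)).const_sub 1
  have h3 := ((h1.div h2 one_ne_zero).mul (tendsto_first_moment hL hq)).neg.rexp
  rw [div_one, one_mul] at h3
  refine ⟨_, h3, ?_⟩
  filter_upwards [hL.eventually_ge_atTop 8, hδ.eventually_le_const (show (0 : ℝ) < 1 / 4 by norm_num)]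
    with n h8 hδn
  have h8' : 8 ≤ totalDegree (d n) := by exact_mod_cast h8
  have := pr_simple_ge (π := Sigma.fst) (S := (Finset.univ : Finset (HalfEdge (d n))))
    (by rw [card_halfEdge]; exact hd.even_total n) (by rw [card_halfEdge]; exact h8')
    (fiber_le_maxDegree (d n)) (δ := δ n) (by rw [card_halfEdge]; exact le_rfl) hδn
  rw [card_halfEdge] at this
  exact this

/-- The preceding difference may be divided by P(simple), which eventually exceeds half the limit of
its lower bound. Convergence of P(simple) itself is not required. -/
theorem tendsto_ratio :
    Tendsto (fun n => connProb d n / simpleProb d n) atTop (𝓝 (limitWeight ρ₁ p₂ dbar)⁻¹) := by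
  have hW := hd.limitWeight_pos
  obtain ⟨f, hf, hfP⟩ := exists_tendsto_le_simpleProb hd hν
  set c := Real.exp (-(ν / 2 + ν ^ 2 / 4)) / 2 with hc
  have hc0 : 0 < c := by positivity
  have hP : ∀ᶠ n in atTop, c ≤ simpleProb d n := by
    filter_upwards [hfP, hf.eventually_const_le (show c < Real.exp (-(ν / 2 + ν ^ 2 / 4)) by
      rw [hc]; linarith [Real.exp_pos (-(ν / 2 + ν ^ 2 / 4))])] with n h1 h2
    exact h2.trans h1
  have h := tendsto_simple_sub_conn hd hν
  have h1 : Tendsto (fun n => (simpleProb d n - limitWeight ρ₁ p₂ dbar * connProb d n) /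
      simpleProb d n) atTop (𝓝 0) := by
    have h2 := (tendsto_zero_iff_norm_tendsto_zero.1 h).div_const c
    rw [zero_div] at h2
    refine squeeze_zero_norm' ?_ h2
    filter_upwards [hP] with n hn
    rw [norm_div, Real.norm_of_nonneg (hc0.le.trans hn)]
    gcongr
  have h2 := (h1.const_sub 1).const_mul (limitWeight ρ₁ p₂ dbar)⁻¹
  rw [sub_zero, mul_one] at h2
  refine h2.congr' ?_
  filter_upwards [hP] with n hn
  have : simpleProb d n ≠ 0 := (hc0.trans_le hn).ne'
  have := hW.ne'
  field_simp
  ring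

/-- In the upper bound the maximal degree enters only through its square divided by the total
degree, which tends to zero under `hΔ`; the lower bound is already available. -/
theorem tendsto_simpleProb
    (hΔ : Tendsto (fun n : ℕ => (maxDegree (d n) : ℝ) / √(n : ℝ)) atTop (𝓝 0)) :
    Tendsto (simpleProb d) atTop (𝓝 (Real.exp (-(ν / 2 + ν ^ 2 / 4)))) := by
  have hL := hd.tendsto_total_atTop
  have hq := tendsto_siblingCount hd hν
  obtain ⟨f, hf, hfP⟩ := exists_tendsto_le_simpleProb hd hν
  have hΔ2 : Tendsto (fun n => (maxDegree (d n) : ℝ) ^ 2 / totalDegree (d n)) atTop (𝓝 0) := by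
    have h := (hΔ.pow 2).div hd.tendsto_total hd.dbar_pos.ne'
    rw [zero_pow two_ne_zero, zero_div] at h
    refine h.congr' ?_
    filter_upwards [eventually_gt_atTop 0] with n hn
    have hn' : (0 : ℝ) < n := by exact_mod_cast hn
    simp only [Pi.div_apply, Pi.pow_apply]
    rw [div_pow, Real.sq_sqrt hn'.le, div_div_div_cancel_right₀ hn'.ne']
  have q1 := tendsto_div_sub hL hq 1
  have q3 := tendsto_div_sub hL hq 3
  have d3 := tendsto_div_sub hL hΔ2 3
  have d5 := tendsto_div_sub hL hΔ2 5
  have hfm := tendsto_first_moment hL hq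
  have hmain : Tendsto (fun n => (siblingCount (d n) : ℝ) / (2 * ((totalDegree (d n) : ℝ) - 1)) +
      ((siblingCount (d n) : ℝ) ^ 2 - siblingCount (d n) * (maxDegree (d n) : ℝ) ^ 2) /
        (4 * (((totalDegree (d n) : ℝ) - 1) * ((totalDegree (d n) : ℝ) - 3)))) atTop
      (𝓝 (ν / 2 + ν ^ 2 / 4)) := by
    have h := hfm.sub ((q1.mul d3).div_const 4)
    rw [mul_zero, zero_div, sub_zero] at h
    refine h.congr fun n => ?_
    rw [sub_div, ← add_sub_assoc, div_mul_div_comm, div_div, mul_comm 4]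
  have herr := (hfm.mul (tendsto_sieveError hL hq)).add ((q1.mul q3).mul d5)
  rw [mul_zero, mul_zero, add_zero] at herr
  have hup := hmain.neg.rexp.add herr
  rw [add_zero] at hup
  refine tendsto_of_tendsto_of_tendsto_of_le_of_le' hf hup hfP ?_
  filter_upwards [hL.eventually_ge_atTop 8] with n h8
  have h8' : 8 ≤ totalDegree (d n) := by exact_mod_cast h8
  have := pr_simple_le (π := Sigma.fst) (S := (Finset.univ : Finset (HalfEdge (d n))))
    (by rw [card_halfEdge]; exact hd.even_total n) (by rw [card_halfEdge]; exact h8')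
    (fiber_le_maxDegree (d n))
  rw [card_halfEdge] at this
  refine this.trans (le_of_eq ?_)
  congr 2
  rw [div_mul_div_comm, div_mul_div_comm, ← sq, mul_div_assoc]
  rfl

end CriticalWindow

end Window

end ConfigModel

theorem mainTheorem2 (d : (n : ℕ) → Fin n → ℕ) (ρ₁ p₂ dbar ν : ℝ)
    (hcrit : ConfigModel.CriticalWindow d ρ₁ p₂ dbar)
    (hν : Tendsto (fun n => ConfigModel.nuParam (d n)) atTop (𝓝 ν)) :
    Tendsto
      (fun n => (((ConfigModel.law (d n))[ConfigModel.connectedEvent (d n) |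
        ConfigModel.simpleEvent (d n)]).toReal : ℝ)) atTop
      (𝓝 (((dbar - 2 * p₂) / dbar) ^ (1 / 2 : ℝ) *
        Real.exp (-(ρ₁ ^ 2 / (2 * (dbar - 2 * p₂))) + (p₂ ^ 2 + dbar * p₂) / dbar ^ 2))) ∧
    (Tendsto (fun n : ℕ => (ConfigModel.maxDegree (d n) : ℝ) / Real.sqrt (n : ℝ)) atTop (𝓝 0) →
      (fun n => (ConfigModel.numConnectedSimple (d n) : ℝ)) ~[atTop]
        (fun n => (((ConfigModel.totalDegree (d n) - 1)‼ : ℕ) : ℝ) / (∏ v, ((d n v)! : ℝ)) *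
          ((dbar - 2 * p₂) / dbar) ^ (1 / 2 : ℝ) *
          Real.exp (-(ν / 2) - ν ^ 2 / 4 - ρ₁ ^ 2 / (2 * (dbar - 2 * p₂)) +
            (p₂ ^ 2 + dbar * p₂) / dbar ^ 2))) := by
  have hratio := hcrit.tendsto_ratio hν
  have hinv := hcrit.limitWeight_inv
  refine ⟨?_, fun hΔ => ?_⟩
  · rw [← hinv]
    exact hratio.congr fun n => ConfigModel.cond_toReal.symm
  · have hP := hcrit.tendsto_simpleProb hν hΔ
    have hpos := Real.exp_pos (-(ν / 2 + ν ^ 2 / 4))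
    have hC : Tendsto (ConfigModel.connProb d) atTop
        (𝓝 ((ConfigModel.CriticalWindow.limitWeight ρ₁ p₂ dbar)⁻¹ *
          Real.exp (-(ν / 2 + ν ^ 2 / 4)))) := by
      refine (hratio.mul hP).congr' ?_
      filter_upwards [hP.eventually_const_lt hpos] with n hn
      rw [div_mul_cancel₀ _ hn.ne']
    have hne : (ConfigModel.CriticalWindow.limitWeight ρ₁ p₂ dbar)⁻¹ *
        Real.exp (-(ν / 2 + ν ^ 2 / 4)) ≠ 0 :=
      mul_ne_zero (inv_ne_zero hcrit.limitWeight_pos.ne') hpos.ne'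
    have hequiv := (Asymptotics.isEquivalent_const_iff_tendsto hne).2 hC
    -- The number of graphs is the number of all pairings, divided by `∏ v, (d v)!`, times the
    -- probability of being simple and connected, and that probability has a non-zero limit.
    have h := (Asymptotics.IsEquivalent.refl (u := fun n =>
      (((ConfigModel.totalDegree (d n) - 1)‼ : ℕ) : ℝ) / (∏ v, ((d n v)! : ℝ))) (l := atTop)).mul
        hequiv
    refine (h.congr_left ?_).congr_right ?_
    · exact Eventually.of_forall fun n =>
        (ConfigModel.numConnectedSimple_eq (hcrit.even_total n)).symm
    · refine Eventually.of_forall fun n => ?_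
      simp only [Pi.mul_apply, Function.const_apply]
      rw [hinv, mul_assoc _ (Real.exp _), ← Real.exp_add, ← mul_assoc]
      congr 2
      ring
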